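/- **Setting.** A *crossingless connection* is a system of pairwise disjoint arcs, up to isotopy fixing the boundary points, in a rectangle with $m$ points $y_1,\dots,y_m$ on the left side and $m$ points $y'_1,\dots,y'_m$ on the right side (numbered downwards), $n_t$ points $x_1,x_2,\dots$ on the top side and $n_b$ points $x'_1,x'_2,\dots$ on the bottom side (numbered from left to right), joining these points in pairs; $m=\mathrm{ht}(C)$ is its height. An arc joining two top (bottom) points is a top (bottom) return. A *roof state* has no bottom returns, a *floor state* has no top returns, a *middle state* has neither; a *top* (*bottom*) *state* is a roof (floor) state of height $0$. $C_1*_vC_2$ denotes $C_1$ stacked on top of $C_2$; it is a formal symbol $K_0$ if $n_b(C_1)\ne n_t(C_2)$ or if a factor is $K_0$. If $n_t(C)=n_b(C)=n$ and $\mathrm{ht}(C)=m$, let $[[C]]_A=\sum_s A^{p(s)-n(s)}(-A^2-A^{-2})^{|D_s|}\in\mathbb Z[A^{\pm1}]$, where $s$ runs over the assignments of markers $\pm1$ to the crossings of the $m\times n$ grid (of $m$ horizontal and $n$ vertical lines) for which smoothing all crossings gives the connection $C$ together with $|D_s|$ closed components, and $p(s)$, $n(s)$ are the numbers of positive and negative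 markers. A positive marker joins the top end of the crossing to its right end and the left end to its bottom end; a negative marker joins the top end to the left end and the right end to the bottom end. Put $[[C]]_A=0$ if $n_t(C)\neq n_b(C)$, and $[[K_0]]_A=0$. For a bottom state $F$ with $n_b(F)=n$ let $\varphi_n(F)$ be the set of indices of the left ends of its bottom returns. The map $\varphi_n$ is injective; let $\mathcal L_n$ be its image. For a crossingless connection $C$ with $n_b(C)=n$ and a finite $I\subset\mathbb N$, let $C_I$ be the crossingless connection $C'$ with $C=C'*_v\varphi_n^{-1}(I)$ if $I\in\mathcal L_n$ and such a $C'$ exists, and $C_I=K_0$ otherwise; put $(K_0)_I=K_0$. For a roof state $R$ and a finite $I\subset\mathbb N$ let $\Theta_A(R,I;F)=[[R*_vF_I]]_A$, a function of $F$, where $F$ is a floor state or $F=K_0$. Let $n_I$ be the least $n$ with $I\in\mathcal L_n$, and let $I'\ominus I=\varphi_{n_{I'}-2|I|}\big((\varphi_{n_{I'}}^{-1}(I'))_I\big)$, which is defined if $(\varphi_{n_{I'}}^{-1}(I'))_I\ne K_0$. Write $(R,I)\trianglelefteq(R',I')$ if $I'\ominus I$ is defined and lies in $\mathcal L_{n_t(R)}$,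 $n_t(R)+2|I|=n_t(R')+2|I'|$ and $n_b(R)=n_b(R')$. For $0\le k\le n$, $k'=\min\{k,n-k\}$ and $0\le l\le k'$, define the following crossingless connections, each of which is determined by the stated data. * $R_{n,k}$ has height $n$, $n$ top points and $|n-2k|$ bottom points. It has $n-k$ arcs from the top to the left side, $k$ from the top to the right side, $k'$ from the left to the right side, and its bottom points are joined to the right side if $k\le n-k$ and to the left side if $k\ge n-k$. * $R'_{n,k,l}$ has height $0$, $n-2l$ top points and $|n-2k|$ bottom points. It has $k'-l$ nested parallel top returns, the innermost one (if any) joining $x_{k-l}$ to $x_{k-l+1}$; its other arcs join the top to the bottom. * $R''_{n,k,l}$ has height $n+k'-l$, $n$ top points and $n-2l$ bottom points. It has $n-k$ arcs from the top to the left side, $k$ from the top to the right side, $k'$ from the left to the right side, $k-l$ from the left side to the bottom and $n-k-l$ from the right side to the bottom. **Lemma 4.3 / Lemma 4.4.** Let $0\le k\le n$ and $k'=\min\{k,n-k\}$. The states $R_{n,k}$ and $R''_{n,k,|I|}$ are middle states, the states $R'_{n,k,|I|}$ are top states, and $(R_{n,k},\emptyset)\trianglelefteq(R'_{n,k,|I|},I)$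 for all $I\in\mathcal L_n$ with $|I|\le k'$. There are Laurent polynomials $Z_I(A)\in\mathbb Z[A^{\pm1}]$, for $I\in\mathcal L_n$ with $|I|\le k'$, such that $$\Theta_A(R_{n,k},\emptyset;F)=\sum_{I\in\mathcal L_n,\ |I|\le k'} Z_I(A)\,\Theta_A(R'_{n,k,|I|},I;F)$$ for every floor state $F$ and for $F=K_0$. Moreover, any Laurent polynomials $Z_I(A)\in\mathbb Z[A^{\pm1}]$ for which this holds are given by $$Z_I(A)=A^{(n-2k)(k'-|I|)}\,[[R''_{n,k,|I|}*_v\varphi_n^{-1}(I)]]_A ,$$ and all of them are nonzero. -/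

import Mathlib

open scoped LaurentPolynomial

namespace LatticeCrossing

noncomputable section

/-! ### Crossingless connections -/

/-- Labels of the points fixed on the boundary of a rectangle: `left i` is `y_i`, `right i` is
`y'_i` (both numbered downwards from the top), `top i` is `x_i`, `bot i` is `x'_i` (both numbered
from left to right).  Numbering starts at `1`. -/
inductive Pt : Type
  | left (i : ℕ)
  | right (i : ℕ)
  | top (i : ℕ)
  | bot (i : ℕ)

/-- `p.On h t b`: the label `p` is one of the fixed points of the rectangle that has `h` points on
its left side, `h` on its right side, `t` on its top side and `b` on its bottom side. -/
def Pt.On (h t b : ℕ) : Pt → Prop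
  | .left i => 1 ≤ i ∧ i ≤ h
  | .right i => 1 ≤ i ∧ i ≤ h
  | .top i => 1 ≤ i ∧ i ≤ t
  | .bot i => 1 ≤ i ∧ i ≤ b

/-- Position of a fixed point when the boundary of the rectangle is traversed counterclockwise,
starting at the upper left corner. -/
def Pt.pos (h t b : ℕ) : Pt → ℕ
  | .left i => i
  | .bot i => h + i
  | .right i => h + b + (h + 1 - i)
  | .top i => h + b + h + (t + 1 - i)

/-- A crossingless connection in a rectangle with `ht` left, `ht` right, `nt` top and `nb` bottom
points, up to isotopy rel boundary: a fixed-point-free involution `mate` on the set of boundary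
points (`mate p` is the other end of the arc that starts at `p`), no two of whose arcs cross.
On labels that are not fixed points of the rectangle `mate` is the identity, so that two
crossingless connections are equal iff they have the same points and the same arcs. -/
@[ext]
structure Conn : Type where
  ht : ℕ
  nt : ℕ
  nb : ℕ
  mate : Pt → Pt
  mate_on : ∀ p, p.On ht nt nb → (mate p).On ht nt nb
  mate_off : ∀ p, ¬ p.On ht nt nb → mate p = p
  mate_ne : ∀ p, p.On ht nt nb → mate p ≠ p
  mate_mate : ∀ p, mate (mate p) = p
  noncrossing : ∀ p q, p.On ht nt nb → q.On ht nt nb →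
    ¬ (p.pos ht nt nb < q.pos ht nt nb ∧ q.pos ht nt nb < (mate p).pos ht nt nb ∧
      (mate p).pos ht nt nb < (mate q).pos ht nt nb)

namespace Conn

/-- `p` is one of the boundary points of `C`. -/
def Bd (C : Conn) (p : Pt) : Prop := p.On C.ht C.nt C.nb

/-- No arc of `C` joins two top-boundary points. -/
def NoTopReturns (C : Conn) : Prop :=
  ∀ i j, C.Bd (.top i) → C.mate (.top i) ≠ .top j

/-- No arc of `C` joins two bottom-boundary points. -/
def NoBotReturns (C : Conn) : Prop :=
  ∀ i j, C.Bd (.bot i) → C.mate (.bot i) ≠ .bot j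

def IsRoof (C : Conn) : Prop := C.NoBotReturns

def IsFloor (C : Conn) : Prop := C.NoTopReturns

def IsMiddle (C : Conn) : Prop := C.IsRoof ∧ C.NoTopReturns

def IsTopState (C : Conn) : Prop := C.IsRoof ∧ C.ht = 0

def IsBottomState (C : Conn) : Prop := C.IsFloor ∧ C.ht = 0

end Conn

/-! ### Vertical product

The symbol `K₀` is represented by `none`, so crossingless connections together with `K₀` form the
type `Option Conn`. -/

/-- Elementary connections in the diagram obtained by putting `C` on top of `D`: along an arc of
`C`, along an arc of `D`, and across the common side, where the `j`-th bottom point of `C` is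
glued to the `j`-th top point of `D`. -/
inductive Glue (C D : Conn) : Pt ⊕ Pt → Pt ⊕ Pt → Prop
  | upper (p : Pt) : Glue C D (.inl p) (.inl (C.mate p))
  | lower (p : Pt) : Glue C D (.inr p) (.inr (D.mate p))
  | seam (j : ℕ) (h1 : 1 ≤ j) (h2 : j ≤ C.nb) : Glue C D (.inl (.bot j)) (.inr (.top j))

/-- The boundary point of `C` or of `D` that becomes the point `p` of the stacked rectangle. -/
def outer (C : Conn) : Pt → Pt ⊕ Pt
  | .left i => if i ≤ C.ht then .inl (.left i) else .inr (.left (i - C.ht))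
  | .right i => if i ≤ C.ht then .inl (.right i) else .inr (.right (i - C.ht))
  | .top i => .inl (.top i)
  | .bot i => .inr (.bot i)

/-- `E` is the crossingless connection obtained by stacking `C` on top of `D`: the numbers of
glued points agree, two boundary points of `E` are joined iff they are connected in the stacked
diagram, and that diagram has no closed components. -/
def IsVProd (C D E : Conn) : Prop :=
  C.nb = D.nt ∧ E.ht = C.ht + D.ht ∧ E.nt = C.nt ∧ E.nb = D.nb ∧
  (∀ p q, E.Bd p → E.Bd q →
    (E.mate p = q ↔ p ≠ q ∧ Relation.EqvGen (Glue C D) (outer C p) (outer C q))) ∧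
  (∀ j, 1 ≤ j → j ≤ C.nb →
    ∃ p, E.Bd p ∧ Relation.EqvGen (Glue C D) (.inl (.bot j)) (outer C p))

open Classical in
/-- The vertical product `C *ᵥ D`, with value `K₀` if one of the factors is `K₀` or if the numbers
of points on the common side differ. (For the products formed below, where the upper factor has no
bottom returns or the lower factor has no top returns, no closed component can arise.) -/
def vprod : Option Conn → Option Conn → Option Conn
  | some C, some D => if h : ∃ E, IsVProd C D E then some h.choose else none
  | _, _ => none

/-! ### Coefficients of Catalan states of the lattice crossing -/

/-- Segments into which the crossings cut the lines of the lattice crossing `L(m,n)`, whose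
crossings are the pairs `(i,j)` with `1 ≤ i ≤ m` (rows, downwards), `1 ≤ j ≤ n` (columns, from the
left): `hor i j` lies on the `i`-th horizontal line, between the columns `j` and `j + 1`, and
`ver i j` lies on the `j`-th vertical line, between the rows `i` and `i + 1`. -/
inductive Seg : Type
  | hor (i j : ℕ)
  | ver (i j : ℕ)

/-- The segments that occur in `L(m,n)`. -/
def Seg.In (m n : ℕ) : Seg → Prop
  | .hor i j => 1 ≤ i ∧ i ≤ m ∧ j ≤ n
  | .ver i j => i ≤ m ∧ 1 ≤ j ∧ j ≤ n

/-- The crossings of `L(m,n)`. -/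
def crossings (m n : ℕ) : Finset (ℕ × ℕ) := Finset.Icc 1 m ×ˢ Finset.Icc 1 n

/-- Smoothings according to a Kauffman state, which is given by the set `s` of crossings with
positive marker. A positive marker joins the upper end of the crossing to the right one and the
left end to the lower one; a negative marker joins the upper end to the left one and the right end
to the lower one. -/
inductive Smooth (m n : ℕ) (s : Finset (ℕ × ℕ)) : Seg → Seg → Prop
  | pos_up (i j : ℕ) (hc : (i, j) ∈ crossings m n) (hs : (i, j) ∈ s) :
      Smooth m n s (.ver (i - 1) j) (.hor i j)
  | pos_down (i j : ℕ) (hc : (i, j) ∈ crossings m n) (hs : (i, j) ∈ s) :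
      Smooth m n s (.hor i (j - 1)) (.ver i j)
  | neg_up (i j : ℕ) (hc : (i, j) ∈ crossings m n) (hs : (i, j) ∉ s) :
      Smooth m n s (.ver (i - 1) j) (.hor i (j - 1))
  | neg_down (i j : ℕ) (hc : (i, j) ∈ crossings m n) (hs : (i, j) ∉ s) :
      Smooth m n s (.hor i j) (.ver i j)

/-- The segment of `L(m,n)` that ends at a given boundary point. -/
def endSeg (m n : ℕ) : Pt → Seg
  | .left i => .hor i 0
  | .right i => .hor i n
  | .top j => .ver 0 j
  | .bot j => .ver m j

/-- `C_s = C`: two boundary points are joined by an arc of `C` iff they are connected in the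
smoothed diagram `D_s`. -/
def Realizes (s : Finset (ℕ × ℕ)) (C : Conn) : Prop :=
  ∀ p q, C.Bd p → C.Bd q →
    (C.mate p = q ↔ p ≠ q ∧
      Relation.EqvGen (Smooth C.ht C.nt s) (endSeg C.ht C.nt p) (endSeg C.ht C.nt q))

/-- `|D_s|`: the number of closed components of the smoothed diagram, that is, of the connected
components that reach no boundary point. -/
def closedCount (m n : ℕ) (s : Finset (ℕ × ℕ)) : ℕ :=
  Set.ncard {c : Quotient (Relation.EqvGen.setoid (Smooth m n s)) |
    (∃ x : Seg, x.In m n ∧ Quotient.mk _ x = c) ∧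
    ∀ p : Pt, p.On m n n → Quotient.mk _ (endSeg m n p) ≠ c}

open Classical in
/-- The coefficient `C(A)` of a Catalan state `C` of `L(m,n)`, where `m = ht(C)` and
`n = n_t(C) = n_b(C)`. The variable `A` is `T 1`, so `T r` is `A ^ r`. -/
def coeff (C : Conn) : ℤ[T;T⁻¹] :=
  ∑ s ∈ (crossings C.ht C.nt).powerset.filter (fun s => Realizes s C),
    LaurentPolynomial.T ((s.card : ℤ) - ((crossings C.ht C.nt \ s).card : ℤ)) *
      (-LaurentPolynomial.T 2 - LaurentPolynomial.T (-2)) ^ closedCount C.ht C.nt s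

/-- `[[C]]_A`. -/
def bracket : Option Conn → ℤ[T;T⁻¹]
  | some C => if C.nt = C.nb then coeff C else 0
  | none => 0

/-! ### Bottom states and removal of bottom returns -/

open Classical in
/-- `φ(F)`: the set of indices of the left ends of the bottom returns of `F`. -/
def phi (F : Conn) : Finset ℕ :=
  (Finset.Icc 1 F.nb).filter fun i => ∃ j, i < j ∧ F.mate (.bot i) = .bot j

open Classical in
/-- `𝓛_n`: the image of `φ_n`, i.e. of the set of bottom states with `n` bottom points. -/
def LL (n : ℕ) : Finset (Finset ℕ) :=
  (Finset.Icc 1 n).powerset.filter fun I =>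
    ∃ F : Conn, F.IsBottomState ∧ F.nb = n ∧ phi F = I

open Classical in
/-- `φ_n⁻¹(I)`, the bottom state with `n` bottom points whose bottom returns have their left ends
at `I`; the value is `K₀` if `I ∉ 𝓛_n`. -/
def phiInv (n : ℕ) (I : Finset ℕ) : Option Conn :=
  if h : ∃ F : Conn, F.IsBottomState ∧ F.nb = n ∧ phi F = I then some h.choose else none

open Classical in
/-- `C_I`: the crossingless connection `C'` such that `C = C' *ᵥ φ_n⁻¹(I)`, `n = n_b(C)`, if there
is one, and `K₀` otherwise. -/
def remove : Option Conn → Finset ℕ → Option Conn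
  | some C, I =>
      if h : ∃ C' : Conn, vprod (some C') (phiInv C.nb I) = some C then some h.choose else none
  | none, _ => none

/-- `Θ_A(R, I; F) = [[R *ᵥ F_I]]_A`, for a floor state `F` or `F = K₀`. -/
def Theta (R : Conn) (I : Finset ℕ) (F : Option Conn) : ℤ[T;T⁻¹] :=
  bracket (vprod (some R) (remove F I))

/-! ### The relation between pairs of roof states and index sets -/

/-- `n_I`, the least `n` with `I ∈ 𝓛_n`. -/
def minLevel (I : Finset ℕ) : ℕ := sInf {n | I ∈ LL n}

/-- `I ⊖ J`, the index set of `(φ⁻¹(I))_J` at level `n_I`; the value is `none` if it is not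
defined, i.e. unless `J ⪯ I`. -/
def ominus (I J : Finset ℕ) : Option (Finset ℕ) :=
  (remove (phiInv (minLevel I) I) J).map phi

/-- `(R, I) ⊴ (R', I')`, for pairs of roof states and finite index sets. -/
def Below (R : Conn) (I : Finset ℕ) (R' : Conn) (I' : Finset ℕ) : Prop :=
  R.IsRoof ∧ R'.IsRoof ∧
  (∃ K, ominus I' I = some K ∧ K ∈ LL R.nt) ∧
  R.nt + 2 * I.card = R'.nt + 2 * I'.card ∧
  R.nb = R'.nb

/-! ### The states `R_{n,k}`, `R'_{n,k,l}`, `R''_{n,k,l}` -/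

/-- The arcs of a state without returns and without arcs from top to bottom: `a` arcs around the
upper left corner, `b` around the upper right corner, `c` from left to right, `e` around the lower
left corner, `f` around the lower right corner. -/
def cornerMate (a b c e f : ℕ) : Pt → Pt
  | .top i =>
      if 1 ≤ i ∧ i ≤ a then .left i
      else if a < i ∧ i ≤ a + b then .right (a + b + 1 - i)
      else .top i
  | .left i =>
      if 1 ≤ i ∧ i ≤ a then .top i
      else if a < i ∧ i ≤ a + c then .right (b + (i - a))
      else if a + c < i ∧ i ≤ a + c + e then .bot (a + c + e + 1 - i)
      else .left i
  | .right i =>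
      if 1 ≤ i ∧ i ≤ b then .top (a + b + 1 - i)
      else if b < i ∧ i ≤ b + c then .left (a + (i - b))
      else if b + c < i ∧ i ≤ b + c + f then .bot (e + (i - (b + c)))
      else .right i
  | .bot i =>
      if 1 ≤ i ∧ i ≤ e then .left (a + c + e + 1 - i)
      else if e < i ∧ i ≤ e + f then .right (b + c + (i - e))
      else .bot i

/-- The crossingless connection with the arcs `cornerMate a b c e f`. -/
def cornerState (a b c e f : ℕ) (h : a + e = b + f) : Conn where
  ht := a + c + e
  nt := a + b
  nb := e + f
  mate := cornerMate a b c e f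
  mate_on := by
    rintro (i | i | i | i) hp <;> simp only [cornerMate, Pt.On] at hp ⊢ <;>
      split_ifs <;> simp only [] <;> omega
  mate_off := by
    rintro (i | i | i | i) hp <;> simp only [cornerMate, Pt.On] at hp ⊢ <;>
      split_ifs <;> first | rfl | omega
  mate_ne := by
    rintro (i | i | i | i) hp <;> simp only [cornerMate, Pt.On] at hp ⊢ <;>
      split_ifs <;> first | (intro hh; cases hh; done) | omega
  mate_mate := by
    rintro (i | i | i | i) <;> simp only [cornerMate] <;>
      split_ifs <;> simp only [cornerMate] <;> split_ifs <;>
      first | rfl | omega | (congr 1; omega)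
  noncrossing := by
    rintro (i | i | i | i) (j | j | j | j) hp hq <;>
      simp only [cornerMate, Pt.On] at hp hq ⊢ <;>
      split_ifs <;> simp only [Pt.pos] <;> omega

/-- The middle state `R_{n,k}`, `0 ≤ k ≤ n`: it has `n` left, `n` right, `n` top and `|n - 2k|`
bottom points; `n - k` arcs join the top to the left side, `k` join the top to the right side,
`min {k, n - k}` join the left to the right side, and the bottom points are joined to the right
side if `k ≤ n - k` and to the left side if `n - k ≤ k`. -/
def Rmid (n k : ℕ) : Conn :=
  cornerState (n - k) k (min k (n - k)) (k - (n - k)) ((n - k) - k) (by omega)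

/-- The middle state `R''_{n,k,l}`, `0 ≤ l ≤ min {k, n - k}`: it has `n` top and `n - 2l` bottom
points; `n - k = l + (n - k - l)` arcs join the top to the left side, `k = l + (k - l)` join the
top to the right side, `min {k, n - k}` join the left to the right side, `k - l` join the left side
to the bottom and `n - k - l` join the right side to the bottom. -/
def Rmid'' (n k l : ℕ) : Conn :=
  cornerState (l + (n - k - l)) (l + (k - l)) (min k (n - k)) (k - l) (n - k - l) (by omega)

/-- The arcs of the top state with `p + q` top points that has `min {p, q}` parallel top returns,
the innermost one joining `x_p` to `x_{p+1}`, the other top points being joined to the bottom. -/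
def nestMate (p q : ℕ) : Pt → Pt
  | .top i =>
      if p - min p q < i ∧ i ≤ p + min p q then .top (2 * p + 1 - i)
      else if 1 ≤ i ∧ i ≤ p - min p q then .bot i
      else if p + min p q < i ∧ i ≤ p + q then .bot (i - 2 * min p q)
      else .top i
  | .bot i =>
      if 1 ≤ i ∧ i ≤ p - min p q then .top i
      else if p - min p q < i ∧ i ≤ p + q - 2 * min p q then .top (i + 2 * min p q)
      else .bot i
  | .left i => .left i
  | .right i => .right i

/-- The top state with the arcs `nestMate p q`. -/
def nestState (p q : ℕ) : Conn where
  ht := 0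
  nt := p + q
  nb := p + q - 2 * min p q
  mate := nestMate p q
  mate_on := by
    rintro (i | i | i | i) hp <;> simp only [nestMate, Pt.On] at hp ⊢ <;>
      (try split_ifs) <;> (try simp only []) <;> omega
  mate_off := by
    rintro (i | i | i | i) hp <;> simp only [nestMate, Pt.On] at hp ⊢ <;>
      (try split_ifs) <;> first | rfl | omega
  mate_ne := by
    rintro (i | i | i | i) hp <;> simp only [nestMate, Pt.On] at hp ⊢ <;>
      (try split_ifs) <;>
      first
        | omega
        | (intro hh; cases hh; done)
        | (intro hh; injection hh; omega)
  mate_mate := by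
    rintro (i | i | i | i) <;> simp only [nestMate] <;>
      (try split_ifs) <;> (try simp only [nestMate]) <;> (try split_ifs) <;>
      first | rfl | omega | (congr 1; omega)
  noncrossing := by
    rintro (i | i | i | i) (j | j | j | j) hp hq <;>
      simp only [nestMate, Pt.On] at hp hq ⊢ <;>
      (try split_ifs) <;> simp only [Pt.pos] <;> omega

/-- The top state `R'_{n,k,l}`, `0 ≤ l ≤ min {k, n - k}`: it has `n - 2l` top and `|n - 2k|` bottom
points and `min {k, n - k} - l` parallel top returns, the innermost one joining `x_{k-l}` to
`x_{k-l+1}`; all other arcs join the top to the bottom. -/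
def Rtop' (n k l : ℕ) : Conn := nestState (k - l) (n - k - l)

/-- The sets `I ∈ 𝓛_n` with `|I| ≤ min {k, n - k}`; they index the pairs `(R'_{n,k,|I|}, I)`. -/
def indexSets (n k : ℕ) : Finset (Finset ℕ) :=
  (LL n).filter fun I => I.card ≤ min k (n - k)

/-- `Z` is a family of coefficients of an expansion of `Θ_A(R_{n,k}, ∅; ·)` into the functions
`Θ_A(R'_{n,k,|I|}, I; ·)`, as functions on floor states and `K₀`. -/
def IsExpansion (n k : ℕ) (Z : Finset ℕ → ℤ[T;T⁻¹]) : Prop :=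
  ∀ F : Option Conn, (∀ F₀ : Conn, F = some F₀ → F₀.IsFloor) →
    Theta (Rmid n k) ∅ F = ∑ I ∈ indexSets n k, Z I * Theta (Rtop' n k I.card) I F

end

end LatticeCrossing

/-!
The boundary of a rectangle with `h` left, `h` right, `t` top and `b` bottom points is cut open at the
lower right corner and traversed clockwise, so that a crossingless connection becomes a *word*: a
matching of the places `1 - b, …, 2 * h + t` without crossings (`Conn.word`). The coefficient of a
connection depends on its word only (`coeff_eq`), and arcs are added to a word by `ins u`, which
inserts an arc between two neighbours.

*Row expansion.* The coefficient of a word in `L(m+1,n)` is a sum over the sets `s₁` of positive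
markers of the first row (`wordCoeff_succ`). Each row cuts off arcs between neighbours at the top of the
diagram, one for each element of `rowArcs`, and its term vanishes unless the word has these arcs. If
there is one, `s₁ = [1,a]`, the row disappears together with the arc (`rowTerm_one`). If there are two,
`s₁ = [1,a] ∪ [b+1,e]`, then the first row leaves a cap over the columns `b`, `b + 1` of the remaining
lattice. This cap slides down through all the rows by Reidemeister's second move (`value_cap_pair`), so
that the term vanishes unless the word has the bottom return at `b`, which is then removed as well
(`rowTerm_two`, `rowTerm_two_zero`). All coefficients in the row expansion are powers of `A`.

*Existence.* The product of `R_{n,k}` and a floor state `F` has the word `twoPeak g c p q F.word`, with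
the arcs `(^c (^p )^p (^q )^q )^c` inserted into the word of `F` (`isVProd_twoPeak`). At the top of such a
word only the two peaks join neighbours, so that a row removes one peak, or both and a bottom
return; which of these happens does not depend on `F` (`rowTerm_twoPeak`). After `n` rows the arcs
`(^p )^p` and `(^q )^q` are used up, and what remains is the product of some `R'_{n,k,|I|}` and `F_I`
(`atRest_mem_thetaSpan`).

*Uniqueness.* For `I ∈ 𝓛_n` the word of the bottom state `φ_n⁻¹(I)` is also the word of a floor state of
height `k' - |I|`. On this floor state the function belonging to `J` vanishes unless `J ⊆ I`, since
only returns that are present can be removed, and it vanishes for `J ⊊ I` as the nest of `k' - |J|` arcs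
is deeper than the lattice crossing is high (`wordCoeff_nest_eq_zero`). For `J = I` it is a power of `A`
(`wordCoeff_nest`), and the left-hand side is `[[R''_{n,k,|I|} *ᵥ φ_n⁻¹(I)]]`, because both products have the
same word (`IsExpansion.eq`).

*Nonvanishing.* At `A = 1` every term of the row expansion of `R''_{n,k,|I|} *ᵥ φ_n⁻¹(I)` is nonnegative, and
one sequence of rows leads to `1` (`evalOne_pos`).
-/

open scoped LaurentPolynomial
namespace LatticeCrossing
noncomputable section

/-! ### Words: matchings of the boundary, cut open at the lower right corner -/

/-- The increasing map `ℤ → ℤ` whose image misses exactly `u` and `u + 1`. The gap is made by moving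
the upper part up by two if `u ≥ 1`, and by moving the lower part down by two otherwise, so that
the place between `0` and `1` (the lower left corner of the rectangle) keeps its number. -/
def sk (u x : ℤ) : ℤ := if 1 ≤ u then (if x < u then x else x + 2) else (if u + 1 < x then x else x - 2)

/-- The left inverse of `sk u`. -/
def un (u x : ℤ) : ℤ := if 1 ≤ u then (if x < u then x else x - 2) else (if u + 1 < x then x else x + 2)

/-- Insertion into the matching `M` of an arc that joins the neighbours `u` and `u + 1`. -/
def ins (u : ℤ) (M : ℤ → ℤ) (x : ℤ) : ℤ :=
  if x = u then u + 1 else if x = u + 1 then u else sk u (M (un u x))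

theorem un_sk (u x : ℤ) : un u (sk u x) = x := by
  unfold un sk; split_ifs <;> omega

theorem sk_un {u x : ℤ} (h1 : x ≠ u) (h2 : x ≠ u + 1) : sk u (un u x) = x := by
  unfold un sk; split_ifs <;> omega

theorem sk_ne (u x : ℤ) : sk u x ≠ u := by unfold sk; split_ifs <;> omega

theorem sk_ne' (u x : ℤ) : sk u x ≠ u + 1 := by unfold sk; split_ifs <;> omega

theorem sk_lt_iff (u x y : ℤ) : sk u x < sk u y ↔ x < y := by
  unfold sk; split_ifs <;> omega

theorem sk_inj {u x y : ℤ} : sk u x = sk u y ↔ x = y :=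
  ⟨fun h => by rw [← un_sk u x, h, un_sk], fun h => by rw [h]⟩

theorem ins_self (u : ℤ) (M : ℤ → ℤ) : ins u M u = u + 1 := by simp [ins]

theorem ins_succ (u : ℤ) (M : ℤ → ℤ) : ins u M (u + 1) = u := by simp [ins]

theorem ins_sk (u : ℤ) (M : ℤ → ℤ) (x : ℤ) : ins u M (sk u x) = sk u (M x) := by
  rw [ins, if_neg (sk_ne u x), if_neg (sk_ne' u x), un_sk]

/-- Every number is `u`, `u + 1` or in the image of `sk u`. -/
theorem sk_cases (u x : ℤ) : x = u ∨ x = u + 1 ∨ ∃ y, x = sk u y := by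
  by_cases h1 : x = u
  · exact Or.inl h1
  by_cases h2 : x = u + 1
  · exact Or.inr (Or.inl h2)
  exact Or.inr (Or.inr ⟨un u x, (sk_un h1 h2).symm⟩)

theorem ins_injective {u : ℤ} {M M' : ℤ → ℤ} (h : ins u M = ins u M') : M = M' := by
  funext x
  have := congrFun h (sk u x)
  rw [ins_sk, ins_sk] at this
  exact sk_inj.1 this

/-- A matching that joins `u` to `u + 1` arises by insertion of that arc. -/
theorem exists_eq_ins {M : ℤ → ℤ} (hM : ∀ x, M (M x) = x) {u : ℤ} (hu : M u = u + 1) :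
    ∃ M', M = ins u M' := by
  have hu' : M (u + 1) = u := by rw [← hu, hM]
  refine ⟨fun x => un u (M (sk u x)), ?_⟩
  funext x
  rcases sk_cases u x with rfl | rfl | ⟨y, rfl⟩
  · rw [ins_self, hu]
  · rw [ins_succ, hu']
  · rw [ins_sk, sk_un]
    · intro h
      exact sk_ne' u y (by rw [← hM (sk u y), h, hu])
    · intro h
      exact sk_ne u y (by rw [← hM (sk u y), h, hu'])

/-- `IsWord n U M`: `M` is a fixed-point-free involution without crossings on `{1 - n, …, U}`, and
the identity elsewhere. -/
structure IsWord (n U : ℤ) (M : ℤ → ℤ) : Prop where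
  invol : ∀ x, M (M x) = x
  off : ∀ x, x < 1 - n ∨ U < x → M x = x
  ne : ∀ x, 1 - n ≤ x → x ≤ U → M x ≠ x
  nc : ∀ x y, x < y → y < M x → M x < M y → False

theorem ins_invol_iff {u : ℤ} {M : ℤ → ℤ} :
    (∀ x, ins u M (ins u M x) = x) ↔ ∀ x, M (M x) = x := by
  constructor
  · intro h x
    have := h (sk u x)
    rwa [ins_sk, ins_sk, sk_inj] at this
  · intro h x
    rcases sk_cases u x with rfl | rfl | ⟨y, rfl⟩
    · rw [ins_self, ins_succ]
    · rw [ins_succ, ins_self]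
    · rw [ins_sk, ins_sk, h]

theorem ins_nc {u : ℤ} {M : ℤ → ℤ} (h : ∀ x y, x < y → y < M x → M x < M y → False) :
    ∀ x y, x < y → y < ins u M x → ins u M x < ins u M y → False := by
  intro x y h1 h2 h3
  rcases sk_cases u x with rfl | rfl | ⟨x, rfl⟩
  · rw [ins_self] at h2; omega
  · rw [ins_succ] at h2; omega
  rcases sk_cases u y with rfl | rfl | ⟨y, rfl⟩
  · rw [ins_self] at h3
    have := sk_ne y (M x); have := sk_ne' y (M x)
    rw [ins_sk] at h2 h3; omega
  · rw [ins_succ] at h3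
    rw [ins_sk] at h2 h3; omega
  rw [ins_sk] at h2 h3
  rw [ins_sk] at h3
  rw [sk_lt_iff] at h1 h2 h3
  exact h x y h1 h2 h3

theorem nc_of_ins {u : ℤ} {M : ℤ → ℤ}
    (h : ∀ x y, x < y → y < ins u M x → ins u M x < ins u M y → False) :
    ∀ x y, x < y → y < M x → M x < M y → False := by
  intro x y h1 h2 h3
  rw [← sk_lt_iff u] at h1 h2 h3
  rw [← ins_sk] at h2 h3
  rw [← ins_sk] at h3
  exact h _ _ h1 h2 h3

/-- Insertion of an arc turns words on a range into words on the range with two more places. -/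
theorem isWord_ins_aux {n U n' U' u : ℤ} {M : ℤ → ℤ}
    (hr : ∀ x, (1 - n ≤ x ∧ x ≤ U) ↔ (1 - n' ≤ sk u x ∧ sk u x ≤ U'))
    (hu : 1 - n' ≤ u ∧ u + 1 ≤ U') : IsWord n' U' (ins u M) ↔ IsWord n U M := by
  constructor
  · intro h
    refine ⟨ins_invol_iff.1 h.invol, fun x hx => ?_, fun x h1 h2 => ?_, nc_of_ins h.nc⟩
    · have := h.off (sk u x) (by have := hr x; omega)
      rwa [ins_sk, sk_inj] at this
    · have := h.ne (sk u x) ((hr x).1 ⟨h1, h2⟩).1 ((hr x).1 ⟨h1, h2⟩).2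
      rwa [ins_sk, Ne, sk_inj] at this
  · intro h
    refine ⟨ins_invol_iff.2 h.invol, fun x hx => ?_, fun x h1 h2 => ?_, ins_nc h.nc⟩
    · rcases sk_cases u x with rfl | rfl | ⟨y, rfl⟩
      · omega
      · omega
      · rw [ins_sk, h.off y (by have := hr y; omega)]
    · rcases sk_cases u x with rfl | rfl | ⟨y, rfl⟩
      · rw [ins_self]; omega
      · rw [ins_succ]; omega
      · rw [ins_sk, Ne, sk_inj]
        exact h.ne y ((hr y).2 ⟨h1, h2⟩).1 ((hr y).2 ⟨h1, h2⟩).2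

theorem isWord_ins_up {n U u : ℤ} {M : ℤ → ℤ} (hn : 0 ≤ n) (h1 : 1 ≤ u) (h2 : u ≤ U + 1) :
    IsWord n (U + 2) (ins u M) ↔ IsWord n U M :=
  isWord_ins_aux (fun x => by unfold sk; split_ifs <;> omega) (by omega)

theorem isWord_ins_down {n U u : ℤ} {M : ℤ → ℤ} (hU : 0 ≤ U) (h1 : u ≤ -1) (h2 : -u ≤ n + 1) :
    IsWord (n + 2) U (ins u M) ↔ IsWord n U M :=
  isWord_ins_aux (fun x => by unfold sk; split_ifs <;> omega) (by omega)

theorem ins_of_eq_sk {u x y : ℤ} (M : ℤ → ℤ) (h : x = sk u y) : ins u M x = sk u (M y) := by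
  rw [h, ins_sk]

/-- Insertions at the top and at the bottom commute. -/
theorem ins_comm_up_down {u v : ℤ} (hu : 1 ≤ u) (hv : v ≤ -1) (M : ℤ → ℤ) :
    ins u (ins v M) = ins v (ins u M) := by
  have hs : ∀ y, sk u (sk v y) = sk v (sk u y) := by
    intro y; unfold sk; split_ifs <;> omega
  funext x
  rcases sk_cases u x with rfl | rfl | ⟨x, rfl⟩
  · rw [ins_self, ins_of_eq_sk (y := x), ins_self] <;> unfold sk <;> split_ifs <;> omega
  · rw [ins_succ, ins_of_eq_sk (y := u + 1), ins_succ] <;> unfold sk <;> split_ifs <;> omega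
  rcases sk_cases v x with rfl | rfl | ⟨x, rfl⟩
  · have : sk u x = x := by unfold sk; split_ifs <;> omega
    rw [ins_sk, this, ins_self, ins_self]; unfold sk; split_ifs <;> omega
  · have : sk u (v + 1) = v + 1 := by unfold sk; split_ifs <;> omega
    rw [ins_sk, this, ins_succ, ins_succ]; unfold sk; split_ifs <;> omega
  · rw [ins_sk, ins_sk, hs, hs, ins_sk, ins_sk]

/-- An insertion behind another one, in the order in which it does not shift the other one. -/
theorem ins_comm_up {u v : ℤ} (hu : 1 ≤ u) (hv : u ≤ v) (M : ℤ → ℤ) :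
    ins u (ins v M) = ins (v + 2) (ins u M) := by
  have hs : ∀ y, sk u (sk v y) = sk (v + 2) (sk u y) := by
    intro y; unfold sk; split_ifs <;> omega
  funext x
  rcases sk_cases u x with rfl | rfl | ⟨x, rfl⟩
  · rw [ins_self, ins_of_eq_sk (y := x), ins_self] <;> unfold sk <;> split_ifs <;> omega
  · rw [ins_succ, ins_of_eq_sk (y := u + 1), ins_succ] <;> unfold sk <;> split_ifs <;> omega
  rcases sk_cases v x with rfl | rfl | ⟨x, rfl⟩
  · have : sk u x = x + 2 := by unfold sk; split_ifs <;> omega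
    rw [ins_sk, this, ins_self, ins_self]; unfold sk; split_ifs <;> omega
  · have : sk u (v + 1) = v + 2 + 1 := by unfold sk; split_ifs <;> omega
    rw [ins_sk, this, ins_succ, ins_succ]; unfold sk; split_ifs <;> omega
  · rw [ins_sk, ins_sk, hs, hs, ins_sk, ins_sk]

/-- `k` nested arcs on the places `u, …, u + 2 * k - 1`, inserted into `M`. -/
def nest (u : ℤ) : ℕ → (ℤ → ℤ) → (ℤ → ℤ)
  | 0, M => M
  | k + 1, M => ins (u + k) (nest u k M)

theorem nest_succ (u : ℤ) (k : ℕ) (M : ℤ → ℤ) : nest u (k + 1) M = ins (u + k) (nest u k M) := rfl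

/-- The arcs of `M` that start before the nest keep their ends, up to the shift by `2 * k`. -/
theorem nest_apply_lt {u : ℤ} (hu : 1 ≤ u) (k : ℕ) (M : ℤ → ℤ) {x : ℤ} (hx : x < u) :
    nest u k M x = if M x < u then M x else M x + 2 * k := by
  induction k with
  | zero => simp [nest]
  | succ k ih =>
    have : x = sk (u + k) x := by unfold sk; split_ifs <;> omega
    rw [nest_succ, this, ins_sk, ← this, ih]
    unfold sk; push_cast; split_ifs <;> omega

theorem nest_apply_mid {u : ℤ} (hu : 1 ≤ u) (k : ℕ) (M : ℤ → ℤ) {x : ℤ} (hx : u ≤ x)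
    (hx' : x < u + 2 * k) : nest u k M x = 2 * u + 2 * k - 1 - x := by
  induction k generalizing x with
  | zero => push_cast at hx'; omega
  | succ k ih =>
    push_cast at hx'
    rw [nest_succ]
    rcases sk_cases (u + k) x with rfl | rfl | ⟨y, rfl⟩
    · rw [ins_self]; push_cast; omega
    · rw [ins_succ]; push_cast; omega
    · have hy : u ≤ y ∧ y < u + 2 * k := by
        revert hx hx'; unfold sk; split_ifs <;> omega
      rw [ins_sk, ih hy.1 hy.2]
      unfold sk; push_cast; split_ifs <;> omega

theorem nest_apply_ge {u : ℤ} (hu : 1 ≤ u) (k : ℕ) (M : ℤ → ℤ) {x : ℤ} (hx : u + 2 * k ≤ x) :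
    nest u k M x = if M (x - 2 * k) < u then M (x - 2 * k) else M (x - 2 * k) + 2 * k := by
  induction k generalizing x with
  | zero => simp [nest]
  | succ k ih =>
    push_cast at hx
    have : x = sk (u + k) (x - 2) := by unfold sk; split_ifs <;> omega
    have h2 : x - 2 - 2 * (k : ℤ) = x - 2 * ((k + 1 : ℕ) : ℤ) := by push_cast; ring
    rw [nest_succ, this, ins_sk, ih (by omega), ← this, h2]
    unfold sk; push_cast; split_ifs <;> omega

theorem ins_nest_comm {u v : ℤ} (hu : 1 ≤ u) (hv : u ≤ v) (k : ℕ) (M : ℤ → ℤ) :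
    nest u k (ins v M) = ins (v + 2 * k) (nest u k M) := by
  induction k with
  | zero => simp [nest]
  | succ k ih =>
    rw [nest_succ, nest_succ, ih, ins_comm_up (by omega) (by omega)]
    congr 1; push_cast; ring

theorem nest_ins_down {u v : ℤ} (hu : 1 ≤ u) (hv : v ≤ -1) (k : ℕ) (M : ℤ → ℤ) :
    nest u k (ins v M) = ins v (nest u k M) := by
  induction k with
  | zero => rfl
  | succ k ih => rw [nest_succ, nest_succ, ih, ins_comm_up_down (by omega) hv]

theorem isWord_nest {n U u : ℤ} {M : ℤ → ℤ} (hn : 0 ≤ n) (h1 : 1 ≤ u) (h2 : u ≤ U + 1) (k : ℕ)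
    (h : IsWord n U M) : IsWord n (U + 2 * k) (nest u k M) := by
  induction k with
  | zero => simpa [nest] using h
  | succ k ih =>
    have := (isWord_ins_up (u := u + k) hn (by omega) (by omega)).2 ih
    rw [nest_succ]
    convert this using 1
    push_cast; ring

/-- The arcs `(^c (^p )^p (^q )^q )^c`, inserted into `M` behind the place `g`. -/
def twoPeak (g : ℤ) (c p q : ℕ) (M : ℤ → ℤ) : ℤ → ℤ :=
  nest (g + c + 1) p (nest (g + c + 1) q (nest (g + 1) c M))

theorem isWord_twoPeak {n U g : ℤ} {M : ℤ → ℤ} (hn : 0 ≤ n) (h1 : 0 ≤ g) (h2 : g ≤ U) (c p q : ℕ)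
    (h : IsWord n U M) : IsWord n (U + 2 * c + 2 * q + 2 * p) (twoPeak g c p q M) :=
  isWord_nest hn (by omega) (by omega) p
    (isWord_nest hn (by omega) (by omega) q (isWord_nest hn (by omega) (by omega) c h))

theorem twoPeak_ins_down {g v : ℤ} (hg : 0 ≤ g) (hv : v ≤ -1) (c p q : ℕ) (M : ℤ → ℤ) :
    twoPeak g c p q (ins v M) = ins v (twoPeak g c p q M) := by
  simp only [twoPeak]
  rw [nest_ins_down (by omega) hv, nest_ins_down (by omega) hv, nest_ins_down (by omega) hv]

theorem twoPeak_succ_left (g : ℤ) (c p q : ℕ) (M : ℤ → ℤ) :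
    twoPeak g c (p + 1) q M = ins (g + c + p + 1) (twoPeak g c p q M) := by
  simp only [twoPeak]
  rw [nest_succ]; congr 1; ring

theorem twoPeak_succ_right {g : ℤ} (hg : 0 ≤ g) (c p q : ℕ) (M : ℤ → ℤ) :
    twoPeak g c p (q + 1) M = ins (g + c + 2 * p + q + 1) (twoPeak g c p q M) := by
  simp only [twoPeak]
  rw [nest_succ, ins_nest_comm (by omega) (by omega)]; congr 1; ring

theorem twoPeak_succ_base (g : ℤ) (c : ℕ) (M : ℤ → ℤ) :
    twoPeak g (c + 1) 0 0 M = ins (g + c + 1) (twoPeak g c 0 0 M) := by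
  simp only [twoPeak, nest]
  congr 1; ring

/-- Neighbours joined after the insertion of nested arcs: the innermost pair, or a pair of neighbours
that were joined before. -/
theorem nest_adj {u : ℤ} (hu : 1 ≤ u) {k : ℕ} {M : ℤ → ℤ} {x : ℤ} (h : nest u k M x = x + 1) :
    (1 ≤ k ∧ x = u + k - 1) ∨ (k = 0 ∧ M x = x + 1) ∨ (x + 1 < u ∧ M x = x + 1) ∨
      (u + 2 * k ≤ x ∧ M (x - 2 * k) = x - 2 * k + 1) := by
  by_cases h1 : x < u
  · rw [nest_apply_lt hu k M h1] at h
    split_ifs at h <;> omega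
  · by_cases h2 : x < u + 2 * k
    · rw [nest_apply_mid hu k M (by omega) h2] at h
      omega
    · rw [nest_apply_ge hu k M (by omega)] at h
      split_ifs at h <;> omega

/-- Neighbours joined in `twoPeak g c p q M`, at places between `h` and `h + t + 2 (c + p + q)`,
are the peaks, if `M` joins no neighbours between `h` and `h + t`. -/
theorem twoPeak_adj {g h t : ℤ} (hh : 0 ≤ h) (hg : h ≤ g) (hg' : g ≤ h + t) {c p q : ℕ} {M : ℤ → ℤ}
    (hM : ∀ x, h < x → x < h + t → M x ≠ x + 1) {x : ℤ} (hx : h < x)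
    (hx' : x < h + t + 2 * (c + p + q)) (hadj : twoPeak g c p q M x = x + 1) :
    (1 ≤ p ∧ x = g + c + p) ∨ (1 ≤ q ∧ x = g + c + 2 * p + q) ∨
      (p = 0 ∧ q = 0 ∧ 1 ≤ c ∧ x = g + c) := by
  have h0 : ∀ y, h < y → y < h + t + 2 * c → nest (g + 1) c M y = y + 1 → 1 ≤ c ∧ y = g + c := by
    intro y hy hy' h1
    rcases nest_adj (by omega) h1 with h2 | h2 | h2 | h2
    · omega
    · exact absurd h2.2 (hM _ (by omega) (by omega))
    · exact absurd h2.2 (hM _ (by omega) (by omega))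
    · exact absurd h2.2 (hM _ (by omega) (by omega))
  have h1 : ∀ y, h < y → y < h + t + 2 * c + 2 * q →
      nest (g + c + 1) q (nest (g + 1) c M) y = y + 1 →
      (1 ≤ q ∧ y = g + c + q) ∨ (q = 0 ∧ 1 ≤ c ∧ y = g + c) := by
    intro y hy hy' h1
    rcases nest_adj (by omega) h1 with h2 | h2 | h2 | h2
    · omega
    · have := h0 _ (by omega) (by omega) h2.2
      omega
    · have := h0 _ (by omega) (by omega) h2.2
      omega
    · have := h0 _ (by omega) (by omega) h2.2
      omega
  rcases nest_adj (by omega) hadj with h2 | h2 | h2 | h2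
  · omega
  · have := h1 _ (by omega) (by omega) h2.2
    omega
  · have := h1 _ (by omega) (by omega) h2.2
    omega
  · have := h1 _ (by omega) (by omega) h2.2
    omega

/-! ### Systems of bottom returns -/

/-- Insertion of bottom returns, the first one of the list last. The entry `b` stands for a return
that joins the `b`-th bottom point to the next one. -/
def insBot : List ℕ → (ℤ → ℤ) → (ℤ → ℤ)
  | [], M => M
  | b :: bs, M => ins (-(b : ℤ)) (insBot bs M)

/-- The list `bs` can be used for insertions that lead to `n` bottom points. -/
def ValidBot : ℕ → List ℕ → Prop
  | _, [] => True
  | n, b :: bs => 1 ≤ b ∧ b + 1 ≤ n ∧ ValidBot (n - 2) bs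

theorem ValidBot.length_le {n : ℕ} {bs : List ℕ} (h : ValidBot n bs) : 2 * bs.length ≤ n := by
  induction bs generalizing n with
  | nil => simp
  | cons b bs ih =>
    have := ih h.2.2
    have := h.1; have := h.2.1
    simp only [List.length_cons]; omega

theorem insBot_injective {bs : List ℕ} {M M' : ℤ → ℤ} (h : insBot bs M = insBot bs M') : M = M' := by
  induction bs with
  | nil => exact h
  | cons b bs ih => exact ih (ins_injective h)

theorem insBot_append (bs : List ℕ) (b : ℕ) (M : ℤ → ℤ) :
    insBot (bs ++ [b]) M = insBot bs (ins (-(b : ℤ)) M) := by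
  induction bs with
  | nil => rfl
  | cons b' bs ih => simp only [List.cons_append, insBot, ih]

theorem ValidBot.append {n : ℕ} {bs : List ℕ} {b : ℕ} (h : ValidBot n bs) (h1 : 1 ≤ b)
    (h2 : b + 1 ≤ n - 2 * bs.length) : ValidBot n (bs ++ [b]) := by
  induction bs generalizing n with
  | nil => exact ⟨h1, by simpa using h2, trivial⟩
  | cons b' bs ih =>
    refine ⟨h.1, h.2.1, ih h.2.2 ?_⟩
    simp only [List.length_cons] at h2
    omega

theorem isWord_insBot {n : ℕ} {U : ℤ} {bs : List ℕ} {M : ℤ → ℤ} (hU : 0 ≤ U) (h : ValidBot n bs) :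
    IsWord n U (insBot bs M) ↔ IsWord (n - 2 * bs.length : ℕ) U M := by
  induction bs generalizing n with
  | nil => simp [insBot]
  | cons b bs ih =>
    have h1 := h.1
    have h2 := h.2.1
    have e : (n : ℤ) = ((n - 2 : ℕ) : ℤ) + 2 := by omega
    rw [insBot, e, isWord_ins_down hU (by omega) (by omega), ih h.2.2, List.length_cons]
    have : n - 2 - 2 * bs.length = n - 2 * (bs.length + 1) := by omega
    rw [this]

/-! ### Components of a diagram and the value of a smoothing -/

/-- The number of classes of the equivalence relation generated by `r` that meet `S` and contain no
`seg x` with `x ∈ D`. -/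
def closedComps {α : Type} (r : α → α → Prop) (S : Set α) (D : Set ℤ) (seg : ℤ → α) : ℕ :=
  Set.ncard {c : Quot r | (∃ x ∈ S, Quot.mk r x = c) ∧ ∀ p ∈ D, Quot.mk r (seg p) ≠ c}

/-- The classes of the equivalence relation generated by `r` join the places in `D` in the same way
as the matching `M` does. -/
def Induces {α : Type} (r : α → α → Prop) (D : Set ℤ) (seg : ℤ → α) (M : ℤ → ℤ) : Prop :=
  ∀ x ∈ D, ∀ y ∈ D, (M x = y ↔ x ≠ y ∧ Quot.mk r (seg x) = Quot.mk r (seg y))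

/-- The value of a closed component. -/
def loopVal : ℤ[T;T⁻¹] := -LaurentPolynomial.T 2 - LaurentPolynomial.T (-2)

open Classical in
/-- The contribution of the diagram `(r, S)` to the coefficient of the matching `M`. -/
def value {α : Type} (r : α → α → Prop) (S : Set α) (D : Set ℤ) (seg : ℤ → α) (M : ℤ → ℤ) :
    ℤ[T;T⁻¹] :=
  if Induces r D seg M then loopVal ^ closedComps r S D seg else 0

theorem ncard_congr_of_maps {β γ : Type} {A : Set β} {B : Set γ} (f : β → γ) (g : γ → β)
    (hf : ∀ x ∈ A, f x ∈ B) (hg : ∀ y ∈ B, g y ∈ A) (hgf : ∀ x ∈ A, g (f x) = x)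
    (hfg : ∀ y ∈ B, f (g y) = y) : A.ncard = B.ncard := by
  have hinj : Set.InjOn f A := fun x hx y hy h => by rw [← hgf x hx, h, hgf y hy]
  have himg : f '' A = B := by
    ext y
    constructor
    · rintro ⟨x, hx, rfl⟩; exact hf x hx
    · intro hy; exact ⟨g y, hg y hy, hfg y hy⟩
  rw [← himg, hinj.ncard_image]

/-- Two diagrams with maps between them that are inverse to each other on components, and compatible
with the boundary, have the same value. -/
theorem value_congr {α β : Type} {r : α → α → Prop} {r' : β → β → Prop} {S : Set α} {S' : Set β}
    {D : Set ℤ} {seg : ℤ → α} {seg' : ℤ → β} (M : ℤ → ℤ) (f : α → β) (g : β → α)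
    (hf : ∀ x y, r x y → Quot.mk r' (f x) = Quot.mk r' (f y))
    (hg : ∀ x y, r' x y → Quot.mk r (g x) = Quot.mk r (g y))
    (hS : ∀ x ∈ S, ∃ y ∈ S', Quot.mk r' y = Quot.mk r' (f x))
    (hS' : ∀ x ∈ S', ∃ y ∈ S, Quot.mk r y = Quot.mk r (g x))
    (hgf : ∀ x ∈ S, Quot.mk r (g (f x)) = Quot.mk r x)
    (hfg : ∀ x ∈ S', Quot.mk r' (f (g x)) = Quot.mk r' x)
    (hseg : ∀ p ∈ D, Quot.mk r' (f (seg p)) = Quot.mk r' (seg' p))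
    (hseg' : ∀ p ∈ D, Quot.mk r (g (seg' p)) = Quot.mk r (seg p)) :
    value r S D seg M = value r' S' D seg' M := by
  let F : Quot r → Quot r' := Quot.lift (fun x => Quot.mk r' (f x)) hf
  let G : Quot r' → Quot r := Quot.lift (fun x => Quot.mk r (g x)) hg
  have hF : ∀ p ∈ D, F (Quot.mk r (seg p)) = Quot.mk r' (seg' p) := hseg
  have hG : ∀ p ∈ D, G (Quot.mk r' (seg' p)) = Quot.mk r (seg p) := hseg'
  have h1 : Induces r D seg M ↔ Induces r' D seg' M := by
    have : ∀ x ∈ D, ∀ y ∈ D, (Quot.mk r (seg x) = Quot.mk r (seg y) ↔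
        Quot.mk r' (seg' x) = Quot.mk r' (seg' y)) := by
      intro x hx y hy
      constructor
      · intro h; rw [← hF x hx, ← hF y hy, h]
      · intro h; rw [← hG x hx, ← hG y hy, h]
    unfold Induces
    constructor
    · intro h x hx y hy; rw [h x hx y hy, this x hx y hy]
    · intro h x hx y hy; rw [h x hx y hy, this x hx y hy]
  have h2 : closedComps r S D seg = closedComps r' S' D seg' := by
    refine ncard_congr_of_maps F G ?_ ?_ ?_ ?_
    · rintro _ ⟨⟨x, hx, rfl⟩, h⟩
      refine ⟨(hS x hx), fun p hp h' => h p hp ?_⟩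
      rw [← hG p hp, h']; exact hgf x hx
    · rintro _ ⟨⟨x, hx, rfl⟩, h⟩
      refine ⟨(hS' x hx), fun p hp h' => h p hp ?_⟩
      rw [← hF p hp, h']; exact hfg x hx
    · rintro _ ⟨⟨x, hx, rfl⟩, -⟩; exact hgf x hx
    · rintro _ ⟨⟨x, hx, rfl⟩, -⟩; exact hfg x hx
  unfold value
  rw [h2]
  by_cases h : Induces r D seg M
  · rw [if_pos h, if_pos (h1.1 h)]
  · rw [if_neg h, if_neg (fun h' => h (h1.2 h'))]

/-- No edge starts or ends at `v`. -/
def Isolated {α : Type} (r : α → α → Prop) (v : α) : Prop := ∀ x, ¬ r v x ∧ ¬ r x v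

theorem Isolated.mk_eq {α : Type} {r : α → α → Prop} {v x : α} (h : Isolated r v) :
    Quot.mk r x = Quot.mk r v ↔ x = v := by
  constructor
  · intro e
    let P : Quot r → Prop := Quot.lift (fun y => y = v) (by
      intro a b hab
      have h1 : a ≠ v := fun e => (h b).1 (e ▸ hab)
      have h2 : b ≠ v := fun e => (h a).2 (e ▸ hab)
      simp [h1, h2])
    have : P (Quot.mk r v) := rfl
    rw [← e] at this
    exact this
  · rintro rfl; rfl

/-- An isolated vertex off the boundary is a closed component. -/
theorem value_insert_isolated {α : Type} {r : α → α → Prop} {S : Set α} {D : Set ℤ} {seg : ℤ → α}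
    (M : ℤ → ℤ) {v : α} (hv : Isolated r v) (hS : S.Finite) (hvS : v ∉ S)
    (hvD : ∀ p ∈ D, seg p ≠ v) :
    value r (insert v S) D seg M = loopVal * value r S D seg M := by
  have : closedComps r (insert v S) D seg = closedComps r S D seg + 1 := by
    have hfin : {c : Quot r | (∃ x ∈ S, Quot.mk r x = c) ∧
        ∀ p ∈ D, Quot.mk r (seg p) ≠ c}.Finite := by
      refine Set.Finite.subset (hS.image (Quot.mk r)) ?_
      rintro _ ⟨⟨x, hx, rfl⟩, -⟩
      exact ⟨x, hx, rfl⟩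
    unfold closedComps
    rw [← Set.ncard_insert_of_notMem (a := Quot.mk r v) ?_ hfin]
    · congr 1
      ext c
      constructor
      · rintro ⟨⟨x, rfl | hx, rfl⟩, h⟩
        · exact Or.inl rfl
        · exact Or.inr ⟨⟨x, hx, rfl⟩, h⟩
      · rintro (rfl | ⟨⟨x, hx, rfl⟩, h⟩)
        · exact ⟨⟨v, Or.inl rfl, rfl⟩, fun p hp h => hvD p hp (hv.mk_eq.1 h)⟩
        · exact ⟨⟨x, Or.inr hx, rfl⟩, h⟩
    · rintro ⟨⟨x, hx, h⟩, -⟩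
      rw [hv.mk_eq] at h
      exact hvS (h ▸ hx)
  unfold value
  rw [this]
  split_ifs
  · rw [pow_succ']
  · rw [mul_zero]

/-- An isolated vertex at which an arc between neighbours on the boundary is concentrated may be
removed together with this arc. -/
theorem value_remove_arc {α : Type} {r : α → α → Prop} {S : Set α} {D D' : Set ℤ} {seg seg' : ℤ → α}
    (M : ℤ → ℤ) {v : α} {u : ℤ} (hv : Isolated r v) (hvS : v ∉ S) (hu : seg u = v)
    (hu' : seg (u + 1) = v) (hseg : ∀ y ∈ D', seg (sk u y) = seg' y ∧ seg' y ≠ v)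
    (hD : ∀ x, x ∈ D ↔ x = u ∨ x = u + 1 ∨ ∃ y ∈ D', x = sk u y) :
    value r (insert v S) D seg (ins u M) = value r S D' seg' M := by
  have h1 : Induces r D seg (ins u M) ↔ Induces r D' seg' M := by
    have aux : ∀ y ∈ D', Quot.mk r (seg (sk u y)) ≠ Quot.mk r v := fun y hy h =>
      (hseg y hy).2 (by rw [← (hseg y hy).1]; exact hv.mk_eq.1 h)
    constructor
    · intro h x hx y hy
      have := h (sk u x) ((hD _).2 (Or.inr (Or.inr ⟨x, hx, rfl⟩))) (sk u y)
        ((hD _).2 (Or.inr (Or.inr ⟨y, hy, rfl⟩)))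
      rwa [ins_sk, sk_inj, Ne, sk_inj, (hseg x hx).1, (hseg y hy).1] at this
    · intro h x hx y hy
      rcases (hD x).1 hx with rfl | rfl | ⟨x, hx', rfl⟩ <;>
        rcases (hD y).1 hy with rfl | rfl | ⟨y, hy', rfl⟩
      · rw [ins_self]; simp
      · rw [ins_self, hu, hu']; simp
      · rw [ins_self, hu]
        exact ⟨fun h => absurd h.symm (sk_ne' _ _), fun h => absurd h.2.symm (aux y hy')⟩
      · rw [ins_succ, hu, hu']; simp
      · rw [ins_succ]; simp
      · rw [ins_succ, hu']
        exact ⟨fun h => absurd h.symm (sk_ne _ _), fun h => absurd h.2.symm (aux y hy')⟩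
      · rw [ins_sk, hu]
        exact ⟨fun h => absurd h (sk_ne _ _), fun h => absurd h.2 (aux x hx')⟩
      · rw [ins_sk, hu']
        exact ⟨fun h => absurd h (sk_ne' _ _), fun h => absurd h.2 (aux x hx')⟩
      · rw [ins_sk, sk_inj, Ne, sk_inj, (hseg x hx').1, (hseg y hy').1]
        exact h x hx' y hy'
  have h2 : closedComps r (insert v S) D seg = closedComps r S D' seg' := by
    unfold closedComps
    congr 1
    ext c
    constructor
    · rintro ⟨⟨x, hx, rfl⟩, h⟩
      rcases hx with rfl | hx
      · exact absurd (by rw [hu]) (h u ((hD u).2 (Or.inl rfl)))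
      · refine ⟨⟨x, hx, rfl⟩, fun p hp h' => h (sk u p) ((hD _).2 (Or.inr (Or.inr ⟨p, hp, rfl⟩))) ?_⟩
        rw [(hseg p hp).1, h']
    · rintro ⟨⟨x, hx, rfl⟩, h⟩
      refine ⟨⟨x, Or.inr hx, rfl⟩, fun p hp h' => ?_⟩
      rcases (hD p).1 hp with rfl | rfl | ⟨y, hy, rfl⟩
      · rw [hu] at h'; exact hvS ((hv.mk_eq.1 h'.symm) ▸ hx)
      · rw [hu'] at h'; exact hvS ((hv.mk_eq.1 h'.symm) ▸ hx)
      · rw [(hseg y hy).1] at h'; exact h y hy h'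
  unfold value
  rw [h2]
  by_cases h : Induces r D seg (ins u M)
  · rw [if_pos h, if_pos (h1.1 h)]
  · rw [if_neg h, if_neg (fun h' => h (h1.2 h'))]

/-- The relation `E` with additional edges. -/
def addEdges {α : Type} (E : α → α → Prop) (l : List (α × α)) (x y : α) : Prop := E x y ∨ (x, y) ∈ l

theorem addEdges_mk {α : Type} {E : α → α → Prop} {l : List (α × α)} {x y : α} (h : (x, y) ∈ l) :
    Quot.mk (addEdges E l) x = Quot.mk (addEdges E l) y := Quot.sound (Or.inr h)

open Classical in
/-- Reidemeister's second move, at the level of smoothings: two neighbouring crossings above which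
the two vertical lines are joined by a cap. Of the four smoothings three cancel, and in the fourth
the horizontal line passes and a cap appears below it. Here `a`, `b`, `c` are the segments of the
horizontal line, `t₁`, `t₂` the ends of the cap, and `d₁`, `d₂` the segments below the crossings. -/
theorem value_cap_pair {α : Type} (E : α → α → Prop) {S : Set α} {D : Set ℤ} {seg : ℤ → α}
    (M : ℤ → ℤ) {a b c d₁ d₂ t₁ t₂ : α} (hS : S.Finite)
    (ib : Isolated E b) (i1 : Isolated E t₁) (i2 : Isolated E t₂)
    (hb1 : b ≠ t₁) (hb2 : b ≠ t₂) (h12 : t₁ ≠ t₂)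
    (ha : a ≠ b ∧ a ≠ t₁ ∧ a ≠ t₂) (hc : c ≠ b ∧ c ≠ t₁ ∧ c ≠ t₂)
    (hd1 : d₁ ≠ b ∧ d₁ ≠ t₁ ∧ d₁ ≠ t₂) (hd2 : d₂ ≠ b ∧ d₂ ≠ t₁ ∧ d₂ ≠ t₂)
    (hseg : ∀ p ∈ D, seg p ≠ b ∧ seg p ≠ t₁ ∧ seg p ≠ t₂)
    (Sa : a ∈ S) (Sb : b ∈ S) (Sc : c ∈ S) (Sd1 : d₁ ∈ S) (S1 : t₁ ∈ S) :
    LaurentPolynomial.T 2 *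
        value (addEdges E [(t₁, t₂), (t₁, b), (a, d₁), (t₂, c), (b, d₂)]) S D seg M +
      LaurentPolynomial.T (-2) *
        value (addEdges E [(t₁, t₂), (t₁, a), (b, d₁), (t₂, b), (c, d₂)]) S D seg M +
      value (addEdges E [(t₁, t₂), (t₁, b), (a, d₁), (t₂, b), (c, d₂)]) S D seg M +
      value (addEdges E [(t₁, t₂), (t₁, a), (b, d₁), (t₂, c), (b, d₂)]) S D seg M =
    value (addEdges E [(a, b), (b, c), (d₁, d₂)]) (S \ {t₁, t₂}) D seg M := by
  obtain ⟨ha1, ha2, ha3⟩ := ha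
  obtain ⟨hc1, hc2, hc3⟩ := hc
  obtain ⟨hd11, hd12, hd13⟩ := hd1
  obtain ⟨hd21, hd22, hd23⟩ := hd2
  have hE : ∀ x y, E x y → (x ≠ b ∧ x ≠ t₁ ∧ x ≠ t₂) ∧ (y ≠ b ∧ y ≠ t₁ ∧ y ≠ t₂) := by
    intro x y h
    refine ⟨⟨?_, ?_, ?_⟩, ?_, ?_, ?_⟩ <;> rintro rfl
    exacts [(ib _).1 h, (i1 _).1 h, (i2 _).1 h, (ib _).2 h, (i1 _).2 h, (i2 _).2 h]
  -- `X` is the diagram that the three cancelling smoothings have in common.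
  set X := addEdges E [(a, d₁), (c, d₂)] with hX
  set S0 : Set α := S \ {b, t₁, t₂} with hS0
  have Xa : Quot.mk X a = Quot.mk X d₁ := addEdges_mk (by simp)
  have Xc : Quot.mk X c = Quot.mk X d₂ := addEdges_mk (by simp)
  -- contraction of the three new vertices to given vertices
  let ρ : α → α → α → α := fun vb v1 x => if x = b then vb else if x = t₁ ∨ x = t₂ then v1 else x
  have ρb : ∀ vb v1, ρ vb v1 b = vb := fun vb v1 => by simp [ρ]
  have ρ1 : ∀ vb v1, ρ vb v1 t₁ = v1 := fun vb v1 => by simp [ρ, hb1.symm]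
  have ρ2 : ∀ vb v1, ρ vb v1 t₂ = v1 := fun vb v1 => by simp [ρ, hb2.symm]
  have ρo : ∀ vb v1 x, x ≠ b ∧ x ≠ t₁ ∧ x ≠ t₂ → ρ vb v1 x = x := fun vb v1 x hx => by
    simp [ρ, hx.1, hx.2.1, hx.2.2]
  have ρa : ∀ vb v1, ρ vb v1 a = a := fun vb v1 => ρo _ _ _ ⟨ha1, ha2, ha3⟩
  have ρc : ∀ vb v1, ρ vb v1 c = c := fun vb v1 => ρo _ _ _ ⟨hc1, hc2, hc3⟩
  have ρd1 : ∀ vb v1, ρ vb v1 d₁ = d₁ := fun vb v1 => ρo _ _ _ ⟨hd11, hd12, hd13⟩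
  have ρd2 : ∀ vb v1, ρ vb v1 d₂ = d₂ := fun vb v1 => ρo _ _ _ ⟨hd21, hd22, hd23⟩
  have S0a : a ∈ S0 := ⟨Sa, by simp [ha1, ha2, ha3]⟩
  have S0c : c ∈ S0 := ⟨Sc, by simp [hc1, hc2, hc3]⟩
  have S0d1 : d₁ ∈ S0 := ⟨Sd1, by simp [hd11, hd12, hd13]⟩
  have cases4 : ∀ x, x = b ∨ x = t₁ ∨ x = t₂ ∨ (x ≠ b ∧ x ≠ t₁ ∧ x ≠ t₂) := by
    intro x; by_cases x = b <;> by_cases x = t₁ <;> by_cases x = t₂ <;> simp_all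
  have hPP : value (addEdges E [(t₁, t₂), (t₁, b), (a, d₁), (t₂, c), (b, d₂)]) S D seg M =
      value X S0 D seg M := by
    set r := addEdges E [(t₁, t₂), (t₁, b), (a, d₁), (t₂, c), (b, d₂)]
    have e1 : Quot.mk r t₁ = Quot.mk r t₂ := addEdges_mk (by simp)
    have e2 : Quot.mk r t₁ = Quot.mk r b := addEdges_mk (by simp)
    have e3 : Quot.mk r a = Quot.mk r d₁ := addEdges_mk (by simp)
    have e4 : Quot.mk r t₂ = Quot.mk r c := addEdges_mk (by simp)
    have e5 : Quot.mk r b = Quot.mk r d₂ := addEdges_mk (by simp)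
    refine value_congr M (ρ c c) id ?_ ?_ ?_ ?_ ?_ ?_ ?_ ?_
    · rintro x y (h | h)
      · rw [ρo _ _ x (hE x y h).1, ρo _ _ y (hE x y h).2]; exact Quot.sound (Or.inl h)
      · simp only [List.mem_cons, Prod.mk.injEq, List.not_mem_nil, or_false] at h
        rcases h with ⟨rfl, rfl⟩ | ⟨rfl, rfl⟩ | ⟨rfl, rfl⟩ | ⟨rfl, rfl⟩ | ⟨rfl, rfl⟩ <;>
          simp only [ρb, ρ1, ρ2, ρa, ρc, ρd1, ρd2, Xa, Xc]
    · rintro x y (h | h)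
      · exact Quot.sound (Or.inl h)
      · simp only [List.mem_cons, Prod.mk.injEq, List.not_mem_nil, or_false] at h
        rcases h with ⟨rfl, rfl⟩ | ⟨rfl, rfl⟩
        · exact e3
        · rw [id, id, ← e4, ← e1, e2, e5]
    · intro x hx
      rcases cases4 x with rfl | rfl | rfl | h
      · exact ⟨c, S0c, by rw [ρb]⟩
      · exact ⟨c, S0c, by rw [ρ1]⟩
      · exact ⟨c, S0c, by rw [ρ2]⟩
      · exact ⟨x, ⟨hx, by simp [h.1, h.2.1, h.2.2]⟩, by rw [ρo _ _ x h]⟩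
    · intro x hx; exact ⟨x, hx.1, rfl⟩
    · intro x hx
      rcases cases4 x with rfl | rfl | rfl | h
      · rw [ρb, id, ← e4, ← e1, e2]
      · rw [ρ1, id, ← e4, ← e1]
      · rw [ρ2, id, ← e4]
      · rw [ρo _ _ x h, id]
    · intro x hx
      rw [id, ρo]
      simpa [S0] using hx.2
    · intro p hp; rw [ρo _ _ _ (hseg p hp)]
    · intro p hp; rfl
  have hMM : value (addEdges E [(t₁, t₂), (t₁, a), (b, d₁), (t₂, b), (c, d₂)]) S D seg M =
      value X S0 D seg M := by
    set r := addEdges E [(t₁, t₂), (t₁, a), (b, d₁), (t₂, b), (c, d₂)]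
    have e1 : Quot.mk r t₁ = Quot.mk r t₂ := addEdges_mk (by simp)
    have e2 : Quot.mk r t₁ = Quot.mk r a := addEdges_mk (by simp)
    have e3 : Quot.mk r b = Quot.mk r d₁ := addEdges_mk (by simp)
    have e4 : Quot.mk r t₂ = Quot.mk r b := addEdges_mk (by simp)
    have e5 : Quot.mk r c = Quot.mk r d₂ := addEdges_mk (by simp)
    refine value_congr M (ρ a a) id ?_ ?_ ?_ ?_ ?_ ?_ ?_ ?_
    · rintro x y (h | h)
      · rw [ρo _ _ x (hE x y h).1, ρo _ _ y (hE x y h).2]; exact Quot.sound (Or.inl h)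
      · simp only [List.mem_cons, Prod.mk.injEq, List.not_mem_nil, or_false] at h
        rcases h with ⟨rfl, rfl⟩ | ⟨rfl, rfl⟩ | ⟨rfl, rfl⟩ | ⟨rfl, rfl⟩ | ⟨rfl, rfl⟩ <;>
          simp only [ρb, ρ1, ρ2, ρa, ρc, ρd1, ρd2, Xa, Xc]
    · rintro x y (h | h)
      · exact Quot.sound (Or.inl h)
      · simp only [List.mem_cons, Prod.mk.injEq, List.not_mem_nil, or_false] at h
        rcases h with ⟨rfl, rfl⟩ | ⟨rfl, rfl⟩
        · rw [id, id, ← e2, e1, e4, e3]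
        · exact e5
    · intro x hx
      rcases cases4 x with rfl | rfl | rfl | h
      · exact ⟨a, S0a, by rw [ρb]⟩
      · exact ⟨a, S0a, by rw [ρ1]⟩
      · exact ⟨a, S0a, by rw [ρ2]⟩
      · exact ⟨x, ⟨hx, by simp [h.1, h.2.1, h.2.2]⟩, by rw [ρo _ _ x h]⟩
    · intro x hx; exact ⟨x, hx.1, rfl⟩
    · intro x hx
      rcases cases4 x with rfl | rfl | rfl | h
      · rw [ρb, id, ← e2, e1, e4]
      · rw [ρ1, id, ← e2]
      · rw [ρ2, id, ← e2, e1]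
      · rw [ρo _ _ x h, id]
    · intro x hx
      rw [id, ρo]
      simpa [S0] using hx.2
    · intro p hp; rw [ρo _ _ _ (hseg p hp)]
    · intro p hp; rfl
  have hPM : value (addEdges E [(t₁, t₂), (t₁, b), (a, d₁), (t₂, b), (c, d₂)]) S D seg M =
      loopVal * value X S0 D seg M := by
    have iX : Isolated X b := by
      intro x
      constructor
      · rintro (h | h)
        · exact (ib x).1 h
        · simp [ha1.symm, hc1.symm] at h
      · rintro (h | h)
        · exact (ib x).2 h
        · simp [hd11.symm, hd21.symm] at h
    rw [← value_insert_isolated M iX (hS.subset Set.sdiff_subset) (by simp) (fun p hp => (hseg p hp).1)]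
    set r := addEdges E [(t₁, t₂), (t₁, b), (a, d₁), (t₂, b), (c, d₂)]
    have e1 : Quot.mk r t₁ = Quot.mk r t₂ := addEdges_mk (by simp)
    have e2 : Quot.mk r t₁ = Quot.mk r b := addEdges_mk (by simp)
    have e3 : Quot.mk r a = Quot.mk r d₁ := addEdges_mk (by simp)
    have e5 : Quot.mk r c = Quot.mk r d₂ := addEdges_mk (by simp)
    refine value_congr M (ρ b b) id ?_ ?_ ?_ ?_ ?_ ?_ ?_ ?_
    · rintro x y (h | h)
      · rw [ρo _ _ x (hE x y h).1, ρo _ _ y (hE x y h).2]; exact Quot.sound (Or.inl h)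
      · simp only [List.mem_cons, Prod.mk.injEq, List.not_mem_nil, or_false] at h
        rcases h with ⟨rfl, rfl⟩ | ⟨rfl, rfl⟩ | ⟨rfl, rfl⟩ | ⟨rfl, rfl⟩ | ⟨rfl, rfl⟩ <;>
          simp only [ρb, ρ1, ρ2, ρa, ρc, ρd1, ρd2, Xa, Xc]
    · rintro x y (h | h)
      · exact Quot.sound (Or.inl h)
      · simp only [List.mem_cons, Prod.mk.injEq, List.not_mem_nil, or_false] at h
        rcases h with ⟨rfl, rfl⟩ | ⟨rfl, rfl⟩
        · exact e3
        · exact e5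
    · intro x hx
      rcases cases4 x with rfl | rfl | rfl | h
      · exact ⟨_, Or.inl rfl, by rw [ρb]⟩
      · exact ⟨_, Or.inl rfl, by rw [ρ1]⟩
      · exact ⟨_, Or.inl rfl, by rw [ρ2]⟩
      · exact ⟨x, Or.inr ⟨hx, by simp [h.1, h.2.1, h.2.2]⟩, by rw [ρo _ _ x h]⟩
    · rintro x (rfl | hx)
      · exact ⟨_, Sb, rfl⟩
      · exact ⟨x, hx.1, rfl⟩
    · intro x hx
      rcases cases4 x with rfl | rfl | rfl | h
      · rw [ρb, id]
      · rw [ρ1, id, ← e2]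
      · rw [ρ2, id, ← e2, e1]
      · rw [ρo _ _ x h, id]
    · rintro x (rfl | hx)
      · rw [id, ρb]
      · rw [id, ρo]
        simpa [S0] using hx.2
    · intro p hp; rw [ρo _ _ _ (hseg p hp)]
    · intro p hp; rfl
  have hMP : value (addEdges E [(t₁, t₂), (t₁, a), (b, d₁), (t₂, c), (b, d₂)]) S D seg M =
      value (addEdges E [(a, b), (b, c), (d₁, d₂)]) (S \ {t₁, t₂}) D seg M := by
    set r := addEdges E [(t₁, t₂), (t₁, a), (b, d₁), (t₂, c), (b, d₂)]
    have e1 : Quot.mk r t₁ = Quot.mk r t₂ := addEdges_mk (by simp)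
    have e2 : Quot.mk r t₁ = Quot.mk r a := addEdges_mk (by simp)
    have e3 : Quot.mk r b = Quot.mk r d₁ := addEdges_mk (by simp)
    have e4 : Quot.mk r t₂ = Quot.mk r c := addEdges_mk (by simp)
    have e5 : Quot.mk r b = Quot.mk r d₂ := addEdges_mk (by simp)
    set r' := addEdges E [(a, b), (b, c), (d₁, d₂)]
    have f1 : Quot.mk r' a = Quot.mk r' b := addEdges_mk (by simp)
    have f2 : Quot.mk r' b = Quot.mk r' c := addEdges_mk (by simp)
    have f3 : Quot.mk r' d₁ = Quot.mk r' d₂ := addEdges_mk (by simp)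
    refine value_congr M (ρ d₁ a) (fun x => if x = b then a else x) ?_ ?_ ?_ ?_ ?_ ?_ ?_ ?_
    · rintro x y (h | h)
      · rw [ρo _ _ x (hE x y h).1, ρo _ _ y (hE x y h).2]; exact Quot.sound (Or.inl h)
      · simp only [List.mem_cons, Prod.mk.injEq, List.not_mem_nil, or_false] at h
        rcases h with ⟨rfl, rfl⟩ | ⟨rfl, rfl⟩ | ⟨rfl, rfl⟩ | ⟨rfl, rfl⟩ | ⟨rfl, rfl⟩ <;>
          simp only [ρb, ρ1, ρ2, ρa, ρc, ρd1, ρd2, f1, f2, f3]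
    · rintro x y (h | h)
      · simp only [(hE x y h).1.1, (hE x y h).2.1, if_false]; exact Quot.sound (Or.inl h)
      · simp only [List.mem_cons, Prod.mk.injEq, List.not_mem_nil, or_false] at h
        rcases h with ⟨rfl, rfl⟩ | ⟨rfl, rfl⟩ | ⟨rfl, rfl⟩
        · simp
        · simp only [hc1, if_true, if_false]; rw [← e2, e1, e4]
        · simp only [hd11, hd21, if_false]; rw [← e3, e5]
    · intro x hx
      rcases cases4 x with rfl | rfl | rfl | h
      · exact ⟨d₁, ⟨Sd1, by simp [hd12, hd13]⟩, by rw [ρb]⟩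
      · exact ⟨a, ⟨Sa, by simp [ha2, ha3]⟩, by rw [ρ1]⟩
      · exact ⟨a, ⟨Sa, by simp [ha2, ha3]⟩, by rw [ρ2]⟩
      · exact ⟨x, ⟨hx, by simp [h.2.1, h.2.2]⟩, by rw [ρo _ _ x h]⟩
    · intro x hx
      by_cases h : x = b
      · exact ⟨a, Sa, by simp [h]⟩
      · exact ⟨x, hx.1, by simp [h]⟩
    · intro x hx
      rcases cases4 x with rfl | rfl | rfl | h
      · simp only [ρb, hd11, if_false]; rw [← e3]
      · simp only [ρ1, ha1, if_false]; rw [← e2]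
      · simp only [ρ2, ha1, if_false]; rw [← e2, e1]
      · simp only [ρo _ _ x h, h.1, if_false]
    · intro x hx
      by_cases h : x = b
      · simp only [h, if_true, ρa, f1]
      · simp only [h, if_false]
        rw [ρo]
        exact ⟨h, by simpa using hx.2⟩
    · intro p hp; rw [ρo _ _ _ (hseg p hp)]
    · intro p hp; simp only [(hseg p hp).1, if_false]
  rw [hPP, hMM, hPM, hMP, loopVal]
  ring

/-! ### State sums and the sliding of caps through rows -/

/-- The state sum over the markers at the crossings in `X`, where `R s` is the diagram that belongs
to the set `s` of crossings with positive marker. -/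
def stateSum {α : Type} (X : Finset (ℕ × ℕ)) (R : Finset (ℕ × ℕ) → α → α → Prop) (S : Set α)
    (D : Set ℤ) (seg : ℤ → α) (M : ℤ → ℤ) : ℤ[T;T⁻¹] :=
  ∑ s ∈ X.powerset, LaurentPolynomial.T (2 * (s.card : ℤ) - X.card) * value (R s) S D seg M

/-- The segments of `L(m,n)`. -/
def segSet (m n : ℕ) : Set Seg := {x | x.In m n}

/-- The places of the boundary points of `L(m,n)`. -/
def places (m n : ℕ) : Set ℤ := Set.Icc (1 - n) (2 * m + n)

/-- The segment of `L(m,n)` that ends at a given place of the boundary. -/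
def placeSeg (m n : ℕ) (x : ℤ) : Seg :=
  if x ≤ 0 then .ver m (1 - x).toNat
  else if x ≤ m then .hor (m + 1 - x).toNat 0
  else if x ≤ m + n then .ver 0 (x - m).toNat
  else .hor (x - m - n).toNat n

/-- The coefficient of the matching `M` in the lattice crossing `L(m,n)`. -/
def wordCoeff (m n : ℕ) (M : ℤ → ℤ) : ℤ[T;T⁻¹] :=
  stateSum (crossings m n) (Smooth m n) (segSet m n) (places m n) (placeSeg m n) M

theorem mem_crossings {m n : ℕ} {i j : ℕ} :
    (i, j) ∈ crossings m n ↔ (1 ≤ i ∧ i ≤ m) ∧ 1 ≤ j ∧ j ≤ n := by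
  simp [crossings, Finset.mem_product]

theorem segSet_finite (m n : ℕ) : (segSet m n).Finite := by
  have h1 : ((fun c : ℕ × ℕ => Seg.hor c.1 c.2) '' (Set.Iic m ×ˢ Set.Iic n)).Finite :=
    ((Set.finite_Iic m).prod (Set.finite_Iic n)).image _
  have h2 : ((fun c : ℕ × ℕ => Seg.ver c.1 c.2) '' (Set.Iic m ×ˢ Set.Iic n)).Finite :=
    ((Set.finite_Iic m).prod (Set.finite_Iic n)).image _
  refine (h1.union h2).subset ?_
  rintro (⟨i, j⟩ | ⟨i, j⟩) h
  · exact Or.inl ⟨(i, j), ⟨h.2.1, h.2.2⟩, rfl⟩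
  · exact Or.inr ⟨(i, j), ⟨h.1, h.2.2⟩, rfl⟩

/-- The smoothings, restricted to the crossings in `X`. -/
def smoothOn (X s : Finset (ℕ × ℕ)) (x y : Seg) : Prop :=
  ∃ i j, (i, j) ∈ X ∧
    (((i, j) ∈ s ∧ ((x = .ver (i - 1) j ∧ y = .hor i j) ∨ (x = .hor i (j - 1) ∧ y = .ver i j))) ∨
      ((i, j) ∉ s ∧ ((x = .ver (i - 1) j ∧ y = .hor i (j - 1)) ∨ (x = .hor i j ∧ y = .ver i j))))

theorem smooth_iff {m n : ℕ} {s : Finset (ℕ × ℕ)} {x y : Seg} :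
    Smooth m n s x y ↔ smoothOn (crossings m n) s x y := by
  constructor
  · rintro (⟨i, j, hc, hs⟩ | ⟨i, j, hc, hs⟩ | ⟨i, j, hc, hs⟩ | ⟨i, j, hc, hs⟩)
    · exact ⟨i, j, hc, Or.inl ⟨hs, Or.inl ⟨rfl, rfl⟩⟩⟩
    · exact ⟨i, j, hc, Or.inl ⟨hs, Or.inr ⟨rfl, rfl⟩⟩⟩
    · exact ⟨i, j, hc, Or.inr ⟨hs, Or.inl ⟨rfl, rfl⟩⟩⟩
    · exact ⟨i, j, hc, Or.inr ⟨hs, Or.inr ⟨rfl, rfl⟩⟩⟩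
  · rintro ⟨i, j, hc, ⟨hs, ⟨rfl, rfl⟩ | ⟨rfl, rfl⟩⟩ | ⟨hs, ⟨rfl, rfl⟩ | ⟨rfl, rfl⟩⟩⟩
    · exact .pos_up i j hc hs
    · exact .pos_down i j hc hs
    · exact .neg_up i j hc hs
    · exact .neg_down i j hc hs

theorem smoothOn_insert {c : ℕ × ℕ} {X s : Finset (ℕ × ℕ)} {x y : Seg} :
    smoothOn (insert c X) s x y ↔ smoothOn X s x y ∨
      (c ∈ s ∧ ((x = .ver (c.1 - 1) c.2 ∧ y = .hor c.1 c.2) ∨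
        (x = .hor c.1 (c.2 - 1) ∧ y = .ver c.1 c.2))) ∨
      (c ∉ s ∧ ((x = .ver (c.1 - 1) c.2 ∧ y = .hor c.1 (c.2 - 1)) ∨
        (x = .hor c.1 c.2 ∧ y = .ver c.1 c.2))) := by
  obtain ⟨i, j⟩ := c
  constructor
  · rintro ⟨i', j', hc, h⟩
    rcases Finset.mem_insert.1 hc with h' | h'
    · obtain ⟨rfl, rfl⟩ := Prod.mk.inj h'
      exact Or.inr h
    · exact Or.inl ⟨i', j', h', h⟩
  · rintro (⟨i', j', hc, h⟩ | h)
    · exact ⟨i', j', Finset.mem_insert_of_mem hc, h⟩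
    · exact ⟨i, j, Finset.mem_insert_self _ _, h⟩

theorem smoothOn_congr {X s s' : Finset (ℕ × ℕ)} (h : ∀ c ∈ X, (c ∈ s ↔ c ∈ s')) {x y : Seg} :
    smoothOn X s x y ↔ smoothOn X s' x y := by
  constructor
  · rintro ⟨i, j, hc, h'⟩; exact ⟨i, j, hc, by rwa [← h _ hc]⟩
  · rintro ⟨i, j, hc, h'⟩; exact ⟨i, j, hc, by rwa [h _ hc]⟩

/-- The crossings of `L(m,n)` that remain when the columns `b` and `b + 1` are erased in the first
`r` rows. -/
def slideCrossings (m n b r : ℕ) : Finset (ℕ × ℕ) :=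
  (crossings m n).filter fun c => ¬ (c.1 ≤ r ∧ (c.2 = b ∨ c.2 = b + 1))

/-- The parts of the first `r` horizontal lines that pass the erased columns. -/
def slideLines (b r : ℕ) (x y : Seg) : Prop :=
  ∃ p, 1 ≤ p ∧ p ≤ r ∧ ((x = .hor p (b - 1) ∧ y = .hor p b) ∨ (x = .hor p b ∧ y = .hor p (b + 1)))

/-- The smoothing of the lattice crossing in which the columns `b` and `b + 1` are erased in the first
`r` rows, and joined by a cap above row `r + 1`. -/
def slideRel (m n b r : ℕ) (s : Finset (ℕ × ℕ)) (x y : Seg) : Prop :=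
  smoothOn (slideCrossings m n b r) s x y ∨ slideLines b r x y ∨ (x = .ver r b ∧ y = .ver r (b + 1))

/-- The segments of the diagrams `slideRel m n b r s`. -/
def slideSegs (m n b r : ℕ) : Set Seg :=
  {x | x.In m n ∧ ∀ p, p < r → x ≠ .ver p b ∧ x ≠ .ver p (b + 1)}

/-- The segments at the boundary places when the top points `b` and `b + 1` are joined by a cap. -/
def slidePlaceSeg (m n b : ℕ) (x : ℤ) : Seg :=
  if x ≤ 0 then .ver m (1 - x).toNat
  else if x ≤ m then .hor (m + 1 - x).toNat 0
  else if x < m + b then .ver 0 (x - m).toNat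
  else if x ≤ m + n - 2 then .ver 0 (x - m + 2).toNat
  else .hor (x - m - n + 2).toNat n

/-- The boundary places when two top points are joined by a cap. -/
def slidePlaces (m n : ℕ) : Set ℤ := Set.Icc (1 - n) (2 * m + n - 2)

theorem slideCrossings_eq_insert {m n b r : ℕ} (hb : 1 ≤ b) (hn : b + 1 ≤ n) (hr : r < m) :
    slideCrossings m n b r =
      insert (r + 1, b) (insert (r + 1, b + 1) (slideCrossings m n b (r + 1))) := by
  ext ⟨i, j⟩
  simp only [slideCrossings, Finset.mem_filter, mem_crossings, Finset.mem_insert, Prod.mk.injEq]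
  omega

/-- The cap over the columns `b` and `b + 1` slides through row `r + 1`. -/
theorem slide_step {m n b r : ℕ} (hb : 1 ≤ b) (hn : b + 1 ≤ n) (hr : r < m) (M : ℤ → ℤ) :
    stateSum (slideCrossings m n b r) (slideRel m n b r) (slideSegs m n b r) (slidePlaces m n)
        (slidePlaceSeg m n b) M =
      stateSum (slideCrossings m n b (r + 1)) (slideRel m n b (r + 1)) (slideSegs m n b (r + 1))
        (slidePlaces m n) (slidePlaceSeg m n b) M := by
  set X := slideCrossings m n b (r + 1) with hX
  have hX1 : (r + 1, b) ∉ X := by simp [hX, slideCrossings]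
  have hX2 : (r + 1, b + 1) ∉ X := by simp [hX, slideCrossings]
  have hX1' : (r + 1, b) ∉ insert (r + 1, b + 1) X := by simp [hX1]
  unfold stateSum
  rw [slideCrossings_eq_insert hb hn hr, ← hX, Finset.sum_powerset_insert hX1',
    Finset.sum_powerset_insert hX2, Finset.sum_powerset_insert hX2, ← Finset.sum_add_distrib,
    ← Finset.sum_add_distrib, ← Finset.sum_add_distrib]
  refine Finset.sum_congr rfl fun s hs => ?_
  rw [Finset.mem_powerset] at hs
  have s1 : (r + 1, b) ∉ s := fun h => hX1 (hs h)
  have s2 : (r + 1, b + 1) ∉ s := fun h => hX2 (hs h)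
  have s1' : (r + 1, b) ∉ insert (r + 1, b + 1) s := by simp [s1]
  let E : Seg → Seg → Prop := fun x y => smoothOn X s x y ∨ slideLines b r x y
  have key : ∀ s' : Finset (ℕ × ℕ), (∀ c ∈ X, (c ∈ s' ↔ c ∈ s)) → ∀ x y,
      slideRel m n b r s' x y ↔ addEdges E ((Seg.ver r b, Seg.ver r (b + 1)) ::
        ((if (r + 1, b) ∈ s' then [(Seg.ver r b, Seg.hor (r + 1) b),
            (Seg.hor (r + 1) (b - 1), Seg.ver (r + 1) b)]
          else [(Seg.ver r b, Seg.hor (r + 1) (b - 1)), (Seg.hor (r + 1) b, Seg.ver (r + 1) b)]) ++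
        (if (r + 1, b + 1) ∈ s' then [(Seg.ver r (b + 1), Seg.hor (r + 1) (b + 1)),
            (Seg.hor (r + 1) b, Seg.ver (r + 1) (b + 1))]
          else [(Seg.ver r (b + 1), Seg.hor (r + 1) b),
            (Seg.hor (r + 1) (b + 1), Seg.ver (r + 1) (b + 1))]))) x y := by
    intro s' hs' x y
    unfold slideRel addEdges
    rw [slideCrossings_eq_insert hb hn hr, ← hX, smoothOn_insert, smoothOn_insert,
      smoothOn_congr hs']
    by_cases h1 : (r + 1, b) ∈ s' <;> by_cases h2 : (r + 1, b + 1) ∈ s' <;>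
      simp only [h1, h2, E, if_true, if_false, List.mem_cons, List.mem_append, Prod.mk.injEq,
        List.not_mem_nil, or_false, not_true, not_false_iff, true_and, false_and, false_or,
        Nat.add_sub_cancel] <;> exact Iff.of_eq (by ac_rfl)
  have key' : ∀ x y, slideRel m n b (r + 1) s x y ↔ addEdges E
      [(Seg.hor (r + 1) (b - 1), Seg.hor (r + 1) b), (Seg.hor (r + 1) b, Seg.hor (r + 1) (b + 1)),
        (Seg.ver (r + 1) b, Seg.ver (r + 1) (b + 1))] x y := by
    intro x y
    have hl : slideLines b (r + 1) x y ↔ slideLines b r x y ∨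
        (x = .hor (r + 1) (b - 1) ∧ y = .hor (r + 1) b) ∨
        (x = .hor (r + 1) b ∧ y = .hor (r + 1) (b + 1)) := by
      constructor
      · rintro ⟨p, hp, hp', h⟩
        rcases Nat.lt_or_ge r p with h1 | h1
        · obtain rfl : p = r + 1 := by omega
          exact Or.inr h
        · exact Or.inl ⟨p, hp, h1, h⟩
      · rintro (⟨p, hp, hp', h⟩ | h)
        · exact ⟨p, hp, by omega, h⟩
        · exact ⟨r + 1, by omega, le_rfl, h⟩
    unfold slideRel addEdges
    rw [← hX, hl]
    simp only [E, List.mem_cons, Prod.mk.injEq, List.not_mem_nil, or_false]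
    exact Iff.of_eq (by ac_rfl)
  have rel : ∀ s' : Finset (ℕ × ℕ), (∀ c ∈ X, (c ∈ s' ↔ c ∈ s)) → slideRel m n b r s' = _ :=
    fun s' hs' => funext fun x => funext fun y => propext (key s' hs' x y)
  have rel' : slideRel m n b (r + 1) s = _ := funext fun x => funext fun y => propext (key' x y)
  have m00 : ∀ c ∈ X, (c ∈ s ↔ c ∈ s) := fun _ _ => Iff.rfl
  have m01 : ∀ c ∈ X, (c ∈ insert (r + 1, b + 1) s ↔ c ∈ s) := by
    intro c hc; simp only [Finset.mem_insert, or_iff_right_iff_imp]; rintro rfl; exact absurd hc hX2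
  have m10 : ∀ c ∈ X, (c ∈ insert (r + 1, b) s ↔ c ∈ s) := by
    intro c hc; simp only [Finset.mem_insert, or_iff_right_iff_imp]; rintro rfl; exact absurd hc hX1
  have m11 : ∀ c ∈ X, (c ∈ insert (r + 1, b) (insert (r + 1, b + 1) s) ↔ c ∈ s) := by
    intro c hc
    simp only [Finset.mem_insert]
    constructor
    · rintro (rfl | rfl | h)
      exacts [absurd hc hX1, absurd hc hX2, h]
    · intro h; exact Or.inr (Or.inr h)
  rw [rel _ m00, rel _ m01, rel _ m10, rel _ m11, rel']
  simp only [s1, s2, s1', Finset.mem_insert, if_true, if_false, Prod.mk.injEq,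
    Nat.succ_ne_self, and_false, or_true, or_false, List.cons_append,
    List.nil_append, Finset.card_insert_of_notMem s1', Finset.card_insert_of_notMem s1,
    Finset.card_insert_of_notMem s2, Finset.card_insert_of_notMem hX1',
    Finset.card_insert_of_notMem hX2]
  have hfin : (slideSegs m n b r).Finite := (segSet_finite m n).subset fun x hx => hx.1
  have iso : Isolated E (.hor (r + 1) b) ∧ Isolated E (.ver r b) ∧ Isolated E (.ver r (b + 1)) := by
    have hno : ∀ x y, E x y → ∀ v, (v = Seg.hor (r + 1) b ∨ v = Seg.ver r b ∨ v = Seg.ver r (b + 1)) →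
        x ≠ v ∧ y ≠ v := by
      rintro x y (⟨i, j, hc, h⟩ | ⟨p, hp, hp', h⟩) v hv
      · simp only [hX, slideCrossings, Finset.mem_filter, mem_crossings] at hc
        rcases h with ⟨-, ⟨rfl, rfl⟩ | ⟨rfl, rfl⟩⟩ | ⟨-, ⟨rfl, rfl⟩ | ⟨rfl, rfl⟩⟩ <;>
          rcases hv with rfl | rfl | rfl <;>
          simp only [ne_eq, Seg.hor.injEq, Seg.ver.injEq, reduceCtorEq, not_false_iff, true_and,
            and_true] <;> omega
      · rcases h with ⟨rfl, rfl⟩ | ⟨rfl, rfl⟩ <;>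
          rcases hv with rfl | rfl | rfl <;>
          simp only [ne_eq, Seg.hor.injEq, reduceCtorEq, not_false_iff, and_true] <;> omega
    exact ⟨fun x => ⟨fun h => (hno _ _ h _ (Or.inl rfl)).1 rfl, fun h => (hno _ _ h _ (Or.inl rfl)).2 rfl⟩,
      fun x => ⟨fun h => (hno _ _ h _ (Or.inr (Or.inl rfl))).1 rfl,
        fun h => (hno _ _ h _ (Or.inr (Or.inl rfl))).2 rfl⟩,
      fun x => ⟨fun h => (hno _ _ h _ (Or.inr (Or.inr rfl))).1 rfl,
        fun h => (hno _ _ h _ (Or.inr (Or.inr rfl))).2 rfl⟩⟩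
  have hsegs : slideSegs m n b (r + 1) = slideSegs m n b r \ {Seg.ver r b, Seg.ver r (b + 1)} := by
    ext x
    simp only [slideSegs, Set.mem_ofPred_eq, Set.mem_sdiff, Set.mem_insert_iff, Set.mem_singleton_iff]
    constructor
    · rintro ⟨h1, h2⟩
      refine ⟨⟨h1, fun p hp => h2 p (by omega)⟩, ?_⟩
      have := h2 r (by omega)
      tauto
    · rintro ⟨⟨h1, h2⟩, h3⟩
      refine ⟨h1, fun p hp => ?_⟩
      rcases Nat.lt_or_ge p r with h | h
      · exact h2 p h
      · obtain rfl : p = r := by omega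
        tauto
  have hmem : ∀ x : Seg, x.In m n → (∀ p, p < r → x ≠ .ver p b ∧ x ≠ .ver p (b + 1)) →
      x ∈ slideSegs m n b r := fun x h1 h2 => ⟨h1, h2⟩
  have main := value_cap_pair E (S := slideSegs m n b r) (D := slidePlaces m n)
    (seg := slidePlaceSeg m n b) M (a := .hor (r + 1) (b - 1)) (b := .hor (r + 1) b)
    (c := .hor (r + 1) (b + 1)) (d₁ := .ver (r + 1) b) (d₂ := .ver (r + 1) (b + 1))
    (t₁ := .ver r b) (t₂ := .ver r (b + 1)) hfin iso.1 iso.2.1 iso.2.2 (by simp) (by simp) (by simp)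
    (by simp; omega) (by simp) (by simp) (by simp)
    (by
      intro p hp
      simp only [slidePlaces, Set.mem_Icc] at hp
      unfold slidePlaceSeg
      split_ifs <;> simp only [ne_eq, Seg.hor.injEq, Seg.ver.injEq, reduceCtorEq, not_false_iff,
        true_and, and_true] <;> omega)
    (hmem _ (by simp only [Seg.In]; omega) fun p hp => by simp)
    (hmem _ (by simp only [Seg.In]; omega) fun p hp => by simp)
    (hmem _ (by simp only [Seg.In]; omega) fun p hp => by simp)
    (hmem _ (by simp only [Seg.In]; omega) fun p hp => by
      simp only [ne_eq, Seg.ver.injEq]; omega)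
    (hmem _ (by simp only [Seg.In]; omega) fun p hp => by
      simp only [ne_eq, Seg.ver.injEq]; omega)
  rw [hsegs, ← main]
  have T1 : ∀ z : ℤ, LaurentPolynomial.T (R := ℤ) z =
      LaurentPolynomial.T (2 * (s.card : ℤ) - X.card) *
        LaurentPolynomial.T (z - (2 * (s.card : ℤ) - X.card)) := by
    intro z; rw [← LaurentPolynomial.T_add]; congr 1; ring
  rw [T1 (2 * (s.card : ℤ) - ((X.card + 1 + 1 : ℕ) : ℤ)),
    T1 (2 * ((s.card + 1 : ℕ) : ℤ) - ((X.card + 1 + 1 : ℕ) : ℤ)),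
    T1 (2 * ((s.card + 1 + 1 : ℕ) : ℤ) - ((X.card + 1 + 1 : ℕ) : ℤ))]
  have w1 : 2 * (s.card : ℤ) - ((X.card + 1 + 1 : ℕ) : ℤ) - (2 * (s.card : ℤ) - X.card) = -2 := by
    push_cast; ring
  have w2 : 2 * ((s.card + 1 : ℕ) : ℤ) - ((X.card + 1 + 1 : ℕ) : ℤ) -
      (2 * (s.card : ℤ) - X.card) = 0 := by
    push_cast; ring
  have w3 : 2 * ((s.card + 1 + 1 : ℕ) : ℤ) - ((X.card + 1 + 1 : ℕ) : ℤ) -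
      (2 * (s.card : ℤ) - X.card) = 2 := by
    push_cast; ring
  rw [w1, w2, w3, LaurentPolynomial.T_zero]
  ring

theorem slide_all {m n b : ℕ} (hb : 1 ≤ b) (hn : b + 1 ≤ n) (M : ℤ → ℤ) :
    stateSum (slideCrossings m n b 0) (slideRel m n b 0) (slideSegs m n b 0) (slidePlaces m n)
        (slidePlaceSeg m n b) M =
      stateSum (slideCrossings m n b m) (slideRel m n b m) (slideSegs m n b m)
        (slidePlaces m n) (slidePlaceSeg m n b) M := by
  have : ∀ r ≤ m, stateSum (slideCrossings m n b 0) (slideRel m n b 0) (slideSegs m n b 0)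
      (slidePlaces m n) (slidePlaceSeg m n b) M =
      stateSum (slideCrossings m n b r) (slideRel m n b r) (slideSegs m n b r)
        (slidePlaces m n) (slidePlaceSeg m n b) M := by
    intro r
    induction r with
    | zero => intro _; rfl
    | succ r ih => intro h; rw [ih (by omega), slide_step hb hn (by omega)]
  exact this m le_rfl

/-- The relation `r` on the first summand of `α ⊕ ℕ`, where the points of `ℕ` are isolated. -/
abbrev liftRel {α : Type} (r : α → α → Prop) : α ⊕ ℕ → α ⊕ ℕ → Prop :=
  Sum.LiftRel r fun _ _ => False

theorem liftRel_isolated {α : Type} (r : α → α → Prop) (k : ℕ) :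
    Isolated (liftRel r) (Sum.inr k) := by
  intro x
  constructor
  · rintro (_ | h); exact h
  · rintro (_ | h); exact h

theorem value_inl {α : Type} {r : α → α → Prop} {S : Set α} {D : Set ℤ} {seg : ℤ → α} (x₀ : α)
    (M : ℤ → ℤ) :
    value (liftRel r) (Sum.inl '' S) D (fun p => Sum.inl (seg p)) M = value r S D seg M := by
  refine value_congr M (Sum.elim id fun _ => x₀) Sum.inl ?_ ?_ ?_ ?_ ?_ ?_ ?_ ?_
  · rintro _ _ (h | h)
    · exact Quot.sound h
    · exact h.elim
  · intro x y h; exact Quot.sound (Sum.LiftRel.inl h)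
  · rintro _ ⟨x, hx, rfl⟩; exact ⟨x, hx, rfl⟩
  · intro x hx; exact ⟨_, ⟨x, hx, rfl⟩, rfl⟩
  · rintro _ ⟨x, hx, rfl⟩; rfl
  · intro x hx; rfl
  · intro p hp; rfl
  · intro p hp; rfl

/-- Contraction of the segments of `slideRel m n b m s` to those of `L(m,n-2)`; the bottom return at
`b` is contracted to an extra point. -/
def slideMap (b : ℕ) : Seg → Seg ⊕ ℕ
  | .hor i j => .inl (.hor i (if j < b then j else if j = b then b - 1 else j - 2))
  | .ver i j => if j < b then .inl (.ver i j) else if j ≤ b + 1 then .inr 0 else .inl (.ver i (j - 2))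

/-- The segments of `L(m,n-2)` as segments of `slideRel m n b m s`. -/
def slideInv (m b : ℕ) : Seg ⊕ ℕ → Seg
  | .inl (.hor i j) => .hor i (if j < b then j else j + 2)
  | .inl (.ver i j) => .ver i (if j < b then j else j + 2)
  | .inr _ => .ver m b

/-- The crossings of `L(m,n-2)` as crossings of `L(m,n)`. -/
def slideCol (b : ℕ) (c : ℕ × ℕ) : ℕ × ℕ := (c.1, if c.2 < b then c.2 else c.2 + 2)

theorem slideCol_injective (b : ℕ) : Function.Injective (slideCol b) := by
  rintro ⟨i, j⟩ ⟨i', j'⟩ h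
  simp only [slideCol, Prod.mk.injEq] at h ⊢
  refine ⟨h.1, ?_⟩
  have := h.2
  split_ifs at this <;> omega

theorem slideCrossings_eq_image {m n b : ℕ} (hb : 1 ≤ b) (hn : b + 1 ≤ n) :
    slideCrossings m n b m = (crossings m (n - 2)).image (slideCol b) := by
  ext ⟨i, j⟩
  simp only [slideCrossings, Finset.mem_filter, mem_crossings, Finset.mem_image, Prod.exists, slideCol,
    Prod.mk.injEq]
  constructor
  · rintro ⟨⟨h1, h2⟩, h3⟩
    refine ⟨i, if j < b then j else j - 2, ⟨h1, ?_⟩, rfl, ?_⟩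
    · split_ifs <;> omega
    · split_ifs <;> omega
  · rintro ⟨i', j', ⟨h1, h2⟩, rfl, rfl⟩
    split_ifs <;> omega

theorem value_slide_end {m n b : ℕ} (hb : 1 ≤ b) (hn : b + 1 ≤ n) (s : Finset (ℕ × ℕ)) (M : ℤ → ℤ) :
    value (slideRel m n b m (s.image (slideCol b))) (slideSegs m n b m) (slidePlaces m n)
        (slidePlaceSeg m n b) (ins (-(b : ℤ)) M) =
      value (Smooth m (n - 2) s) (segSet m (n - 2)) (places m (n - 2)) (placeSeg m (n - 2)) M := by
  set r := slideRel m n b m (s.image (slideCol b)) with hr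
  set r' := Smooth m (n - 2) s with hr'
  have line1 : ∀ i, 1 ≤ i → i ≤ m → Quot.mk r (.hor i (b - 1)) = Quot.mk r (.hor i b) := fun i h1 h2 =>
    Quot.sound (Or.inr (Or.inl ⟨i, h1, h2, Or.inl ⟨rfl, rfl⟩⟩))
  have line2 : ∀ i, 1 ≤ i → i ≤ m → Quot.mk r (.hor i b) = Quot.mk r (.hor i (b + 1)) := fun i h1 h2 =>
    Quot.sound (Or.inr (Or.inl ⟨i, h1, h2, Or.inr ⟨rfl, rfl⟩⟩))
  have cup : Quot.mk r (.ver m b) = Quot.mk r (.ver m (b + 1)) :=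
    Quot.sound (Or.inr (Or.inr ⟨rfl, rfl⟩))
  have hgf : ∀ x ∈ slideSegs m n b m, Quot.mk r (slideInv m b (slideMap b x)) = Quot.mk r x := by
    rintro (⟨i, j⟩ | ⟨i, j⟩) ⟨hx, hx'⟩
    · simp only [Seg.In] at hx
      rcases lt_or_ge j b with h | h
      · simp only [slideMap, slideInv, h, if_true]
      rcases eq_or_ne j b with rfl | h2
      · simp only [slideMap, slideInv, lt_irrefl, if_true, if_false]
        rw [if_pos (by omega)]; exact line1 i hx.1 hx.2.1
      rcases eq_or_ne j (b + 1) with rfl | h3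
      · simp only [slideMap, slideInv]
        rw [if_neg (by omega : ¬ (b + 1 < b)), if_neg (by omega : ¬ (b + 1 = b)), if_pos (by omega)]
        exact (line1 i hx.1 hx.2.1).trans (line2 i hx.1 hx.2.1)
      · simp only [slideMap, slideInv]
        rw [if_neg (by omega : ¬ (j < b)), if_neg h2, if_neg (by omega)]
        congr 2; omega
    · simp only [Seg.In] at hx
      have h0 : i < m → j ≠ b ∧ j ≠ b + 1 := fun h => by simpa using hx' i h
      rcases lt_or_ge j b with h | h
      · simp only [slideMap, slideInv, h, if_true]
      rcases eq_or_ne j b with rfl | h2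
      · obtain rfl : i = m := by omega
        simp only [slideMap, slideInv, lt_irrefl, if_false, Nat.le_succ, if_true]
      rcases eq_or_ne j (b + 1) with rfl | h3
      · obtain rfl : i = m := by omega
        simp only [slideMap, slideInv]
        rw [if_neg (by omega : ¬ (b + 1 < b)), if_pos le_rfl]
        exact cup
      · simp only [slideMap]
        rw [if_neg (by omega : ¬ (j < b)), if_neg (by omega)]
        simp only [slideInv]
        rw [if_neg (by omega)]
        congr 2; omega
  have hsegD : ∀ p ∈ slidePlaces m n, slidePlaceSeg m n b p ∈ slideSegs m n b m := by
    intro p hp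
    simp only [slidePlaces, Set.mem_Icc] at hp
    unfold slidePlaceSeg
    split_ifs <;> refine ⟨by simp only [Seg.In]; omega, fun p hp => ?_⟩ <;>
      simp only [ne_eq, Seg.ver.injEq, reduceCtorEq, not_false_iff, and_self] <;> omega
  have e1 : value r (slideSegs m n b m) (slidePlaces m n) (slidePlaceSeg m n b) (ins (-(b : ℤ)) M) =
      value (liftRel r') (insert (Sum.inr 0) (Sum.inl '' segSet m (n - 2))) (slidePlaces m n)
        (fun p => slideMap b (slidePlaceSeg m n b p)) (ins (-(b : ℤ)) M) := by
    refine value_congr _ (slideMap b) (slideInv m b) ?_ ?_ ?_ ?_ hgf ?_ ?_ ?_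
    · rintro x y (⟨i, j, hc, h⟩ | ⟨p, hp, hp', h⟩ | ⟨rfl, rfl⟩)
      · simp only [slideCrossings, Finset.mem_filter, mem_crossings] at hc
        obtain ⟨j', hj', hj''⟩ : ∃ j', (j < b ∧ j = j' ∨ b + 2 ≤ j ∧ j = j' + 2) ∧
            (i, j') ∈ crossings m (n - 2) := by
          refine ⟨if j < b then j else j - 2, ?_, ?_⟩
          · split_ifs <;> omega
          · rw [mem_crossings]; split_ifs <;> omega
        have hs : (i, j) ∈ s.image (slideCol b) ↔ (i, j') ∈ s := by
          have : (i, j) = slideCol b (i, j') := by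
            simp only [slideCol, Prod.mk.injEq, true_and]; split_ifs <;> omega
          rw [this, (slideCol_injective b).mem_finset_image]
        rw [hs] at h
        have v : ∀ k, slideMap b (.ver k j) = .inl (.ver k j') := by
          intro k; simp only [slideMap]
          rcases hj' with ⟨h1, rfl⟩ | ⟨h1, rfl⟩
          · rw [if_pos h1]
          · rw [if_neg (by omega), if_neg (by omega)]; simp
        have h1 : slideMap b (.hor i j) = .inl (.hor i j') := by
          simp only [slideMap]
          rcases hj' with ⟨h1, rfl⟩ | ⟨h1, rfl⟩
          · rw [if_pos h1]
          · rw [if_neg (by omega), if_neg (by omega)]; simp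
        have h2 : slideMap b (.hor i (j - 1)) = .inl (.hor i (j' - 1)) := by
          simp only [slideMap]
          congr 2
          split_ifs <;> omega
        rcases h with ⟨hs, ⟨rfl, rfl⟩ | ⟨rfl, rfl⟩⟩ | ⟨hs, ⟨rfl, rfl⟩ | ⟨rfl, rfl⟩⟩
        · rw [v, h1]; exact Quot.sound (.inl (.pos_up i j' hj'' hs))
        · rw [v, h2]; exact Quot.sound (.inl (.pos_down i j' hj'' hs))
        · rw [v, h2]; exact Quot.sound (.inl (.neg_up i j' hj'' hs))
        · rw [v, h1]; exact Quot.sound (.inl (.neg_down i j' hj'' hs))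
      · congr 1
        rcases h with ⟨rfl, rfl⟩ | ⟨rfl, rfl⟩ <;> simp only [slideMap] <;> congr 2 <;>
          split_ifs <;> omega
      · congr 1
        simp only [slideMap]
        split_ifs <;> first | rfl | omega
    · rintro _ _ (h | h)
      swap
      · exact h.elim
      have tr : ∀ i j, (i, j) ∈ crossings m (n - 2) → ∃ j', (if j < b then j else j + 2) = j' ∧
          (i, j') ∈ slideCrossings m n b m ∧ ((i, j) ∈ s ↔ (i, j') ∈ s.image (slideCol b)) ∧
          Quot.mk r (slideInv m b (.inl (.hor i (j - 1)))) = Quot.mk r (.hor i (j' - 1)) := by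
        intro i j hc
        refine ⟨_, rfl, ?_, ?_, ?_⟩
        · rw [slideCrossings_eq_image hb hn]
          exact Finset.mem_image_of_mem (slideCol b) hc
        · exact ((slideCol_injective b).mem_finset_image (a := (i, j))).symm
        · rw [mem_crossings] at hc
          simp only [slideInv]
          rcases lt_trichotomy j b with h | rfl | h
          · rw [if_pos (by omega), if_pos (by omega)]
          · rw [if_pos (by omega), if_neg (by omega)]
            exact (line1 i hc.1.1 hc.1.2).trans (line2 i hc.1.1 hc.1.2)
          · rw [if_neg (by omega), if_neg (by omega)]
            congr 2; omega
      rcases h with (⟨i, j, hc, hs⟩ | ⟨i, j, hc, hs⟩ | ⟨i, j, hc, hs⟩ | ⟨i, j, hc, hs⟩) <;>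
        obtain ⟨j', hj', hc', hs', h3⟩ := tr i j hc <;> rw [hs'] at hs
      · simp only [slideInv, hj']
        exact Quot.sound (Or.inl ⟨i, j', hc', Or.inl ⟨hs, Or.inl ⟨rfl, rfl⟩⟩⟩)
      · rw [h3]; simp only [slideInv, hj']
        exact Quot.sound (Or.inl ⟨i, j', hc', Or.inl ⟨hs, Or.inr ⟨rfl, rfl⟩⟩⟩)
      · rw [h3]; simp only [slideInv, hj']
        exact Quot.sound (Or.inl ⟨i, j', hc', Or.inr ⟨hs, Or.inl ⟨rfl, rfl⟩⟩⟩)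
      · simp only [slideInv, hj']
        exact Quot.sound (Or.inl ⟨i, j', hc', Or.inr ⟨hs, Or.inr ⟨rfl, rfl⟩⟩⟩)
    · rintro (⟨i, j⟩ | ⟨i, j⟩) ⟨hx, -⟩
      · simp only [Seg.In] at hx
        refine ⟨_, Or.inr ⟨_, ?_, rfl⟩, rfl⟩
        simp only [segSet, Set.mem_ofPred_eq, Seg.In]
        split_ifs <;> omega
      · simp only [Seg.In] at hx
        simp only [slideMap]
        split_ifs
        · refine ⟨_, Or.inr ⟨_, ?_, rfl⟩, rfl⟩
          simp only [segSet, Set.mem_ofPred_eq, Seg.In]; omega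
        · exact ⟨_, Or.inl rfl, rfl⟩
        · refine ⟨_, Or.inr ⟨_, ?_, rfl⟩, rfl⟩
          simp only [segSet, Set.mem_ofPred_eq, Seg.In]; omega
    · rintro _ (rfl | ⟨⟨i, j⟩ | ⟨i, j⟩, hx, rfl⟩)
      · refine ⟨.ver m b, ⟨by simp only [Seg.In]; omega, fun p hp => ?_⟩, rfl⟩
        simp only [ne_eq, Seg.ver.injEq]; omega
      · simp only [segSet, Set.mem_ofPred_eq, Seg.In] at hx
        refine ⟨_, ⟨?_, fun p hp => ?_⟩, rfl⟩
        · simp only [slideInv, Seg.In]; split_ifs <;> omega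
        · simp [slideInv]
      · simp only [segSet, Set.mem_ofPred_eq, Seg.In] at hx
        refine ⟨_, ⟨?_, fun p hp => ?_⟩, rfl⟩
        · simp only [slideInv, Seg.In]; split_ifs <;> omega
        · simp only [slideInv, ne_eq, Seg.ver.injEq]; split_ifs <;> omega
    · rintro _ (rfl | ⟨⟨i, j⟩ | ⟨i, j⟩, hx, rfl⟩)
      · simp [slideInv, slideMap]
      · congr 1; simp only [slideInv, slideMap]; congr 2; split_ifs <;> omega
      · congr 1; simp only [slideInv, slideMap]
        split_ifs <;> first | omega | simp
    · intro p hp; rfl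
    · intro p hp; exact hgf _ (hsegD p hp)
  rw [e1, value_remove_arc (D' := places m (n - 2))
    (seg' := fun p => Sum.inl (placeSeg m (n - 2) p)) M (liftRel_isolated r' 0), value_inl (.hor 0 0)]
  · simp
  · simp only [slidePlaceSeg]
    rw [if_pos (by omega), show (1 - -(b : ℤ)).toNat = b + 1 by omega]
    simp [slideMap]
  · simp only [slidePlaceSeg]
    rw [if_pos (by omega), show (1 - (-(b : ℤ) + 1)).toNat = b by omega]
    simp [slideMap]
  · intro y hy
    simp only [places, Set.mem_Icc] at hy
    refine ⟨?_, by simp⟩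
    rcases le_or_gt y 0 with h0 | h0
    · have : slidePlaceSeg m n b (sk (-(b : ℤ)) y) =
          .ver m (1 - sk (-(b : ℤ)) y).toNat := by
        unfold slidePlaceSeg; rw [if_pos]; unfold sk; split_ifs <;> omega
      rw [this, placeSeg, if_pos h0]
      unfold sk
      simp only [slideMap]
      split_ifs <;> first | omega | (congr 2 <;> omega)
    · have : sk (-(b : ℤ)) y = y := by unfold sk; split_ifs <;> omega
      rw [this]
      unfold slidePlaceSeg placeSeg
      split_ifs <;> simp only [slideMap] <;> (try split_ifs) <;> first | omega | (congr 2 <;> omega)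
  · intro x
    simp only [slidePlaces, places, Set.mem_Icc]
    constructor
    · intro hx
      rcases sk_cases (-(b : ℤ)) x with h | h | ⟨y, h⟩
      · exact Or.inl h
      · exact Or.inr (Or.inl h)
      · refine Or.inr (Or.inr ⟨y, ?_, h⟩)
        rw [h] at hx; revert hx
        unfold sk; split_ifs <;> omega
    · rintro (rfl | rfl | ⟨y, hy, rfl⟩)
      · omega
      · omega
      · unfold sk; split_ifs <;> omega

/-- A cap on top of `L(m,n)` slides down and becomes a bottom return below `L(m,n-2)`. -/
theorem slide_ins {m n b : ℕ} (hb : 1 ≤ b) (hn : b + 1 ≤ n) (M : ℤ → ℤ) :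
    stateSum (slideCrossings m n b 0) (slideRel m n b 0) (slideSegs m n b 0) (slidePlaces m n)
        (slidePlaceSeg m n b) (ins (-(b : ℤ)) M) = wordCoeff m (n - 2) M := by
  rw [slide_all hb hn, wordCoeff, stateSum, stateSum, slideCrossings_eq_image hb hn,
    Finset.powerset_image, Finset.sum_image (fun x _ y _ h =>
      Finset.image_injective (slideCol_injective b) h),
    Finset.card_image_of_injective _ (slideCol_injective b)]
  refine Finset.sum_congr rfl fun s _ => ?_
  rw [Finset.card_image_of_injective _ (slideCol_injective b), value_slide_end hb hn]

/-- The cap below the last row joins the bottom points `b` and `b + 1`, so no other matching is realized. -/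
theorem slide_zero {m n b : ℕ} (hb : 1 ≤ b) (hn : b + 1 ≤ n) {M : ℤ → ℤ} (hM : M (-(b : ℤ)) ≠ -b + 1) :
    stateSum (slideCrossings m n b 0) (slideRel m n b 0) (slideSegs m n b 0) (slidePlaces m n)
        (slidePlaceSeg m n b) M = 0 := by
  rw [slide_all hb hn, stateSum]
  refine Finset.sum_eq_zero fun s _ => ?_
  rw [value, if_neg, mul_zero]
  intro h
  refine hM ((h _ ?_ _ ?_).2 ⟨by omega, ?_⟩)
  · simp only [slidePlaces, Set.mem_Icc]; omega
  · simp only [slidePlaces, Set.mem_Icc]; omega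
  · simp only [slidePlaceSeg]
    rw [if_pos (by omega), if_pos (by omega), show (1 - -(b : ℤ)).toNat = b + 1 by omega,
      show (1 - (-(b : ℤ) + 1)).toNat = b by omega]
    have cup : Quot.mk (slideRel m n b m s) (.ver m b) = Quot.mk _ (.ver m (b + 1)) :=
      Quot.sound (Or.inr (Or.inr ⟨rfl, rfl⟩))
    exact cup.symm

/-! ### Expansion along the first row -/

/-- The `j`-th crossing of the first row. -/
def rowCol (j : ℕ) : ℕ × ℕ := (1, j)

/-- The crossings of `L(m,n)` as the crossings of `L(m+1,n)` below the first row. -/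
def rowShift (c : ℕ × ℕ) : ℕ × ℕ := (c.1 + 1, c.2)

theorem rowCol_injective : Function.Injective rowCol := fun _ _ h => (Prod.mk.inj h).2

theorem rowShift_injective : Function.Injective rowShift := by
  rintro ⟨i, j⟩ ⟨i', j'⟩ h
  simp only [rowShift, Prod.mk.injEq] at h ⊢
  omega

/-- The set of positive markers that is `s₁` in the first row and `s` in the other rows. -/
def rowJoin (s₁ : Finset ℕ) (s : Finset (ℕ × ℕ)) : Finset (ℕ × ℕ) :=
  s₁.image rowCol ∪ s.image rowShift

theorem mem_rowJoin_one {m n j : ℕ} {s₁ : Finset ℕ} {s : Finset (ℕ × ℕ)} (hs : s ⊆ crossings m n) :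
    (1, j) ∈ rowJoin s₁ s ↔ j ∈ s₁ := by
  simp only [rowJoin, Finset.mem_union, Finset.mem_image, rowCol, rowShift, Prod.exists,
    Prod.mk.injEq, true_and, exists_eq_right, or_iff_left_iff_imp]
  rintro ⟨i, j', h, h1, rfl⟩
  have := mem_crossings.1 (hs h)
  omega

theorem mem_rowJoin_succ {i j : ℕ} {s₁ : Finset ℕ} {s : Finset (ℕ × ℕ)} (hi : 1 ≤ i) :
    (i + 1, j) ∈ rowJoin s₁ s ↔ (i, j) ∈ s := by
  simp only [rowJoin, Finset.mem_union, Finset.mem_image, rowCol, rowShift, Prod.exists,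
    Prod.mk.injEq]
  constructor
  · rintro (⟨j', -, h, -⟩ | ⟨i', j', h, h1, rfl⟩)
    · omega
    · obtain rfl : i' = i := by omega
      exact h
  · intro h; exact Or.inr ⟨i, j, h, rfl, rfl⟩

theorem crossings_succ (m n : ℕ) :
    crossings (m + 1) n = (Finset.Icc 1 n).image rowCol ∪ (crossings m n).image rowShift := by
  ext ⟨i, j⟩
  simp only [Finset.mem_union, Finset.mem_image, rowCol, rowShift, Prod.exists,
    Prod.mk.injEq, mem_crossings, Finset.mem_Icc]
  constructor
  · intro h
    rcases Nat.lt_or_ge 1 i with h1 | h1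
    · exact Or.inr ⟨i - 1, j, by omega, by omega, rfl⟩
    · exact Or.inl ⟨j, h.2, by omega, rfl⟩
  · rintro (⟨j', h, rfl, rfl⟩ | ⟨i', j', h, rfl, rfl⟩) <;> omega

theorem disjoint_row (n : ℕ) {m : ℕ} {A : Finset ℕ} {B : Finset (ℕ × ℕ)} (hB : B ⊆ crossings m n) :
    Disjoint (A.image rowCol) (B.image rowShift) := by
  rw [Finset.disjoint_left]
  intro c h1 h2
  rw [Finset.mem_image] at h1 h2
  obtain ⟨j, -, rfl⟩ := h1
  obtain ⟨⟨i, j'⟩, h, h'⟩ := h2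
  have := mem_crossings.1 (hB h)
  simp only [rowCol, rowShift, Prod.mk.injEq] at h'
  omega

theorem sum_powerset_union {ι A : Type} [DecidableEq ι] [AddCommMonoid A] {X Y : Finset ι}
    (h : Disjoint X Y) (f : Finset ι → A) :
    ∑ s ∈ (X ∪ Y).powerset, f s = ∑ s ∈ X.powerset, ∑ t ∈ Y.powerset, f (s ∪ t) := by
  induction X using Finset.induction_on generalizing f with
  | empty => simp
  | insert a X ha ih =>
    rw [Finset.disjoint_insert_left] at h
    have ha' : a ∉ X ∪ Y := by simp [ha, h.1]
    rw [Finset.insert_union, Finset.sum_powerset_insert ha', Finset.sum_powerset_insert ha, ih h.2,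
      ih h.2]
    simp only [Finset.insert_union]

/-- The part of the state sum of `L(m+1,n)` in which the markers in the first row are given by `s₁`,
without the weight of these markers. -/
def rowTerm (m n : ℕ) (s₁ : Finset ℕ) (M : ℤ → ℤ) : ℤ[T;T⁻¹] :=
  stateSum (crossings m n) (fun s => Smooth (m + 1) n (rowJoin s₁ s)) (segSet (m + 1) n)
    (places (m + 1) n) (placeSeg (m + 1) n) M

/-- The expansion along the first row, with set `s₁` of positive markers. -/
theorem wordCoeff_succ (m n : ℕ) (M : ℤ → ℤ) :
    wordCoeff (m + 1) n M = ∑ s₁ ∈ (Finset.Icc 1 n).powerset,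
      LaurentPolynomial.T (2 * (s₁.card : ℤ) - n) * rowTerm m n s₁ M := by
  have hd := disjoint_row n (A := Finset.Icc 1 n) (Finset.Subset.refl (crossings m n))
  rw [wordCoeff, stateSum, crossings_succ, sum_powerset_union hd, Finset.powerset_image,
    Finset.sum_image (fun x _ y _ h => Finset.image_injective rowCol_injective h)]
  refine Finset.sum_congr rfl fun s₁ _ => ?_
  rw [Finset.powerset_image,
    Finset.sum_image (fun x _ y _ h => Finset.image_injective rowShift_injective h), rowTerm,
    stateSum, Finset.mul_sum]
  refine Finset.sum_congr rfl fun s hs => ?_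
  rw [Finset.card_union_of_disjoint (disjoint_row n (Finset.mem_powerset.1 hs)),
    Finset.card_union_of_disjoint hd, Finset.card_image_of_injective _ rowCol_injective,
    Finset.card_image_of_injective _ rowCol_injective,
    Finset.card_image_of_injective _ rowShift_injective,
    Finset.card_image_of_injective _ rowShift_injective, ← mul_assoc, ← LaurentPolynomial.T_add,
    rowJoin, Nat.card_Icc]
  congr 2
  push_cast
  omega

/-- The place to which the `j`-th segment of the first horizontal line is contracted: an upper end of
`L(m,n)`, or an extra point if a positive marker and a negative one join the segment to two ends of
the row at the top. -/
def rowHor (s₁ : Finset ℕ) (j : ℕ) : Seg ⊕ ℕ :=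
  if j + 1 ∈ s₁ then .inl (.ver 0 (j + 1)) else if j = 0 ∨ j ∈ s₁ then .inr j else .inl (.ver 0 j)

/-- Contraction of the first row of `L(m+1,n)`, smoothed according to `s₁`. -/
def rowMap (s₁ : Finset ℕ) : Seg → Seg ⊕ ℕ
  | .hor 0 j => .inl (.hor 0 j)
  | .hor 1 j => rowHor s₁ j
  | .hor (i + 2) j => .inl (.hor (i + 1) j)
  | .ver 0 j => if j ∈ s₁ then rowHor s₁ j else rowHor s₁ (j - 1)
  | .ver (i + 1) j => .inl (.ver i j)

/-- The segments of `L(m,n)`, and the extra points, as segments of `L(m+1,n)`. -/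
def rowInv : Seg ⊕ ℕ → Seg
  | .inl (.hor i j) => .hor (i + 1) j
  | .inl (.ver i j) => .ver (i + 1) j
  | .inr j => .hor 1 j

/-- The smoothing `s` of `L(m,n)` with a cap on top at each place where a negative marker of the row
above is followed by a positive one. -/
def rowRel (m n : ℕ) (s₁ : Finset ℕ) (s : Finset (ℕ × ℕ)) (x y : Seg) : Prop :=
  Smooth m n s x y ∨ ∃ j, 1 ≤ j ∧ j ∉ s₁ ∧ j + 1 ∈ s₁ ∧ x = .ver 0 j ∧ y = .ver 0 (j + 1)

/-- The places where a positive marker is followed by a negative one; here the left side of the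
rectangle counts as positive and the right side as negative. -/
def rowArcs (n : ℕ) (s₁ : Finset ℕ) : Set ℕ := {j | j ≤ n ∧ (j = 0 ∨ j ∈ s₁) ∧ j + 1 ∉ s₁}

/-- The first row is contracted: each upper arc becomes an isolated point, and every other segment of
the row is identified with a segment of the remaining rows. -/
theorem value_row {m n : ℕ} {s₁ : Finset ℕ} (h₁ : s₁ ⊆ Finset.Icc 1 n) {s : Finset (ℕ × ℕ)}
    (hs : s ⊆ crossings m n) (M : ℤ → ℤ) :
    value (Smooth (m + 1) n (rowJoin s₁ s)) (segSet (m + 1) n) (places (m + 1) n)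
        (placeSeg (m + 1) n) M =
      value (liftRel (rowRel m n s₁ s)) (Sum.inl '' segSet m n ∪ Sum.inr '' rowArcs n s₁)
        (places (m + 1) n) (fun p => rowMap s₁ (placeSeg (m + 1) n p)) M := by
  set r := Smooth (m + 1) n (rowJoin s₁ s) with hr
  set r' := rowRel m n s₁ s with hr'
  have hmem : ∀ {j}, j ∈ s₁ → 1 ≤ j ∧ j ≤ n := fun h => Finset.mem_Icc.1 (h₁ h)
  have c1 : ∀ {j}, 1 ≤ j → j ≤ n → (1, j) ∈ crossings (m + 1) n := fun h h' => by
    rw [mem_crossings]; omega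
  have pd : ∀ {j}, j + 1 ∈ s₁ → Quot.mk r (.hor 1 j) = Quot.mk r (.ver 1 (j + 1)) := fun {j} h =>
    Quot.sound (.pos_down 1 (j + 1) (c1 (hmem h).1 (hmem h).2) ((mem_rowJoin_one hs).2 h))
  have pu : ∀ {j}, j ∈ s₁ → Quot.mk r (.ver 0 j) = Quot.mk r (.hor 1 j) := fun {j} h =>
    Quot.sound (.pos_up 1 j (c1 (hmem h).1 (hmem h).2) ((mem_rowJoin_one hs).2 h))
  have nd : ∀ {j}, 1 ≤ j → j ≤ n → j ∉ s₁ → Quot.mk r (.hor 1 j) = Quot.mk r (.ver 1 j) :=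
    fun {j} h1 h2 h =>
      Quot.sound (.neg_down 1 j (c1 h1 h2) (fun h' => h ((mem_rowJoin_one hs).1 h')))
  have nu : ∀ {j}, 1 ≤ j → j ≤ n → j ∉ s₁ → Quot.mk r (.ver 0 j) = Quot.mk r (.hor 1 (j - 1)) :=
    fun {j} h1 h2 h =>
      Quot.sound (.neg_up 1 j (c1 h1 h2) (fun h' => h ((mem_rowJoin_one hs).1 h')))
  have hh : ∀ j, j ≤ n → Quot.mk r (rowInv (rowHor s₁ j)) = Quot.mk r (.hor 1 j) := by
    intro j hj
    unfold rowHor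
    split_ifs with h1 h2
    · exact (pd h1).symm
    · rfl
    · rw [not_or] at h2
      exact (nd (by omega) hj h2.2).symm
  have hgf : ∀ x ∈ segSet (m + 1) n, Quot.mk r (rowInv (rowMap s₁ x)) = Quot.mk r x := by
    rintro (⟨_ | _ | i, j⟩ | ⟨_ | i, j⟩) hx <;>
      simp only [segSet, Set.mem_ofPred_eq, Seg.In] at hx
    · omega
    · exact hh j hx.2.2
    · rfl
    · simp only [rowMap]
      split_ifs with h
      · rw [hh j hx.2.2, pu h]
      · rw [hh (j - 1) (by omega), nu hx.2.1 hx.2.2 h]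
    · rfl
  have hsegD : ∀ p ∈ places (m + 1) n, placeSeg (m + 1) n p ∈ segSet (m + 1) n := by
    intro p hp
    simp only [places, Set.mem_Icc] at hp
    unfold placeSeg
    split_ifs <;> simp only [segSet, Set.mem_ofPred_eq, Seg.In] <;> omega
  refine value_congr M (rowMap s₁) rowInv ?_ ?_ ?_ ?_ hgf ?_ ?_ ?_
  · have low : ∀ i j x y, (i + 2, j) ∈ crossings (m + 1) n →
        (((i + 1, j) ∈ crossings m n) → Smooth m n s x y) →
        Quot.mk (liftRel r') (.inl x) = Quot.mk (liftRel r') (.inl y) := by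
      intro i j x y hc h
      refine Quot.sound (.inl (Or.inl (h ?_)))
      rw [mem_crossings] at hc ⊢; omega
    rintro _ _ (⟨_ | _ | i, j, hc, h⟩ | ⟨_ | _ | i, j, hc, h⟩ | ⟨_ | _ | i, j, hc, h⟩ |
      ⟨_ | _ | i, j, hc, h⟩)
    · rw [mem_crossings] at hc; omega
    · rw [mem_rowJoin_one hs] at h
      simp only [rowMap, zero_add, Nat.sub_self, h, if_true]
    · rw [mem_rowJoin_succ (by omega)] at h
      exact low i j _ _ hc fun hc => .pos_up (i + 1) j hc h
    · rw [mem_crossings] at hc; omega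
    · rw [mem_rowJoin_one hs] at h
      have : j - 1 + 1 = j := by have := hmem h; omega
      simp only [rowMap, rowHor, this, h, if_true]
    · rw [mem_rowJoin_succ (by omega)] at h
      exact low i j _ _ hc fun hc => .pos_down (i + 1) j hc h
    · rw [mem_crossings] at hc; omega
    · rw [mem_rowJoin_one hs] at h
      simp only [rowMap, zero_add, Nat.sub_self, h, if_false]
    · rw [mem_rowJoin_succ (by omega)] at h
      exact low i j _ _ hc fun hc => .neg_up (i + 1) j hc h
    · rw [mem_crossings] at hc; omega
    · rw [mem_rowJoin_one hs] at h
      rw [mem_crossings] at hc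
      have hj : j ≠ 0 := by omega
      simp only [rowMap, rowHor, h, hj, or_false, if_false]
      split_ifs with h2
      · exact (Quot.sound (.inl (Or.inr ⟨j, by omega, h, h2, rfl, rfl⟩))).symm
      · rfl
    · rw [mem_rowJoin_succ (by omega)] at h
      exact low i j _ _ hc fun hc => .neg_down (i + 1) j hc h
  · rintro _ _ (h | h)
    swap
    · exact h.elim
    have up : ∀ {i j}, (i, j) ∈ crossings m n → (i + 1, j) ∈ crossings (m + 1) n ∧
        (∀ k, rowInv (.inl (.ver (i - 1) k)) = .ver (i + 1 - 1) k) ∧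
        ((i + 1, j) ∈ rowJoin s₁ s ↔ (i, j) ∈ s) := by
      intro i j hc
      rw [mem_crossings] at hc ⊢
      refine ⟨by omega, fun k => ?_, mem_rowJoin_succ hc.1.1⟩
      simp only [rowInv]; congr 1; omega
    rcases h with (⟨i, j, hc, hs⟩ | ⟨i, j, hc, hs⟩ | ⟨i, j, hc, hs⟩ | ⟨i, j, hc, hs⟩) |
      ⟨j, h1, h2, h3, rfl, rfl⟩
    · obtain ⟨hc', hv, hi⟩ := up hc
      rw [hv]; exact Quot.sound (.pos_up (i + 1) j hc' (hi.2 hs))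
    · obtain ⟨hc', hv, hi⟩ := up hc
      exact Quot.sound (.pos_down (i + 1) j hc' (hi.2 hs))
    · obtain ⟨hc', hv, hi⟩ := up hc
      rw [hv]; exact Quot.sound (.neg_up (i + 1) j hc' (fun h => hs (hi.1 h)))
    · obtain ⟨hc', hv, hi⟩ := up hc
      exact Quot.sound (.neg_down (i + 1) j hc' (fun h => hs (hi.1 h)))
    · have := hmem h3
      exact (nd h1 (by omega) h2).symm.trans (pd h3)
  · rintro x hx
    have hh' : ∀ j, j ≤ n → rowHor s₁ j ∈ Sum.inl '' segSet m n ∪ Sum.inr '' rowArcs n s₁ := by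
      intro j hj
      unfold rowHor
      split_ifs with h1 h2
      · have := hmem h1
        exact Or.inl ⟨_, by simp only [segSet, Set.mem_ofPred_eq, Seg.In]; omega, rfl⟩
      · exact Or.inr ⟨j, ⟨hj, h2, h1⟩, rfl⟩
      · exact Or.inl ⟨_, by simp only [segSet, Set.mem_ofPred_eq, Seg.In]; omega, rfl⟩
    refine ⟨rowMap s₁ x, ?_, rfl⟩
    rcases x with ⟨_ | _ | i, j⟩ | ⟨_ | i, j⟩ <;>
      simp only [segSet, Set.mem_ofPred_eq, Seg.In] at hx
    · omega
    · exact hh' j hx.2.2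
    · exact Or.inl ⟨_, by simp only [segSet, Set.mem_ofPred_eq, Seg.In]; omega, rfl⟩
    · simp only [rowMap]
      split_ifs with h
      · exact hh' j hx.2.2
      · exact hh' (j - 1) (by omega)
    · exact Or.inl ⟨_, by simp only [segSet, Set.mem_ofPred_eq, Seg.In]; omega, rfl⟩
  · rintro _ (⟨⟨i, j⟩ | ⟨i, j⟩, hx, rfl⟩ | ⟨j, hj, rfl⟩)
    · simp only [segSet, Set.mem_ofPred_eq, Seg.In] at hx
      exact ⟨_, by simp only [rowInv, segSet, Set.mem_ofPred_eq, Seg.In]; omega, rfl⟩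
    · simp only [segSet, Set.mem_ofPred_eq, Seg.In] at hx
      exact ⟨_, by simp only [rowInv, segSet, Set.mem_ofPred_eq, Seg.In]; omega, rfl⟩
    · have := hj.1
      exact ⟨_, by simp only [rowInv, segSet, Set.mem_ofPred_eq, Seg.In]; omega, rfl⟩
  · rintro _ (⟨⟨_ | i, j⟩ | ⟨i, j⟩, hx, rfl⟩ | ⟨j, hj, rfl⟩)
    · simp only [segSet, Set.mem_ofPred_eq, Seg.In] at hx; omega
    · rfl
    · rfl
    · simp only [rowInv, rowMap, rowHor, hj.2.1, hj.2.2, if_true, if_false]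
  · intro p hp; rfl
  · intro p hp; exact hgf _ (hsegD p hp)

/-- Where a positive marker is followed by a negative one, two neighbours on the boundary are joined. -/
theorem rowTerm_eq_zero {m n : ℕ} {s₁ : Finset ℕ} {M : ℤ → ℤ} {j : ℕ} (hj : j ∈ rowArcs n s₁)
    (hM : M (m + 1 + j) ≠ m + 1 + j + 1) : rowTerm m n s₁ M = 0 := by
  rw [rowTerm, stateSum]
  refine Finset.sum_eq_zero fun s hs => ?_
  rw [Finset.mem_powerset] at hs
  rw [value, if_neg, mul_zero]
  obtain ⟨h1, h2, h3⟩ := hj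
  intro h
  refine hM ((h _ ?_ _ ?_).2 ⟨by omega, ?_⟩)
  · simp only [places, Set.mem_Icc]; push_cast; omega
  · simp only [places, Set.mem_Icc]; push_cast; omega
  · have e1 : Quot.mk (Smooth (m + 1) n (rowJoin s₁ s)) (placeSeg (m + 1) n (m + 1 + j)) =
        Quot.mk _ (.hor 1 j) := by
      rcases Nat.eq_zero_or_pos j with rfl | hj
      · rw [placeSeg, if_neg (by omega), if_pos (by push_cast; omega)]
        congr 2; push_cast; omega
      · rw [placeSeg, if_neg (by omega), if_neg (by push_cast; omega), if_pos (by push_cast; omega),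
          show (((m : ℤ) + 1 + j) - ((m + 1 : ℕ) : ℤ)).toNat = j by push_cast; omega]
        exact Quot.sound (.pos_up 1 j (by rw [mem_crossings]; omega)
          ((mem_rowJoin_one hs).2 (h2.resolve_left (by omega))))
    have e2 : Quot.mk (Smooth (m + 1) n (rowJoin s₁ s)) (placeSeg (m + 1) n (m + 1 + j + 1)) =
        Quot.mk _ (.hor 1 j) := by
      rcases Nat.lt_or_ge j n with hj | hj
      · rw [placeSeg, if_neg (by omega), if_neg (by push_cast; omega), if_pos (by push_cast; omega),
          show (((m : ℤ) + 1 + j + 1) - ((m + 1 : ℕ) : ℤ)).toNat = j + 1 by push_cast; omega]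
        exact Quot.sound (.neg_up 1 (j + 1) (by rw [mem_crossings]; omega)
          (fun h => h3 ((mem_rowJoin_one hs).1 h)))
      · obtain rfl : j = n := by omega
        rw [placeSeg, if_neg (by omega), if_neg (by push_cast; omega), if_neg (by push_cast; omega)]
        congr 2; push_cast; omega
    rw [e1, e2]

theorem rowMap_place_top {m n j : ℕ} {s₁ : Finset ℕ} (h₁ : s₁ ⊆ Finset.Icc 1 n) (hj : j ≤ n + 1)
    {x : ℤ} (hx : x = m + 1 + j) :
    rowMap s₁ (placeSeg (m + 1) n x) = if j ∈ s₁ then rowHor s₁ j else rowHor s₁ (j - 1) := by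
  subst hx
  have hmem : ∀ {j}, j ∈ s₁ → 1 ≤ j ∧ j ≤ n := fun h => Finset.mem_Icc.1 (h₁ h)
  rcases Nat.eq_zero_or_pos j with rfl | h
  · rw [placeSeg, if_neg (by omega), if_pos (by push_cast; omega),
      show ((((m + 1 : ℕ) : ℤ) + 1 - ((m : ℤ) + 1 + (0 : ℕ)))).toNat = 1 by push_cast; omega,
      if_neg (fun h => by have := hmem h; omega)]
    rfl
  · rcases Nat.lt_or_ge n j with h' | h'
    · obtain rfl : j = n + 1 := by omega
      rw [placeSeg, if_neg (by omega), if_neg (by push_cast; omega), if_neg (by push_cast; omega),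
        show ((m : ℤ) + 1 + ((n + 1 : ℕ) : ℤ) - ((m + 1 : ℕ) : ℤ) - n).toNat = 1 by
          push_cast; omega, if_neg (fun h => by have := hmem h; omega)]
      rfl
    · rw [placeSeg, if_neg (by omega), if_neg (by push_cast; omega), if_pos (by push_cast; omega),
        show ((m : ℤ) + 1 + j - ((m + 1 : ℕ) : ℤ)).toNat = j by push_cast; omega]
      rfl

theorem rowMap_place_low {m n : ℕ} {s₁ : Finset ℕ} {y : ℤ} (hy : y ≤ m) :
    rowMap s₁ (placeSeg (m + 1) n y) = .inl (placeSeg m n y) := by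
  unfold placeSeg
  rcases le_or_gt y 0 with h | h
  · rw [if_pos h, if_pos h]; rfl
  · rw [if_neg (by omega), if_pos (by push_cast; omega), if_neg (by omega), if_pos hy]
    obtain ⟨i, hi⟩ : ∃ i : ℕ, (i : ℤ) = m - y := ⟨(m - y).toNat, by omega⟩
    rw [show (((m + 1 : ℕ) : ℤ) + 1 - y).toNat = i + 2 by push_cast; omega,
      show ((m : ℤ) + 1 - y).toNat = i + 1 by omega]
    rfl

theorem rowMap_place_high {m n : ℕ} {s₁ : Finset ℕ} {x : ℤ} (hx : (m : ℤ) + n + 2 < x) :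
    rowMap s₁ (placeSeg (m + 1) n x) = .inl (.hor (x - 2 - m - n).toNat n) := by
  rw [placeSeg, if_neg (by omega), if_neg (by push_cast; omega), if_neg (by push_cast; omega)]
  obtain ⟨i, hi⟩ : ∃ i : ℕ, (i : ℤ) = x - 3 - m - n := ⟨(x - 3 - m - n).toNat, by omega⟩
  rw [show (x - ((m + 1 : ℕ) : ℤ) - n).toNat = i + 2 by push_cast; omega,
    show (x - 2 - m - n).toNat = i + 1 by omega]
  rfl

theorem rowHor_left {s₁ : Finset ℕ} {j : ℕ} (h : j + 1 ∈ s₁) : rowHor s₁ j = .inl (.ver 0 (j + 1)) :=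
  if_pos h

theorem rowHor_right {s₁ : Finset ℕ} {j : ℕ} (h : j + 1 ∉ s₁) (h0 : j ≠ 0) (h' : j ∉ s₁) :
    rowHor s₁ j = .inl (.ver 0 j) := by
  rw [rowHor, if_neg h, if_neg (by tauto)]

theorem rowHor_arc {n : ℕ} {s₁ : Finset ℕ} {j : ℕ} (h : j ∈ rowArcs n s₁) : rowHor s₁ j = .inr j := by
  rw [rowHor, if_neg h.2.2, if_pos h.2.1]

theorem rowMap_arc {m n a : ℕ} {s₁ : Finset ℕ} (h₁ : s₁ ⊆ Finset.Icc 1 n) (ha : a ∈ rowArcs n s₁)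
    {x : ℤ} (hx : x = m + 1 + a ∨ x = m + 1 + a + 1) :
    rowMap s₁ (placeSeg (m + 1) n x) = .inr a := by
  have hn := ha.1
  rcases hx with hx | hx
  · rw [rowMap_place_top h₁ (j := a) (by omega) hx]
    split_ifs with h
    · exact rowHor_arc ha
    · obtain rfl : a = 0 := ha.2.1.resolve_right h
      exact rowHor_arc ha
  · rw [rowMap_place_top h₁ (j := a + 1) (by omega) (by push_cast; omega), if_neg ha.2.2]
    exact rowHor_arc ha

theorem rowMap_plus {m n j : ℕ} {s₁ : Finset ℕ} (h₁ : s₁ ⊆ Finset.Icc 1 n) (hj : j = 0 ∨ j ∈ s₁)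
    (hj' : j + 1 ∈ s₁) {x : ℤ} (hx : x = m + 1 + j) :
    rowMap s₁ (placeSeg (m + 1) n x) = .inl (.ver 0 (j + 1)) := by
  have := Finset.mem_Icc.1 (h₁ hj')
  rw [rowMap_place_top h₁ (j := j) (by omega) hx]
  split_ifs with h
  · exact rowHor_left hj'
  · obtain rfl : j = 0 := hj.resolve_right h
    exact rowHor_left hj'

theorem rowMap_minus {m n j : ℕ} {s₁ : Finset ℕ} (h₁ : s₁ ⊆ Finset.Icc 1 n) (hn : j ≤ n) (h0 : j ≠ 0)
    (hj : j ∉ s₁) (hj' : j + 1 ∉ s₁) {x : ℤ} (hx : x = m + 1 + j + 1) :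
    rowMap s₁ (placeSeg (m + 1) n x) = .inl (.ver 0 j) := by
  rw [rowMap_place_top h₁ (j := j + 1) (by omega) (by push_cast; omega), if_neg hj']
  exact rowHor_right hj' h0 hj

/-- The row with `a` positive markers followed by negative ones peels off the arc at the place
`m + 1 + a`. -/
theorem rowTerm_one {m n a : ℕ} (ha : a ≤ n) (M : ℤ → ℤ) :
    rowTerm m n (Finset.Icc 1 a) (ins (m + 1 + a) M) = wordCoeff m n M := by
  rw [rowTerm, wordCoeff, stateSum, stateSum]
  refine Finset.sum_congr rfl fun s hs => ?_
  rw [Finset.mem_powerset] at hs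
  have hsub : Finset.Icc 1 a ⊆ Finset.Icc 1 n := Finset.Icc_subset_Icc_right ha
  have hrel : rowRel m n (Finset.Icc 1 a) s = Smooth m n s := by
    funext x y
    refine propext ⟨?_, Or.inl⟩
    rintro (h | ⟨j, h1, h2, h3, -⟩)
    · exact h
    · rw [Finset.mem_Icc] at h2 h3; omega
  have harcs : rowArcs n (Finset.Icc 1 a) = {a} := by
    ext j
    simp only [rowArcs, Set.mem_ofPred_eq, Finset.mem_Icc, Set.mem_singleton_iff]
    omega
  rw [value_row hsub hs, hrel, harcs, Set.image_singleton, Set.union_singleton,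
    value_remove_arc (D' := places m n) (seg' := fun p => Sum.inl (placeSeg m n p)) M
      (liftRel_isolated _ a), value_inl (.hor 0 0)]
  · simp
  · exact rowMap_arc hsub (harcs ▸ rfl) (Or.inl rfl)
  · exact rowMap_arc hsub (harcs ▸ rfl) (Or.inr rfl)
  · intro y hy
    simp only [places, Set.mem_Icc] at hy
    refine ⟨?_, by simp⟩
    rcases le_or_gt y m with h0 | h0
    · rw [show sk (m + 1 + a) y = y by unfold sk; split_ifs <;> omega, rowMap_place_low h0]
    rcases lt_or_ge ((m : ℤ) + n) y with h1 | h1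
    · rw [show sk (m + 1 + a) y = y + 2 by unfold sk; split_ifs <;> omega,
        rowMap_place_high (by omega), placeSeg, if_neg (by omega), if_neg (by omega),
        if_neg (by omega)]
      congr 3; ring
    obtain ⟨j, hj⟩ : ∃ j : ℕ, (j : ℤ) = y - m - 1 := ⟨(y - m - 1).toNat, by omega⟩
    have hy' : placeSeg m n y = .ver 0 (j + 1) := by
      rw [placeSeg, if_neg (by omega), if_neg (by omega), if_pos (by omega),
        show (y - m).toNat = j + 1 by omega]
    rw [hy']
    rcases lt_or_ge j a with h2 | h2
    · exact rowMap_plus hsub (by rw [Finset.mem_Icc]; omega) (by rw [Finset.mem_Icc]; omega)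
        (by unfold sk; split_ifs <;> omega)
    · exact rowMap_minus hsub (by omega) (by omega) (by rw [Finset.mem_Icc]; omega)
        (by rw [Finset.mem_Icc]; omega) (by unfold sk; push_cast; split_ifs <;> omega)
  · intro x
    simp only [places, Set.mem_Icc]
    constructor
    · intro hx
      rcases sk_cases (m + 1 + a) x with h | h | ⟨y, h⟩
      · exact Or.inl h
      · exact Or.inr (Or.inl h)
      · refine Or.inr (Or.inr ⟨y, ?_, h⟩)
        rw [h] at hx; revert hx
        unfold sk; push_cast; split_ifs <;> omega
    · rintro (rfl | rfl | ⟨y, hy, rfl⟩)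
      · push_cast; omega
      · push_cast; omega
      · unfold sk; push_cast; split_ifs <;> omega

/-- The row with `a` positive, then `b - a` negative, `e - b` positive, and again negative markers peels
off two arcs, and its cap at `b` slides down to the bottom. -/
theorem rowTerm_two_eq {m n a b e : ℕ} (hab : a < b) (hbe : b < e) (hen : e ≤ n) (M : ℤ → ℤ) :
    rowTerm m n (Finset.Icc 1 a ∪ Finset.Icc (b + 1) e) (ins (m + 1 + a) (ins (m + e - 1) M)) =
      stateSum (slideCrossings m n b 0) (slideRel m n b 0) (slideSegs m n b 0) (slidePlaces m n)
        (slidePlaceSeg m n b) M := by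
  have hX : slideCrossings m n b 0 = crossings m n := by
    ext ⟨i, j⟩
    simp only [slideCrossings, Finset.mem_filter, mem_crossings]; omega
  have hS : slideSegs m n b 0 = segSet m n := by
    ext x; simp [slideSegs, segSet]
  rw [rowTerm, stateSum, stateSum, hX, hS]
  refine Finset.sum_congr rfl fun s hs => ?_
  rw [Finset.mem_powerset] at hs
  set s₁ := Finset.Icc 1 a ∪ Finset.Icc (b + 1) e with hs₁
  have hm : ∀ j, j ∈ s₁ ↔ (1 ≤ j ∧ j ≤ a) ∨ (b + 1 ≤ j ∧ j ≤ e) := fun j => by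
    rw [hs₁, Finset.mem_union, Finset.mem_Icc, Finset.mem_Icc]
  have hsub : s₁ ⊆ Finset.Icc 1 n := fun j hj => by
    rw [hm] at hj; rw [Finset.mem_Icc]; omega
  have hrel : rowRel m n s₁ s = slideRel m n b 0 s := by
    funext x y
    unfold rowRel slideRel
    rw [hX, smooth_iff]
    refine propext (or_congr_right ⟨?_, ?_⟩)
    · rintro ⟨j, h1, h2, h3, rfl, rfl⟩
      rw [hm] at h2 h3
      obtain rfl : j = b := by omega
      exact Or.inr ⟨rfl, rfl⟩
    · rintro (⟨p, h1, h2, -⟩ | ⟨rfl, rfl⟩)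
      · omega
      · exact ⟨b, by omega, by rw [hm]; omega, by rw [hm]; omega, rfl, rfl⟩
  have harcs : rowArcs n s₁ = {a, e} := by
    ext j
    simp only [rowArcs, Set.mem_ofPred_eq, hm, Set.mem_singleton_iff, Set.mem_insert_iff]
    omega
  have haA : a ∈ rowArcs n s₁ := by rw [harcs]; exact Or.inl rfl
  have heA : e ∈ rowArcs n s₁ := by rw [harcs]; exact Or.inr rfl
  have hset : Sum.inl '' segSet m n ∪ Sum.inr '' rowArcs n s₁ =
      insert (Sum.inr a) (insert (Sum.inr e) (Sum.inl '' segSet m n)) := by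
    ext x
    rw [harcs, Set.image_pair]
    simp only [Set.mem_union, Set.mem_insert_iff, Set.mem_singleton_iff]
    tauto
  -- the boundary segments away from the two arcs
  have hseg : ∀ y ∈ slidePlaces m n, rowMap s₁ (placeSeg (m + 1) n (sk (m + 1 + a) (sk (m + e - 1) y))) =
      .inl (slidePlaceSeg m n b y) := by
    intro y hy
    simp only [slidePlaces, Set.mem_Icc] at hy
    rcases le_or_gt y m with h0 | h0
    · rw [show sk (m + 1 + a) (sk (m + e - 1) y) = y by unfold sk; split_ifs <;> omega,
        rowMap_place_low h0]
      unfold placeSeg slidePlaceSeg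
      rcases le_or_gt y 0 with h1 | h1
      · rw [if_pos h1, if_pos h1]
      · rw [if_neg (by omega), if_pos h0, if_neg (by omega), if_pos h0]
    rcases lt_or_ge ((m : ℤ) + n - 2) y with h1 | h1
    · rw [show sk (m + 1 + a) (sk (m + e - 1) y) = y + 4 by unfold sk; split_ifs <;> omega,
        rowMap_place_high (by omega), slidePlaceSeg, if_neg (by omega), if_neg (by omega),
        if_neg (by omega), if_neg (by omega)]
      congr 3; ring
    obtain ⟨j, hj⟩ : ∃ j : ℕ, (j : ℤ) = y - m - 1 := ⟨(y - m - 1).toNat, by omega⟩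
    rw [slidePlaceSeg, if_neg (by omega), if_neg (by omega)]
    rcases lt_or_ge y (m + b) with h2 | h2
    · rw [if_pos h2, show (y - m).toNat = j + 1 by omega]
      rcases lt_or_ge j a with h3 | h3
      · exact rowMap_plus hsub (by rw [hm]; omega) (by rw [hm]; omega)
          (by unfold sk; split_ifs <;> omega)
      · exact rowMap_minus hsub (by omega) (by omega) (by rw [hm]; omega)
          (by rw [hm]; omega) (by unfold sk; push_cast; split_ifs <;> omega)
    · rw [if_neg (by omega), if_pos (by omega), show (y - m + 2).toNat = j + 3 by omega]
      rcases lt_or_ge (j + 2) e with h3 | h3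
      · exact rowMap_plus (j := j + 2) hsub (by rw [hm]; omega) (by rw [hm]; omega)
          (by unfold sk; push_cast; split_ifs <;> omega)
      · exact rowMap_minus hsub (by omega) (by omega) (by rw [hm]; omega)
          (by rw [hm]; omega) (by unfold sk; push_cast; split_ifs <;> omega)
  rw [value_row hsub hs, hrel, hset,
    value_remove_arc (D' := places m n)
      (seg' := fun p => rowMap s₁ (placeSeg (m + 1) n (sk (m + 1 + a) p))) _
      (liftRel_isolated _ a),
    value_remove_arc (D' := slidePlaces m n) (seg' := fun p => Sum.inl (slidePlaceSeg m n b p)) M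
      (liftRel_isolated _ e), value_inl (.hor 0 0)]
  · simp
  · exact rowMap_arc hsub heA (Or.inl (by unfold sk; split_ifs <;> omega))
  · exact rowMap_arc hsub heA (Or.inr (by unfold sk; split_ifs <;> omega))
  · intro y hy
    exact ⟨hseg y hy, by simp⟩
  · intro x
    simp only [places, slidePlaces, Set.mem_Icc]
    constructor
    · intro hx
      rcases sk_cases (m + e - 1) x with h | h | ⟨y, h⟩
      · exact Or.inl h
      · exact Or.inr (Or.inl h)
      · refine Or.inr (Or.inr ⟨y, ?_, h⟩)
        rw [h] at hx; revert hx
        unfold sk; split_ifs <;> omega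
    · rintro (rfl | rfl | ⟨y, hy, rfl⟩)
      · omega
      · omega
      · unfold sk; split_ifs <;> omega
  · simp only [Set.mem_insert_iff, Sum.inr.injEq]
    rintro (h | ⟨x, -, h⟩)
    · omega
    · cases h
  · exact rowMap_arc hsub haA (Or.inl rfl)
  · exact rowMap_arc hsub haA (Or.inr rfl)
  · intro y hy
    refine ⟨rfl, ?_⟩
    rcases sk_cases (m + e - 1) y with rfl | rfl | ⟨y, rfl⟩
    · rw [rowMap_arc hsub heA (Or.inl (by unfold sk; split_ifs <;> omega))]
      simp only [ne_eq, Sum.inr.injEq]; omega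
    · rw [rowMap_arc hsub heA (Or.inr (by unfold sk; split_ifs <;> omega))]
      simp only [ne_eq, Sum.inr.injEq]; omega
    · rw [hseg]
      · simp
      · simp only [places, slidePlaces, Set.mem_Icc] at hy ⊢
        revert hy
        unfold sk; split_ifs <;> omega
  · intro x
    simp only [places, Set.mem_Icc]
    constructor
    · intro hx
      rcases sk_cases (m + 1 + a) x with h | h | ⟨y, h⟩
      · exact Or.inl h
      · exact Or.inr (Or.inl h)
      · refine Or.inr (Or.inr ⟨y, ?_, h⟩)
        rw [h] at hx; revert hx
        unfold sk; push_cast; split_ifs <;> omega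
    · rintro (rfl | rfl | ⟨y, hy, rfl⟩)
      · push_cast; omega
      · push_cast; omega
      · unfold sk; push_cast; split_ifs <;> omega

/-- If the word has the two arcs cut off by the first row, and the bottom return to which the cap below
the row slides down, then all three can be removed. -/
theorem rowTerm_two {m n a b e : ℕ} (hab : a < b) (hbe : b < e) (hen : e ≤ n) (M : ℤ → ℤ) :
    rowTerm m n (Finset.Icc 1 a ∪ Finset.Icc (b + 1) e)
      (ins (m + 1 + a) (ins (m + e - 1) (ins (-(b : ℤ)) M))) = wordCoeff m (n - 2) M := by
  rw [rowTerm_two_eq hab hbe hen, slide_ins (by omega) (by omega)]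

theorem rowTerm_two_zero {m n a b e : ℕ} (hab : a < b) (hbe : b < e) (hen : e ≤ n) {M : ℤ → ℤ}
    (hM : M (-(b : ℤ)) ≠ -b + 1) :
    rowTerm m n (Finset.Icc 1 a ∪ Finset.Icc (b + 1) e) (ins (m + 1 + a) (ins (m + e - 1) M)) = 0 := by
  rw [rowTerm_two_eq hab hbe hen, slide_zero (by omega) (by omega) hM]

/-- The sets of positive markers of a row: `[1,a]`, or `[1,a] ∪ [b+1,e]`, or there are three places
where a positive marker is followed by a negative one. -/
theorem row_trichotomy {n : ℕ} {s₁ : Finset ℕ} (h₁ : s₁ ⊆ Finset.Icc 1 n) :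
    (∃ a, a ≤ n ∧ s₁ = Finset.Icc 1 a) ∨
    (∃ a b e, a < b ∧ b < e ∧ e ≤ n ∧ s₁ = Finset.Icc 1 a ∪ Finset.Icc (b + 1) e) ∨
    (∃ a b e, a < b ∧ b < e ∧ a ∈ rowArcs n s₁ ∧ b ∈ rowArcs n s₁ ∧ e ∈ rowArcs n s₁) := by
  have hmem : ∀ {j}, j ∈ s₁ → 1 ≤ j ∧ j ≤ n := fun h => Finset.mem_Icc.1 (h₁ h)
  -- the end of the block of positive markers that starts after `j`
  have run : ∀ j, j ≤ n → ∃ a, j ≤ a ∧ a ≤ n ∧ (∀ i, j < i → i ≤ a → i ∈ s₁) ∧ a + 1 ∉ s₁ := by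
    intro j hj
    have hex : ∃ i, j < i ∧ i ∉ s₁ := ⟨n + 1, by omega, fun h => by have := hmem h; omega⟩
    classical
    have hs := Nat.find_spec hex
    have hmin : ∀ i, i < Nat.find hex → ¬ (j < i ∧ i ∉ s₁) := fun i hi => Nat.find_min hex hi
    have hle : Nat.find hex ≤ n + 1 := Nat.find_min' hex ⟨by omega, fun h => by have := hmem h; omega⟩
    refine ⟨Nat.find hex - 1, by omega, by omega, fun i h1 h2 => ?_, ?_⟩
    · by_contra h; exact hmin i (by omega) ⟨h1, h⟩
    · rw [show Nat.find hex - 1 + 1 = Nat.find hex by omega]; exact hs.2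
  -- the next positive marker
  have next : ∀ a, (∀ i, a < i → i ∉ s₁) ∨ ∃ b, a ≤ b ∧ b + 1 ∈ s₁ ∧ ∀ i, a < i → i ≤ b → i ∉ s₁ := by
    intro a
    by_cases hex : ∃ i, a < i ∧ i ∈ s₁
    · classical
      have hs := Nat.find_spec hex
      have hmin : ∀ i, i < Nat.find hex → ¬ (a < i ∧ i ∈ s₁) := fun i hi => Nat.find_min hex hi
      refine Or.inr ⟨Nat.find hex - 1, by omega, ?_, fun i h1 h2 h => hmin i (by omega) ⟨h1, h⟩⟩
      rw [show Nat.find hex - 1 + 1 = Nat.find hex by omega]; exact hs.2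
    · exact Or.inl fun i hi h => hex ⟨i, hi, h⟩
  obtain ⟨a, -, ha, ha1, ha2⟩ := run 0 (by omega)
  have haA : a ∈ rowArcs n s₁ := by
    refine ⟨ha, ?_, ha2⟩
    rcases Nat.eq_zero_or_pos a with h | h
    · exact Or.inl h
    · exact Or.inr (ha1 a h le_rfl)
  rcases next a with h | ⟨b, hb0, hb1, hb2⟩
  · refine Or.inl ⟨a, ha, ?_⟩
    ext i
    rw [Finset.mem_Icc]
    constructor
    · intro hi
      refine ⟨(hmem hi).1, ?_⟩
      by_contra h'; exact h i (by omega) hi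
    · intro hi; exact ha1 i (by omega) hi.2
  have hab : a < b := by
    rcases Nat.lt_or_ge a b with h | h
    · exact h
    · obtain rfl : a = b := by omega
      exact absurd hb1 ha2
  obtain ⟨e, he0, he, he1, he2⟩ := run b (by have := hmem hb1; omega)
  have hbe : b < e := by
    rcases Nat.lt_or_ge b e with h | h
    · exact h
    · obtain rfl : b = e := by omega
      exact absurd hb1 he2
  rcases next e with h | ⟨c, hc0, hc1, hc2⟩
  · refine Or.inr (Or.inl ⟨a, b, e, hab, hbe, he, ?_⟩)
    ext i
    rw [Finset.mem_union, Finset.mem_Icc, Finset.mem_Icc]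
    constructor
    · intro hi
      have h1 := (hmem hi).1
      by_contra h'
      rcases Nat.lt_or_ge e i with h2 | h2
      · exact h i h2 hi
      · exact hb2 i (by omega) (by omega) hi
    · rintro (hi | hi)
      · exact ha1 i (by omega) hi.2
      · exact he1 i (by omega) hi.2
  · obtain ⟨d, hd0, hd, hd1, hd2⟩ := run c (by have := hmem hc1; omega)
    have hcd : c < d := by
      rcases Nat.lt_or_ge c d with h | h
      · exact h
      · obtain rfl : c = d := by omega
        exact absurd hc1 hd2
    exact Or.inr (Or.inr ⟨a, e, d, by omega, by omega, haA,
      ⟨he, Or.inr (he1 e hbe le_rfl), he2⟩, ⟨hd, Or.inr (hd1 d hcd le_rfl), hd2⟩⟩)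

/-- In a lattice crossing of height zero only the identity is realized. -/
theorem wordCoeff_zero {n : ℕ} {M : ℤ → ℤ} (h : wordCoeff 0 n M ≠ 0) {x : ℤ} (h1 : 1 ≤ x)
    (h2 : x ≤ n) : M x = 1 - x := by
  have hX : crossings 0 n = ∅ := by
    ext ⟨i, j⟩; rw [mem_crossings]; simp; omega
  rw [wordCoeff, stateSum, hX, Finset.powerset_empty, Finset.sum_singleton, value] at h
  have hI : Induces (Smooth 0 n ∅) (places 0 n) (placeSeg 0 n) M := by
    by_contra h'; rw [if_neg h', mul_zero] at h; exact h rfl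
  refine (hI x ?_ _ ?_).2 ⟨by omega, ?_⟩
  · simp only [places, Set.mem_Icc]; push_cast; omega
  · simp only [places, Set.mem_Icc]; push_cast; omega
  · congr 1
    unfold placeSeg
    rw [if_neg (by omega), if_neg (by push_cast; omega), if_pos (by push_cast; omega), if_pos (by omega)]
    congr 1; push_cast; omega

theorem wordCoeff_zero_id {n : ℕ} {M : ℤ → ℤ} (h : ∀ x, 1 - (n : ℤ) ≤ x → x ≤ n → M x = 1 - x) :
    wordCoeff 0 n M = 1 := by
  have hX : crossings 0 n = ∅ := by
    ext ⟨i, j⟩; rw [mem_crossings]; simp; omega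
  have hiso : ∀ v, Isolated (Smooth 0 n ∅) v := by
    intro v x
    constructor <;> rintro (⟨i, j, hc, _⟩ | ⟨i, j, hc, _⟩ | ⟨i, j, hc, _⟩ | ⟨i, j, hc, _⟩) <;>
      rw [hX] at hc <;> simp at hc
  have hp : ∀ x, 1 - (n : ℤ) ≤ x → x ≤ n →
      placeSeg 0 n x = .ver 0 (if x ≤ 0 then 1 - x else x).toNat := by
    intro x h1 h2
    unfold placeSeg
    split_ifs <;> push_cast at * <;> first | omega | rfl | (congr 2; omega)
  rw [wordCoeff, stateSum, hX, Finset.powerset_empty, Finset.sum_singleton, value, if_pos]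
  · have : closedComps (Smooth 0 n ∅) (segSet 0 n) (places 0 n) (placeSeg 0 n) = 0 := by
      unfold closedComps
      refine (congrArg Set.ncard ?_).trans (Set.ncard_empty _)
      rw [Set.eq_empty_iff_forall_notMem]
      rintro _ ⟨⟨⟨i, j⟩ | ⟨i, j⟩, hx, rfl⟩, h⟩ <;>
        simp only [segSet, Set.mem_ofPred_eq, Seg.In] at hx
      · omega
      · refine h j (by simp only [places, Set.mem_Icc]; push_cast; omega) ?_
        rw [hp j (by omega) (by omega), if_neg (by omega)]
        congr 2; omega
    rw [this]; simp
  · intro x hx y hy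
    simp only [places, Set.mem_Icc] at hx hy
    push_cast at hx hy
    rw [(hiso _).mk_eq, h x (by omega) (by omega), hp x (by omega) (by omega),
      hp y (by omega) (by omega), Seg.ver.injEq]
    split_ifs <;> omega

/-! ### Crossingless connections as words -/

/-- The place of a boundary point in the word of a crossingless connection with `h` left and `t` top
points: the boundary is traversed clockwise from the lower right corner, and `0` and `1` are
the places next to the lower left corner. -/
def place (h t : ℕ) : Pt → ℤ
  | .left i => h + 1 - i
  | .right i => h + t + i
  | .top i => h + i
  | .bot i => 1 - i

/-- The boundary point at a given place. -/
def ptAt (h t : ℕ) (x : ℤ) : Pt :=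
  if x ≤ 0 then .bot (1 - x).toNat
  else if x ≤ h then .left (h + 1 - x).toNat
  else if x ≤ h + t then .top (x - h).toNat
  else .right (x - h - t).toNat

theorem ptAt_bot {h t : ℕ} {x : ℤ} (h1 : x ≤ 0) : ptAt h t x = .bot (1 - x).toNat := if_pos h1

theorem ptAt_left {h t : ℕ} {x : ℤ} (h1 : 0 < x) (h2 : x ≤ h) :
    ptAt h t x = .left (h + 1 - x).toNat := by
  rw [ptAt, if_neg (by omega), if_pos h2]

theorem ptAt_top {h t : ℕ} {x : ℤ} (h1 : (h : ℤ) < x) (h2 : x ≤ h + t) :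
    ptAt h t x = .top (x - h).toNat := by
  rw [ptAt, if_neg (by omega), if_neg (by omega), if_pos h2]

theorem ptAt_right {h t : ℕ} {x : ℤ} (h1 : (h : ℤ) + t < x) :
    ptAt h t x = .right (x - h - t).toNat := by
  rw [ptAt, if_neg (by omega), if_neg (by omega), if_neg (by omega)]

theorem place_mem {h t b : ℕ} {p : Pt} (hp : p.On h t b) :
    1 - (b : ℤ) ≤ place h t p ∧ place h t p ≤ 2 * h + t := by
  rcases p with i | i | i | i <;> simp only [Pt.On] at hp <;> simp only [place] <;> omega

theorem ptAt_place {h t b : ℕ} {p : Pt} (hp : p.On h t b) : ptAt h t (place h t p) = p := by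
  rcases p with i | i | i | i <;> simp only [Pt.On] at hp <;> rw [place]
  · rw [ptAt_left (by omega) (by omega)]; congr 1; omega
  · rw [ptAt_right (by omega)]; congr 1; omega
  · rw [ptAt_top (by omega) (by omega)]; congr 1; omega
  · rw [ptAt_bot (by omega)]; congr 1; omega

theorem ptAt_on {h t b : ℕ} {x : ℤ} (h1 : 1 - (b : ℤ) ≤ x) (h2 : x ≤ 2 * h + t) :
    (ptAt h t x).On h t b := by
  unfold ptAt
  split_ifs <;> simp only [Pt.On] <;> omega

theorem place_ptAt {h t : ℕ} (x : ℤ) : place h t (ptAt h t x) = x := by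
  unfold ptAt
  split_ifs <;> simp only [place] <;> omega

theorem place_inj {h t b : ℕ} {p q : Pt} (hp : p.On h t b) (hq : q.On h t b)
    (e : place h t p = place h t q) : p = q := by
  rw [← ptAt_place hp, e, ptAt_place hq]

/-- The position of a boundary point is determined by its place, up to the different starting point and
direction. -/
theorem pos_eq {h t b : ℕ} {p : Pt} (hp : p.On h t b) :
    (p.pos h t b : ℤ) = if place h t p ≤ h then h + 1 - place h t p
      else h + 1 - place h t p + (2 * h + t + b) := by
  rcases p with i | i | i | i <;> simp only [Pt.On] at hp <;> simp only [place, Pt.pos] <;>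
    split_ifs <;> omega

/-- The matching of the places that belongs to a crossingless connection. -/
def Conn.word (C : Conn) (x : ℤ) : ℤ :=
  if 1 - (C.nb : ℤ) ≤ x ∧ x ≤ 2 * C.ht + C.nt then place C.ht C.nt (C.mate (ptAt C.ht C.nt x)) else x

theorem Conn.word_place (C : Conn) {p : Pt} (hp : C.Bd p) :
    C.word (place C.ht C.nt p) = place C.ht C.nt (C.mate p) := by
  rw [Conn.word, if_pos (place_mem hp), ptAt_place hp]

theorem Conn.exists_place (C : Conn) {x : ℤ} (h1 : 1 - (C.nb : ℤ) ≤ x) (h2 : x ≤ 2 * C.ht + C.nt) :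
    ∃ p, C.Bd p ∧ place C.ht C.nt p = x :=
  ⟨_, ptAt_on h1 h2, place_ptAt x⟩

theorem Conn.mate_eq_iff (C : Conn) {p q : Pt} (hp : C.Bd p) (hq : C.Bd q) :
    C.mate p = q ↔ C.word (place C.ht C.nt p) = place C.ht C.nt q := by
  rw [C.word_place hp]
  exact ⟨fun h => by rw [h], fun h => place_inj (C.mate_on p hp) hq h⟩

theorem Conn.word_off (C : Conn) {x : ℤ} (h : ¬ (1 - (C.nb : ℤ) ≤ x ∧ x ≤ 2 * C.ht + C.nt)) :
    C.word x = x := if_neg h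

theorem Conn.isWord (C : Conn) : IsWord C.nb (2 * C.ht + C.nt) C.word := by
  have on : ∀ x, C.word x ≠ x → 1 - (C.nb : ℤ) ≤ x ∧ x ≤ 2 * C.ht + C.nt := fun x h => by
    by_contra h'; exact h (C.word_off h')
  refine ⟨fun x => ?_, fun x hx => C.word_off (by omega), fun x h1 h2 => ?_, fun x y h1 h2 h3 => ?_⟩
  · by_cases h : 1 - (C.nb : ℤ) ≤ x ∧ x ≤ 2 * C.ht + C.nt
    · obtain ⟨p, hp, rfl⟩ := C.exists_place h.1 h.2
      rw [C.word_place hp, C.word_place (C.mate_on p hp), C.mate_mate]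
    · rw [C.word_off h, C.word_off h]
  · obtain ⟨p, hp, rfl⟩ := C.exists_place h1 h2
    rw [C.word_place hp]
    exact fun h => C.mate_ne p hp (place_inj (C.mate_on p hp) hp h)
  · have hx := on x (by omega)
    have hy := on y (by omega)
    obtain ⟨p, hp, rfl⟩ := C.exists_place hx.1 hx.2
    obtain ⟨q, hq, rfl⟩ := C.exists_place hy.1 hy.2
    have hp' := C.mate_on p hp
    have hq' := C.mate_on q hq
    rw [C.word_place hp] at h2 h3
    rw [C.word_place hq] at h3
    -- the cut of `Pt.pos` at the upper left corner may separate the four ends at any place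
    have n1 := C.noncrossing _ _ hq' hp'
    have n2 := C.noncrossing _ _ hp hq'
    have n3 := C.noncrossing _ _ hq hp
    have n4 := C.noncrossing _ _ hp' hq
    simp only [C.mate_mate] at n1 n2 n3 n4
    have e1 := pos_eq hp
    have e2 := pos_eq hq
    have e3 := pos_eq hp'
    have e4 := pos_eq hq'
    have m1 := place_mem hp
    have m4 := place_mem hq'
    split_ifs at e1 e2 e3 e4 <;> omega

open Classical in
/-- The crossingless connection with a given word. -/
def ofWord (h t b : ℕ) (M : ℤ → ℤ) (hM : IsWord b (2 * h + t) M) : Conn where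
  ht := h
  nt := t
  nb := b
  mate p := if p.On h t b then ptAt h t (M (place h t p)) else p
  mate_on p hp := by
    rw [if_pos hp]
    have := place_mem hp
    have h1 : ¬ (M (place h t p) < 1 - b ∨ 2 * (h : ℤ) + t < M (place h t p)) := fun hh => by
      have := hM.off _ hh
      rw [hM.invol] at this
      omega
    exact ptAt_on (by omega) (by omega)
  mate_off p hp := if_neg hp
  mate_ne p hp := by
    rw [if_pos hp]
    have := place_mem hp
    intro e
    refine hM.ne _ this.1 this.2 ?_
    conv_rhs => rw [← e]
    rw [place_ptAt]
  mate_mate p := by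
    by_cases hp : p.On h t b
    · have := place_mem hp
      have h1 : ¬ (M (place h t p) < 1 - b ∨ 2 * (h : ℤ) + t < M (place h t p)) := fun hh => by
        have := hM.off _ hh
        rw [hM.invol] at this
        omega
      rw [if_pos hp, if_pos (ptAt_on (by omega) (by omega)), place_ptAt, hM.invol, ptAt_place hp]
    · rw [if_neg hp, if_neg hp]
  noncrossing p q hp hq := by
    have hin : ∀ p : Pt, p.On h t b → (ptAt h t (M (place h t p))).On h t b := fun p hp => by
      have := place_mem hp
      have h1 : ¬ (M (place h t p) < 1 - b ∨ 2 * (h : ℤ) + t < M (place h t p)) := fun hh => by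
        have := hM.off _ hh
        rw [hM.invol] at this
        omega
      exact ptAt_on (by omega) (by omega)
    rw [if_pos hp, if_pos hq]
    rintro ⟨h1, h2, h3⟩
    have e1 := pos_eq hp
    have e2 := pos_eq hq
    have e3 := pos_eq (hin p hp)
    have e4 := pos_eq (hin q hq)
    rw [place_ptAt] at e3 e4
    have m1 := place_mem hp
    have m2 := place_mem hq
    have m3 := place_mem (hin p hp)
    have m4 := place_mem (hin q hq)
    rw [place_ptAt] at m3 m4
    have nc : ∀ x y, ¬ (x < y ∧ y < M x ∧ M x < M y) := fun x y h => hM.nc x y h.1 h.2.1 h.2.2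
    have n1 := nc (M (place h t q)) (M (place h t p))
    have n2 := nc (place h t p) (M (place h t q))
    have n3 := nc (place h t q) (place h t p)
    have n4 := nc (M (place h t p)) (place h t q)
    simp only [hM.invol] at n1 n2 n3 n4
    split_ifs at e1 e2 e3 e4 <;> omega

open Classical in
theorem ofWord_word {h t b : ℕ} {M : ℤ → ℤ} (hM : IsWord b (2 * h + t) M) :
    (ofWord h t b M hM).word = M := by
  funext x
  by_cases hx : 1 - (b : ℤ) ≤ x ∧ x ≤ 2 * h + t
  · have hon := ptAt_on hx.1 hx.2
    change (if 1 - (b : ℤ) ≤ x ∧ x ≤ 2 * (h : ℤ) + t then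
      place h t (if (ptAt h t x).On h t b then ptAt h t (M (place h t (ptAt h t x))) else ptAt h t x)
      else x) = M x
    rw [if_pos hx, if_pos hon, place_ptAt, place_ptAt]
  · rw [Conn.word_off _ hx, hM.off x (by omega)]

theorem Conn.eq_of_word {C C' : Conn} (h1 : C.ht = C'.ht) (h2 : C.nt = C'.nt) (h3 : C.nb = C'.nb)
    (h : C.word = C'.word) : C = C' := by
  refine Conn.ext h1 h2 h3 (funext fun p => ?_)
  by_cases hp : C.Bd p
  · have hp' : C'.Bd p := by unfold Conn.Bd at hp ⊢; rwa [← h1, ← h2, ← h3]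
    have hq := C'.mate_on p hp'
    have hq' : C.Bd (C'.mate p) := by unfold Conn.Bd; rwa [h1, h2, h3]
    rw [C.mate_eq_iff hp hq', h, h1, h2, C'.word_place hp']
  · have hp' : ¬ C'.Bd p := by unfold Conn.Bd at hp ⊢; rwa [← h1, ← h2, ← h3]
    rw [C.mate_off p hp, C'.mate_off p hp']

theorem endSeg_eq {m n : ℕ} {p : Pt} (hp : p.On m n n) :
    endSeg m n p = placeSeg m n (place m n p) := by
  rcases p with i | i | i | i <;> simp only [Pt.On] at hp <;>
    rw [place, placeSeg, endSeg]
  · rw [if_neg (by omega), if_pos (by omega), show ((m : ℤ) + 1 - (m + 1 - i)).toNat = i by omega]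
  · rw [if_neg (by omega), if_neg (by omega), if_neg (by omega),
      show ((m : ℤ) + n + i - m - n).toNat = i by omega]
  · rw [if_neg (by omega), if_neg (by omega), if_pos (by omega),
      show ((m : ℤ) + i - m).toNat = i by omega]
  · rw [if_pos (by omega), show ((1 : ℤ) - (1 - i)).toNat = i by omega]

theorem closedCount_eq (m n : ℕ) (s : Finset (ℕ × ℕ)) :
    closedCount m n s = closedComps (Smooth m n s) (segSet m n) (places m n) (placeSeg m n) := by
  set r := Smooth m n s
  have e1 : ∀ x y : Seg, (Quotient.mk (Relation.EqvGen.setoid r) x = Quotient.mk _ y) ↔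
      Quot.mk r x = Quot.mk r y := fun x y => by
    rw [Quotient.eq, Quot.eq]; rfl
  refine ncard_congr_of_maps (Quotient.lift (Quot.mk r) fun x y h => Quot.eq.2 h)
    (Quot.lift (Quotient.mk (Relation.EqvGen.setoid r)) fun x y h => (e1 x y).2 (Quot.sound h)) ?_ ?_ ?_ ?_
  · rintro _ ⟨⟨x, hx, rfl⟩, h⟩
    refine ⟨⟨x, hx, rfl⟩, fun y hy h' => ?_⟩
    refine h (ptAt m n y) (ptAt_on hy.1 hy.2) ?_
    rw [endSeg_eq (ptAt_on hy.1 hy.2), place_ptAt]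
    exact (e1 _ _).2 h'
  · rintro _ ⟨⟨x, hx, rfl⟩, h⟩
    refine ⟨⟨x, hx, rfl⟩, fun p hp h' => ?_⟩
    refine h (place m n p) (place_mem hp) ?_
    rw [← endSeg_eq hp]
    exact (e1 _ _).1 h'
  · rintro _ ⟨⟨x, hx, rfl⟩, h⟩; rfl
  · rintro _ ⟨⟨x, hx, rfl⟩, h⟩; rfl

theorem realizes_iff {C : Conn} (hC : C.nt = C.nb) (s : Finset (ℕ × ℕ)) :
    Realizes s C ↔
      Induces (Smooth C.ht C.nt s) (places C.ht C.nt) (placeSeg C.ht C.nt) C.word := by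
  have key : ∀ p q, C.Bd p → C.Bd q → ((C.mate p = q ↔ p ≠ q ∧
      Relation.EqvGen (Smooth C.ht C.nt s) (endSeg C.ht C.nt p) (endSeg C.ht C.nt q)) ↔
      (C.word (place C.ht C.nt p) = place C.ht C.nt q ↔ place C.ht C.nt p ≠ place C.ht C.nt q ∧
        Quot.mk (Smooth C.ht C.nt s) (placeSeg C.ht C.nt (place C.ht C.nt p)) =
          Quot.mk _ (placeSeg C.ht C.nt (place C.ht C.nt q)))) := by
    intro p q hp hq
    have hp' : p.On C.ht C.nt C.nt := by unfold Conn.Bd at hp; rwa [← hC] at hp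
    have hq' : q.On C.ht C.nt C.nt := by unfold Conn.Bd at hq; rwa [← hC] at hq
    rw [C.mate_eq_iff hp hq, Quot.eq, ← endSeg_eq hp', ← endSeg_eq hq']
    have : p ≠ q ↔ place C.ht C.nt p ≠ place C.ht C.nt q :=
      ⟨fun h h' => h (place_inj hp hq h'), fun h h' => h (by rw [h'])⟩
    rw [this]
  constructor
  · intro h x hx y hy
    simp only [places, Set.mem_Icc] at hx hy
    rw [hC] at hx hy
    obtain ⟨p, hp, rfl⟩ := C.exists_place hx.1 (by omega)
    obtain ⟨q, hq, rfl⟩ := C.exists_place hy.1 (by omega)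
    exact (key p q hp hq).1 (h p q hp hq)
  · intro h p q hp hq
    have hp' := place_mem hp
    have hq' := place_mem hq
    refine (key p q hp hq).2 (h _ ?_ _ ?_) <;> simp only [places, Set.mem_Icc] <;> omega

/-- The coefficient of a crossingless connection is the coefficient of its word. -/
theorem coeff_eq {C : Conn} (hC : C.nt = C.nb) : coeff C = wordCoeff C.ht C.nt C.word := by
  classical
  rw [coeff, wordCoeff, stateSum, Finset.sum_filter]
  refine Finset.sum_congr rfl fun s hs => ?_
  have hle := Finset.card_le_card (Finset.mem_powerset.1 hs)
  have hw : (s.card : ℤ) - ((crossings C.ht C.nt \ s).card : ℤ) =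
      2 * (s.card : ℤ) - (crossings C.ht C.nt).card := by
    rw [Finset.card_sdiff_of_subset (Finset.mem_powerset.1 hs)]; omega
  rw [value, ← closedCount_eq, hw, loopVal]
  by_cases h : Realizes s C
  · rw [if_pos h, if_pos ((realizes_iff hC s).1 h)]
  · rw [if_neg h, if_neg fun h' => h ((realizes_iff hC s).2 h'), mul_zero]

/-! ### Vertical products in terms of words -/

theorem IsVProd.unique {C D E E' : Conn} (h : IsVProd C D E) (h' : IsVProd C D E') : E = E' := by
  obtain ⟨-, h1, h2, h3, h4, -⟩ := h
  obtain ⟨-, h1', h2', h3', h4', -⟩ := h'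
  have e1 := h1.trans h1'.symm
  have e2 := h2.trans h2'.symm
  have e3 := h3.trans h3'.symm
  have hBd : ∀ p, E.Bd p ↔ E'.Bd p := fun p => by unfold Conn.Bd; rw [e1, e2, e3]
  refine Conn.ext e1 e2 e3 (funext fun p => ?_)
  by_cases hp : E.Bd p
  · exact ((h4' p _ ((hBd p).1 hp) ((hBd _).1 (E.mate_on p hp))).2
      ((h4 p _ hp (E.mate_on p hp)).1 rfl)).symm
  · rw [E.mate_off p hp, E'.mate_off p fun h => hp ((hBd p).2 h)]

theorem IsVProd.vprod_eq {C D E : Conn} (h : IsVProd C D E) : vprod (some C) (some D) = some E := by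
  have hx : ∃ E, IsVProd C D E := ⟨E, h⟩
  rw [vprod, dif_pos hx, hx.choose_spec.unique h]

theorem isVProd_of_vprod_eq {C D E : Conn} (h : vprod (some C) (some D) = some E) :
    IsVProd C D E := by
  rw [vprod] at h
  split_ifs at h with hx
  rw [← Option.some_injective _ h]
  exact hx.choose_spec

/-- The place, in the product of `C` and `D`, of the boundary point of `D` with place `z`, which is not
one of the top points. -/
def lowPlace (C D : Conn) (z : ℤ) : ℤ :=
  if z ≤ D.ht then z else z + (2 * C.ht + C.nt - D.nt)

/-- The place, in the product of `C` and `D`, of the end that is reached from the boundary point of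
`C` with place `x` by crossing to `D`, if it is a bottom point, and following the arc of `D`. -/
def exitPlace (C D : Conn) (x : ℤ) : ℤ :=
  if 1 ≤ x then x + D.ht else lowPlace C D (D.word (D.ht + 1 - x))

theorem IsWord.mem {n U : ℤ} {M : ℤ → ℤ} (h : IsWord n U M) {x : ℤ} (h1 : 1 - n ≤ x) (h2 : x ≤ U) :
    1 - n ≤ M x ∧ M x ≤ U := by
  by_contra h'
  have := h.off (M x) (by omega)
  rw [h.invol] at this
  omega

theorem exitPlace_mem {C D : Conn} (h : C.nb = D.nt)
    (hD : ∀ z, (D.ht : ℤ) < z → z ≤ D.ht + D.nt → D.word z ≤ D.ht ∨ D.ht + D.nt < D.word z)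
    {x : ℤ} (h1 : 1 - (C.nb : ℤ) ≤ x) (h2 : x ≤ 2 * C.ht + C.nt) :
    1 - (D.nb : ℤ) ≤ exitPlace C D x ∧ exitPlace C D x ≤ 2 * (C.ht + D.ht) + C.nt := by
  unfold exitPlace
  split_ifs with hx
  · omega
  · have h3 := hD (D.ht + 1 - x) (by omega) (by omega)
    have h4 := D.isWord.mem (x := D.ht + 1 - x) (by omega) (by omega)
    unfold lowPlace
    split_ifs <;> omega

/-- A criterion for products in which no arc of the lower factor joins two top points. -/
theorem isVProd_of_word {C D E : Conn} (hn : C.nb = D.nt) (e1 : E.ht = C.ht + D.ht)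
    (e2 : E.nt = C.nt) (e3 : E.nb = D.nb)
    (hF : ∀ z, (D.ht : ℤ) < z → z ≤ D.ht + D.nt → D.word z ≤ D.ht ∨ D.ht + D.nt < D.word z)
    (hC : ∀ x, 1 - (C.nb : ℤ) ≤ x → x ≤ 2 * C.ht + C.nt →
      E.word (exitPlace C D x) = exitPlace C D (C.word x))
    (hD : ∀ z, 1 - (D.nb : ℤ) ≤ z → z ≤ 2 * D.ht + D.nt → (z ≤ D.ht ∨ D.ht + D.nt < z) →
      (D.word z ≤ D.ht ∨ D.ht + D.nt < D.word z) →
      E.word (lowPlace C D z) = lowPlace C D (D.word z)) : IsVProd C D E := by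
  classical
  have hWC := C.isWord
  have hWD := D.isWord
  have hWE := E.isWord
  -- the ends of the diagram that belong to the places of the two factors and of the product
  let up : ℤ → Pt ⊕ Pt := fun x => .inl (ptAt C.ht C.nt x)
  let dn : ℤ → Pt ⊕ Pt := fun z => .inr (ptAt D.ht D.nt z)
  let out : ℤ → Pt ⊕ Pt := fun y => outer C (ptAt E.ht E.nt y)
  have out_up : ∀ x : ℤ, 1 ≤ x → x ≤ 2 * C.ht + C.nt → out (x + D.ht) = up x := by
    intro x h1 h2
    simp only [out, up, e1, e2]
    by_cases a1 : x ≤ C.ht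
    · rw [ptAt_left (by omega) (by omega), ptAt_left (by omega) a1, outer, if_pos (by omega)]
      congr 2; omega
    by_cases a2 : x ≤ C.ht + C.nt
    · rw [ptAt_top (by omega) (by omega), ptAt_top (by omega) a2, outer]
      congr 2; omega
    · rw [ptAt_right (by omega), ptAt_right (by omega), outer, if_pos (by omega)]
      congr 2; omega
  have out_low : ∀ z : ℤ, (z ≤ D.ht ∨ D.ht + D.nt < z) → out (lowPlace C D z) = dn z := by
    intro z h1
    simp only [out, dn, lowPlace, e1, e2]
    by_cases a1 : z ≤ 0
    · rw [if_pos (by omega), ptAt_bot a1, ptAt_bot a1, outer]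
    by_cases a2 : z ≤ D.ht
    · rw [if_pos a2, ptAt_left (by omega) (by omega), ptAt_left (by omega) a2, outer,
        if_neg (by omega)]
      congr 2; omega
    · rw [if_neg a2, ptAt_right (by omega), ptAt_right (by omega), outer, if_neg (by omega)]
      congr 2; omega
  have exit_one : ∀ x, 1 ≤ x → exitPlace C D x = x + D.ht := fun x h => if_pos h
  have exit_low : ∀ z, (D.ht : ℤ) < z → exitPlace C D (D.ht + 1 - z) = lowPlace C D (D.word z) := by
    intro z h
    rw [exitPlace, if_neg (by omega), show (D.ht : ℤ) + 1 - (D.ht + 1 - z) = z by ring]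
  have cover : ∀ y, 1 - (E.nb : ℤ) ≤ y → y ≤ 2 * E.ht + E.nt →
      (∃ x : ℤ, 1 ≤ x ∧ x ≤ 2 * C.ht + C.nt ∧ y = x + D.ht) ∨
      (∃ z, 1 - (D.nb : ℤ) ≤ z ∧ z ≤ 2 * D.ht + D.nt ∧ (z ≤ D.ht ∨ D.ht + D.nt < z) ∧
        y = lowPlace C D z) := by
    intro y h1 h2
    by_cases a1 : y ≤ D.ht
    · exact Or.inr ⟨y, by omega, by omega, Or.inl a1, (if_pos a1).symm⟩
    by_cases a2 : y ≤ D.ht + 2 * C.ht + C.nt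
    · exact Or.inl ⟨y - D.ht, by omega, by omega, by ring⟩
    · refine Or.inr ⟨y - (2 * C.ht + C.nt - D.nt), by omega, by omega, by omega, ?_⟩
      rw [lowPlace, if_neg (by omega)]; ring
  -- paths
  let P := Relation.EqvGen (Glue C D)
  have path_up : ∀ x, 1 - (C.nb : ℤ) ≤ x → x ≤ 2 * C.ht + C.nt → P (up x) (up (C.word x)) := by
    intro x h1 h2
    have : C.mate (ptAt C.ht C.nt x) = ptAt C.ht C.nt (C.word x) := by
      rw [Conn.word, if_pos ⟨h1, h2⟩, ptAt_place (C.mate_on _ (ptAt_on h1 h2))]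
    simp only [up, ← this]
    exact .rel _ _ (.upper _)
  have path_dn : ∀ z, 1 - (D.nb : ℤ) ≤ z → z ≤ 2 * D.ht + D.nt → P (dn z) (dn (D.word z)) := by
    intro x h1 h2
    have : D.mate (ptAt D.ht D.nt x) = ptAt D.ht D.nt (D.word x) := by
      rw [Conn.word, if_pos ⟨h1, h2⟩, ptAt_place (D.mate_on _ (ptAt_on h1 h2))]
    simp only [dn, ← this]
    exact .rel _ _ (.lower _)
  have path_seam : ∀ x, 1 - (C.nb : ℤ) ≤ x → x ≤ 0 → P (up x) (dn (D.ht + 1 - x)) := by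
    intro x h1 h2
    have a1 : up x = .inl (.bot (1 - x).toNat) := by simp only [up]; rw [ptAt_bot h2]
    have a2 : dn (D.ht + 1 - x) = .inr (.top (1 - x).toNat) := by
      simp only [dn]; rw [ptAt_top (by omega) (by omega)]
      congr 3; omega
    rw [a1, a2]
    exact .rel _ _ (.seam _ (by omega) (by omega))
  have path_exit : ∀ x, 1 - (C.nb : ℤ) ≤ x → x ≤ 2 * C.ht + C.nt → P (up x) (out (exitPlace C D x)) := by
    intro x h1 h2
    by_cases hx : 1 ≤ x
    · rw [exit_one x hx, out_up x hx h2]; exact .refl _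
    · rw [exitPlace, if_neg hx, out_low _ (hF _ (by omega) (by omega))]
      exact .trans _ _ _ (path_seam x h1 (by omega)) (path_dn _ (by omega) (by omega))
  have path : ∀ y, 1 - (E.nb : ℤ) ≤ y → y ≤ 2 * E.ht + E.nt → P (out y) (out (E.word y)) := by
    intro y h1 h2
    rcases cover y h1 h2 with ⟨x, hx1, hx2, rfl⟩ | ⟨z, hz1, hz2, hz, rfl⟩
    · have := hWC.mem (x := x) (by omega) hx2
      rw [out_up x hx1 hx2, ← exit_one x hx1, hC x (by omega) hx2]
      exact .trans _ _ _ (path_up x (by omega) hx2) (path_exit _ this.1 this.2)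
    · have hm := hWD.mem hz1 hz2
      rw [out_low z hz]
      by_cases ht : D.word z ≤ D.ht ∨ D.ht + D.nt < D.word z
      · rw [hD z hz1 hz2 hz ht, out_low _ ht]
        exact path_dn z hz1 hz2
      · have hl := exit_low (D.word z) (by omega)
        rw [hWD.invol] at hl
        have hm' := hWC.mem (x := D.ht + 1 - D.word z) (by omega) (by omega)
        rw [← hl, hC _ (by omega) (by omega)]
        refine .trans _ _ _ (path_dn z hz1 hz2) (.trans _ _ _ (.symm _ _ ?_)
          (.trans _ _ _ (path_up (D.ht + 1 - D.word z) (by omega) (by omega))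
            (path_exit _ hm'.1 hm'.2)))
        have := path_seam (D.ht + 1 - D.word z) (by omega) (by omega)
        rwa [show (D.ht : ℤ) + 1 - (D.ht + 1 - D.word z) = D.word z by ring] at this
  -- the arc of the product through a given point of the diagram, as the pair of its ends
  let arc : ℤ → Sym2 ℤ := fun y => s(y, E.word y)
  let κ : Pt ⊕ Pt → Sym2 ℤ := Sum.elim
    (fun p => arc (exitPlace C D (place C.ht C.nt p)))
    (fun q => if (D.ht : ℤ) < place D.ht D.nt q ∧ place D.ht D.nt q ≤ D.ht + D.nt
      then arc (exitPlace C D (D.ht + 1 - place D.ht D.nt q))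
      else arc (lowPlace C D (place D.ht D.nt q)))
  have arc_symm : ∀ y y', E.word y = y' → arc y = arc y' := by
    rintro y _ rfl
    simp only [arc, hWE.invol]
    exact Sym2.eq_swap
  have κ_glue : ∀ a b, Glue C D a b → κ a = κ b := by
    rintro _ _ (p | p | ⟨j, h1, h2⟩)
    · by_cases hp : C.Bd p
      · have hm := place_mem hp
        simp only [κ, Sum.elim_inl, ← C.word_place hp]
        exact arc_symm _ _ (hC _ hm.1 hm.2)
      · rw [C.mate_off p hp]
    · by_cases hp : D.Bd p
      · have hm := place_mem hp
        simp only [κ, Sum.elim_inr, ← D.word_place hp]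
        set z := place D.ht D.nt p
        have hm' := hWD.mem hm.1 hm.2
        by_cases ht : (D.ht : ℤ) < z ∧ z ≤ D.ht + D.nt
        · rw [if_pos ht, if_neg (by have := hF z ht.1 ht.2; omega), exit_low z ht.1]
        · rw [if_neg ht]
          by_cases ht' : (D.ht : ℤ) < D.word z ∧ D.word z ≤ D.ht + D.nt
          · rw [if_pos ht', exit_low _ ht'.1, hWD.invol]
          · rw [if_neg ht']
            exact arc_symm _ _ (hD z hm.1 hm.2 (by omega) (by omega))
      · rw [D.mate_off p hp]
    · have p1 : place C.ht C.nt (.bot j) = 1 - j := rfl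
      have p2 : place D.ht D.nt (.top j) = D.ht + j := rfl
      simp only [κ, Sum.elim_inl, Sum.elim_inr]
      rw [p1, p2, if_pos (by omega)]
      congr 2; ring
  have κ_path : ∀ a b, P a b → κ a = κ b := by
    intro a b h
    induction h with
    | rel _ _ h => exact κ_glue _ _ h
    | refl => rfl
    | symm _ _ _ ih => exact ih.symm
    | trans _ _ _ _ _ ih1 ih2 => exact ih1.trans ih2
  have κ_out : ∀ y, 1 - (E.nb : ℤ) ≤ y → y ≤ 2 * E.ht + E.nt → κ (out y) = arc y := by
    intro y h1 h2
    rcases cover y h1 h2 with ⟨x, hx1, hx2, rfl⟩ | ⟨z, hz1, hz2, hz, rfl⟩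
    · rw [out_up x hx1 hx2, ← exit_one x hx1]
      simp only [κ, up, Sum.elim_inl, place_ptAt]
    · rw [out_low z hz]
      simp only [κ, dn, Sum.elim_inr, place_ptAt]
      rw [if_neg (by omega)]
  refine ⟨hn, e1, e2, e3, fun p q hp hq => ?_, fun j h1 h2 => ?_⟩
  · have mp := place_mem hp
    have mq := place_mem hq
    have op : out (place E.ht E.nt p) = outer C p := by simp only [out, ptAt_place hp]
    have oq : out (place E.ht E.nt q) = outer C q := by simp only [out, ptAt_place hq]
    rw [E.mate_eq_iff hp hq]
    constructor
    · intro h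
      refine ⟨fun hpq => hWE.ne _ mp.1 mp.2 (by rw [h, hpq]), ?_⟩
      have := path _ mp.1 mp.2
      rwa [h, op, oq] at this
    · rintro ⟨hne, h⟩
      have h' := κ_path _ _ h
      rw [← op, ← oq, κ_out _ mp.1 mp.2, κ_out _ mq.1 mq.2] at h'
      rcases Sym2.eq_iff.1 h' with h'' | h''
      · exact absurd (place_inj hp hq h''.1) hne
      · exact h''.2
  · have h3 : up (1 - j) = .inl (.bot j) := by
      simp only [up]; rw [ptAt_bot (by omega)]; congr 2; omega
    have h4 := exitPlace_mem hn hF (x := 1 - j) (by omega) (by omega)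
    refine ⟨ptAt E.ht E.nt (exitPlace C D (1 - j)), ptAt_on (by omega) ?_, ?_⟩
    · rw [e1, e2]; push_cast; omega
    · rw [← h3]
      exact path_exit _ (by omega) (by omega)

/-- The matching of the straight vertical diagram of height `0` with `n` lines. -/
def mirror (n : ℕ) (x : ℤ) : ℤ := if 1 - (n : ℤ) ≤ x ∧ x ≤ n then 1 - x else x

theorem isWord_mirror (n : ℕ) : IsWord n n (mirror n) := by
  refine ⟨fun x => ?_, fun x h => ?_, fun x h1 h2 => ?_, fun x y h1 h2 h3 => ?_⟩
  · unfold mirror; split_ifs <;> omega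
  · unfold mirror; split_ifs <;> omega
  · unfold mirror; split_ifs <;> omega
  · revert h2 h3; unfold mirror; split_ifs <;> omega

/-- The increasing map that skips the `2 * d` places behind `g`. -/
def gap (g : ℤ) (d : ℕ) (z : ℤ) : ℤ := if z ≤ g then z else z + 2 * d

theorem nest_gap {g : ℤ} (hg : 0 ≤ g) (k : ℕ) (M : ℤ → ℤ) (z : ℤ) :
    nest (g + 1) k M (gap g k z) = gap g k (M z) := by
  by_cases h : z ≤ g
  · rw [gap, if_pos h, nest_apply_lt (by omega) k M (by omega), gap]; split_ifs <;> omega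
  · rw [gap, if_neg h, nest_apply_ge (by omega) k M (by omega), gap, show z + 2 * (k : ℤ) - 2 * k = z by ring]
    split_ifs <;> omega

/-- The arcs of `M`, as arcs of `twoPeak g c p q M`. -/
theorem twoPeak_gap {g : ℤ} (hg : 0 ≤ g) (c p q : ℕ) (M : ℤ → ℤ) (z : ℤ) :
    twoPeak g c p q M (gap g (c + p + q) z) = gap g (c + p + q) (M z) := by
  have e : ∀ z, gap g (c + p + q) z = gap (g + c) p (gap (g + c) q (gap g c z)) := fun z => by
    unfold gap; push_cast; split_ifs <;> omega
  rw [e, e, twoPeak, nest_gap (by omega), nest_gap (by omega), nest_gap hg]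

theorem twoPeak_low {g : ℤ} (hg : 0 ≤ g) (c p q : ℕ) (M : ℤ → ℤ) {x : ℤ} (hx : x ≤ g) :
    twoPeak g c p q M x = gap g (c + p + q) (M x) := by
  rw [← twoPeak_gap hg]; congr 1; rw [gap, if_pos hx]

theorem twoPeak_high {g : ℤ} (hg : 0 ≤ g) (c p q : ℕ) (M : ℤ → ℤ) {x : ℤ}
    (hx : g + 2 * (c + p + q) < x) :
    twoPeak g c p q M x = gap g (c + p + q) (M (x - 2 * (c + p + q))) := by
  rw [← twoPeak_gap hg]; congr 1; rw [gap, if_neg (by omega)]; push_cast; ring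

/-- The arcs of `twoPeak g c p q M` that do not come from `M`. -/
theorem twoPeak_mid {g : ℤ} (hg : 0 ≤ g) (c p q : ℕ) (M : ℤ → ℤ) {x : ℤ} (h1 : g < x)
    (h2 : x ≤ g + 2 * (c + p + q)) :
    twoPeak g c p q M x =
      if x ≤ g + c ∨ g + c + 2 * p + 2 * q < x then 2 * g + 2 * (c + p + q) + 1 - x
      else if x ≤ g + c + 2 * p then 2 * (g + c) + 2 * p + 1 - x
      else 2 * (g + c) + 4 * p + 2 * q + 1 - x := by
  have h0 : ∀ y, g < y → y ≤ g + 2 * c → nest (g + 1) c M y = 2 * g + 2 * c + 1 - y :=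
    fun y h1 h2 => by rw [nest_apply_mid (by omega) c M (by omega) (by omega)]; ring
  have hu : 1 ≤ g + c + 1 := by omega
  rw [twoPeak]
  by_cases a1 : x ≤ g + c
  · rw [nest_apply_lt hu p _ (by omega), nest_apply_lt hu q _ (by omega), h0 x (by omega) (by omega)]
    split_ifs <;> omega
  by_cases a2 : x ≤ g + c + 2 * p
  · rw [nest_apply_mid hu p _ (by omega) (by omega)]
    split_ifs <;> omega
  rw [nest_apply_ge hu p _ (by omega)]
  by_cases a3 : x ≤ g + c + 2 * p + 2 * q
  · rw [nest_apply_mid hu q _ (by omega) (by omega)]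
    split_ifs <;> omega
  · rw [nest_apply_ge hu q _ (by omega), h0 _ (by omega) (by omega)]
    split_ifs <;> omega

/-- Words can be compared at the places of boundary points. -/
theorem Conn.word_eq {C : Conn} {M : ℤ → ℤ} (hM : IsWord C.nb (2 * C.ht + C.nt) M)
    (h : ∀ p, C.Bd p → M (place C.ht C.nt p) = place C.ht C.nt (C.mate p)) : C.word = M := by
  funext x
  by_cases hx : 1 - (C.nb : ℤ) ≤ x ∧ x ≤ 2 * C.ht + C.nt
  · obtain ⟨p, hp, rfl⟩ := C.exists_place hx.1 hx.2
    rw [C.word_place hp, h p hp]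
  · rw [C.word_off hx, hM.off x (by omega)]

theorem isWord_twoPeak_mirror (c p q e f : ℕ) : IsWord (e + f : ℕ) (e + f + 2 * (c + p + q))
    (twoPeak e c p q (mirror (e + f))) := by
  have := isWord_twoPeak (n := (e + f : ℕ)) (U := (e + f : ℕ)) (g := e) (by omega) (by omega)
    (by omega) c p q (isWord_mirror _)
  convert this using 1
  push_cast; ring

theorem cornerState_word (a b c e f : ℕ) (h : a + e = b + f) :
    (cornerState a b c e f h).word = twoPeak e c a b (mirror (e + f)) := by
  have he : (0 : ℤ) ≤ e := by omega
  have hw := isWord_twoPeak_mirror c a b e f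
  refine Conn.word_eq ?_ fun p hp => ?_
  · convert hw using 1
    · rfl
    · have eh : (cornerState a b c e f h).ht = a + c + e := rfl
      have et : (cornerState a b c e f h).nt = a + b := rfl
      rw [eh, et]; push_cast; omega
  have eh : (cornerState a b c e f h).ht = a + c + e := rfl
  have et : (cornerState a b c e f h).nt = a + b := rfl
  have em : (cornerState a b c e f h).mate = cornerMate a b c e f := rfl
  have hp : p.On (a + c + e) (a + b) (e + f) := hp
  rw [eh, et, em]
  rcases p with i | i | i | i <;> simp only [Pt.On] at hp <;> simp only [cornerMate] <;>
    split_ifs <;> simp only [place] <;> push_cast <;> try omega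
  · rw [twoPeak_mid he _ _ _ _ (by omega) (by omega)]; split_ifs <;> omega
  · rw [twoPeak_mid he _ _ _ _ (by omega) (by omega)]; split_ifs <;> omega
  · rw [twoPeak_low he _ _ _ _ (by omega)]; unfold gap mirror; split_ifs <;> omega
  · rw [twoPeak_mid he _ _ _ _ (by omega) (by omega)]; split_ifs <;> omega
  · rw [twoPeak_mid he _ _ _ _ (by omega) (by omega)]; split_ifs <;> omega
  · rw [twoPeak_high he _ _ _ _ (by omega)]; unfold gap mirror; split_ifs <;> omega
  · rw [twoPeak_mid he _ _ _ _ (by omega) (by omega)]; split_ifs <;> omega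
  · rw [twoPeak_mid he _ _ _ _ (by omega) (by omega)]; split_ifs <;> omega
  · rw [twoPeak_low he _ _ _ _ (by omega)]; unfold gap mirror; split_ifs <;> omega
  · rw [twoPeak_low he _ _ _ _ (by omega)]; unfold gap mirror; split_ifs <;> omega

theorem nestState_word (p q : ℕ) :
    (nestState p q).word =
      twoPeak (p - min p q : ℕ) (min p q) 0 0 (mirror (p - min p q + (q - min p q))) := by
  have he : (0 : ℤ) ≤ (p - min p q : ℕ) := by omega
  have hw := isWord_twoPeak_mirror (min p q) 0 0 (p - min p q) (q - min p q)
  refine Conn.word_eq ?_ fun x hp => ?_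
  · convert hw using 1
    · simp only [nestState]; omega
    · simp only [nestState]; push_cast; omega
  have eh : (nestState p q).ht = 0 := rfl
  have et : (nestState p q).nt = p + q := rfl
  have em : (nestState p q).mate = nestMate p q := rfl
  have hp : x.On 0 (p + q) (p + q - 2 * min p q) := hp
  rw [eh, et, em]
  rcases x with i | i | i | i <;> simp only [Pt.On] at hp <;> simp only [nestMate] <;>
    (try split_ifs) <;> simp only [place] <;> push_cast <;> try omega
  · rw [twoPeak_mid he _ _ _ _ (by omega) (by omega)]; split_ifs <;> omega
  · rw [twoPeak_low he _ _ _ _ (by omega)]; unfold gap mirror; split_ifs <;> omega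
  · rw [twoPeak_high he _ _ _ _ (by omega)]; unfold gap mirror; split_ifs <;> omega
  · rw [twoPeak_low he _ _ _ _ (by omega)]; unfold gap mirror; split_ifs <;> omega
  · rw [twoPeak_low he _ _ _ _ (by omega)]; unfold gap mirror; split_ifs <;> omega

theorem Conn.IsFloor.word {D : Conn} (h : D.IsFloor) {z : ℤ} (h1 : (D.ht : ℤ) < z)
    (h2 : z ≤ D.ht + D.nt) : D.word z ≤ D.ht ∨ D.ht + D.nt < D.word z := by
  by_contra hc
  have hp : D.Bd (.top (z - D.ht).toNat) := by unfold Conn.Bd Pt.On; omega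
  have hq : D.Bd (.top (D.word z - D.ht).toNat) := by unfold Conn.Bd Pt.On; omega
  refine h _ (D.word z - D.ht).toNat hp ?_
  rw [D.mate_eq_iff hp hq]
  simp only [place]
  rw [show (D.ht : ℤ) + (z - D.ht).toNat = z by omega]
  omega

theorem Conn.isFloor_of_word {D : Conn}
    (h : ∀ z, (D.ht : ℤ) < z → z ≤ D.ht + D.nt → D.word z ≤ D.ht ∨ D.ht + D.nt < D.word z) :
    D.IsFloor := by
  intro i j hi hij
  have hi' : 1 ≤ i ∧ i ≤ D.nt := hi
  have hj : 1 ≤ j ∧ j ≤ D.nt := by have := D.mate_on _ hi; rwa [hij] at this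
  have := (D.mate_eq_iff hi (q := .top j) hj).1 hij
  simp only [place] at this
  have := h (D.ht + i) (by omega) (by omega)
  omega

/-- The product of a middle or top state with the arcs of `twoPeak`, and a floor state. -/
theorem isVProd_twoPeak {C F E : Conn} {a b c e f : ℕ}
    (hC : C.word = twoPeak e c a b (mirror (e + f))) (hb : C.nb = e + f) (hF : F.nt = e + f)
    (hU : 2 * C.ht + C.nt = e + f + 2 * (c + a + b)) (hfl : F.IsFloor) (e1 : E.ht = C.ht + F.ht)
    (e2 : E.nt = C.nt) (e3 : E.nb = F.nb)
    (hE : E.word = twoPeak (F.ht + e) c a b F.word) : IsVProd C F E := by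
  have hg : (0 : ℤ) ≤ F.ht + e := by omega
  have he : (0 : ℤ) ≤ e := by omega
  have hFw := F.isWord
  have low : ∀ z : ℤ, (z ≤ F.ht ∨ F.ht + F.nt < z) → lowPlace C F z = gap (F.ht + e) (c + a + b) z := by
    intro z hz
    unfold lowPlace gap
    split_ifs <;> omega
  refine isVProd_of_word (by omega) e1 e2 e3 (fun z => hfl.word) ?_ ?_
  · intro x h1 h2
    rw [hC, hE]
    -- the end of the arc of `C` at `x`, if it is an arc of the straight part
    have straight : ∀ z, (F.ht : ℤ) < z → z ≤ F.ht + F.nt →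
        exitPlace C F (F.ht + 1 - z) = gap (F.ht + e) (c + a + b) (F.word z) := by
      intro z a1 a2
      rw [exitPlace, if_neg (by omega), show (F.ht : ℤ) + 1 - (F.ht + 1 - z) = z by ring,
        low _ (hfl.word a1 a2)]
    have straight' : ∀ z, (F.ht : ℤ) < z → z ≤ F.ht + F.nt →
        exitPlace C F (gap e (c + a + b) (z - F.ht)) = gap (F.ht + e) (c + a + b) z := by
      intro z a1 a2
      unfold exitPlace gap
      split_ifs <;> omega
    by_cases hx : x ≤ 0
    · have h3 := straight (F.ht + 1 - x) (by omega) (by omega)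
      rw [show (F.ht : ℤ) + 1 - (F.ht + 1 - x) = x by ring] at h3
      rw [h3, twoPeak_gap hg, hFw.invol, twoPeak_low he _ _ _ _ (by omega), ← straight' _ (by omega)
        (by omega), mirror, if_pos (by omega)]
      congr 2; ring
    have hx1 : exitPlace C F x = x + F.ht := if_pos (by omega)
    rw [hx1]
    by_cases h4 : x ≤ e
    · have h3 := straight (F.ht + x) (by omega) (by omega)
      rw [twoPeak_low hg _ _ _ _ (by omega), twoPeak_low he _ _ _ _ h4, mirror, if_pos (by omega),
        gap.eq_1 e, if_pos (by omega), show 1 - x = F.ht + 1 - (F.ht + x) by ring, h3]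
      congr 2; ring
    by_cases h5 : x ≤ e + 2 * (c + a + b)
    · have h6 := exitPlace.eq_1 C F
      rw [twoPeak_mid hg _ _ _ _ (by omega) (by omega), twoPeak_mid he _ _ _ _ (by omega) h5, h6]
      split_ifs <;> omega
    · have h3 := straight (F.ht + (x - 2 * (c + a + b))) (by omega) (by omega)
      rw [twoPeak_high hg _ _ _ _ (by omega), twoPeak_high he _ _ _ _ (by omega), mirror,
        if_pos (by omega), gap.eq_1 e, if_pos (by omega),
        show 1 - (x - 2 * ((c : ℤ) + a + b)) = F.ht + 1 - (F.ht + (x - 2 * (c + a + b))) by ring, h3]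
      congr 2; ring
  · intro z h1 h2 h3 h4
    rw [low z h3, low _ h4, hE, twoPeak_gap hg]

/-! ### Bottom states and removal of bottom returns -/

/-- The increasing map that skips the places of the returns of `insBot bs`. -/
def skBot : List ℕ → ℤ → ℤ
  | [], x => x
  | b :: bs, x => sk (-(b : ℤ)) (skBot bs x)

theorem insBot_skBot (bs : List ℕ) (M : ℤ → ℤ) (x : ℤ) :
    insBot bs M (skBot bs x) = skBot bs (M x) := by
  induction bs with
  | nil => rfl
  | cons b bs ih => rw [insBot, skBot, ins_sk, ih, skBot]

theorem skBot_lt_iff (bs : List ℕ) (x y : ℤ) : skBot bs x < skBot bs y ↔ x < y := by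
  induction bs with
  | nil => rfl
  | cons b bs ih => rw [skBot, skBot, sk_lt_iff, ih]

theorem skBot_of_pos {n : ℕ} {bs : List ℕ} (h : ValidBot n bs) {x : ℤ} (hx : 1 ≤ x) :
    skBot bs x = x := by
  induction bs generalizing n with
  | nil => rfl
  | cons b bs ih =>
    have := h.1
    rw [skBot, ih h.2.2]; unfold sk; split_ifs <;> omega

theorem skBot_nonpos (bs : List ℕ) {x : ℤ} (hx : x ≤ 0) : skBot bs x ≤ 0 := by
  induction bs with
  | nil => exact hx
  | cons b bs ih => rw [skBot]; unfold sk; split_ifs <;> omega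

/-- At the ends of the inserted returns the matching into which they are inserted does not matter. -/
theorem insBot_of_notMem {bs : List ℕ} {z : ℤ} (hz : ∀ x, z ≠ skBot bs x) (M M' : ℤ → ℤ) :
    insBot bs M z = insBot bs M' z := by
  induction bs generalizing z with
  | nil => exact absurd rfl (hz z)
  | cons b bs ih =>
    rw [insBot, insBot]
    rcases sk_cases (-(b : ℤ)) z with rfl | rfl | ⟨y, rfl⟩
    · rw [ins_self, ins_self]
    · rw [ins_succ, ins_succ]
    · rw [ins_sk, ins_sk, ih fun x hx => hz x (by rw [skBot, hx])]

/-- The product of a crossingless connection and a bottom state. -/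
theorem isVProd_insBot {C D E : Conn} {bs : List ℕ} (hv : ValidBot D.nb bs) (hh : D.ht = 0)
    (ht : D.nt = C.nb) (hD : D.word = insBot bs (mirror C.nb)) (e1 : E.ht = C.ht) (e2 : E.nt = C.nt)
    (e3 : E.nb = D.nb) (hE : E.word = insBot bs C.word) : IsVProd C D E := by
  have hDw := D.isWord
  have low : ∀ z ≤ 0, lowPlace C D z = z := fun z hz => if_pos (by omega)
  have hDx : ∀ x, 1 - (C.nb : ℤ) ≤ x → x ≤ 0 → D.word (1 - x) = skBot bs x := fun x h1 h2 => by
    rw [hD, ← skBot_of_pos hv (x := 1 - x) (by omega), insBot_skBot, mirror, if_pos (by omega)]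
    congr 1; ring
  have ex : ∀ x, 1 - (C.nb : ℤ) ≤ x → exitPlace C D x = skBot bs x := by
    intro x h1
    by_cases hx : 1 ≤ x
    · rw [exitPlace, if_pos hx, skBot_of_pos hv hx]; omega
    · rw [exitPlace, if_neg hx, hh, show ((0 : ℕ) : ℤ) + 1 - x = 1 - x by norm_num,
        hDx x h1 (by omega), low _ (skBot_nonpos bs (by omega))]
  refine isVProd_of_word ht.symm (by omega) e2 e3 (fun z h1 h2 => Or.inl ?_) (fun x h1 h2 => ?_)
    (fun z h1 h2 h3 h4 => ?_)
  · have := hDx (1 - z) (by omega) (by omega)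
    have h3 := skBot_nonpos bs (x := 1 - z) (by omega)
    rw [show 1 - (1 - z) = z by ring] at this
    omega
  · have := C.isWord.mem h1 h2
    rw [ex x h1, ex _ this.1, hE, insBot_skBot]
  · have hm := hDw.mem h1 h2
    rw [low z (by omega), low _ (by omega), hE, hD]
    refine insBot_of_notMem (fun y hy => ?_) _ _
    have hy0 : y ≤ 0 := by
      by_contra h
      rw [skBot_of_pos hv (by omega)] at hy
      omega
    have h5 : D.word z = skBot bs (mirror C.nb y) := by rw [hD, hy, insBot_skBot]
    have h6 := hDw.ne z h1 h2
    by_cases h7 : 1 - (C.nb : ℤ) ≤ y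
    · rw [mirror, if_pos (by omega), skBot_of_pos hv (by omega)] at h5
      omega
    · rw [mirror, if_neg (by omega), ← hy] at h5
      exact h6 h5

/-- Under an arc there is an arc that joins neighbours. -/
theorem IsWord.exists_adj {n U : ℤ} {M : ℤ → ℤ} (h : IsWord n U M) {x : ℤ} (hx : x < M x) :
    ∃ y, x ≤ y ∧ y + 1 ≤ M x ∧ M y = y + 1 := by
  obtain ⟨d, hd⟩ : ∃ d : ℕ, M x - x ≤ d := ⟨(M x - x).toNat, by omega⟩
  induction d generalizing x with
  | zero => push_cast at hd; omega
  | succ d ih =>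
    push_cast at hd
    by_cases h1 : M x = x + 1
    · exact ⟨x, le_rfl, by omega, h1⟩
    have h2 : 1 - n ≤ x ∧ M x ≤ U := by
      by_contra h'
      by_cases h3 : x < 1 - n
      · have := h.off x (Or.inl h3); omega
      · have := h.off (M x) (Or.inr (by omega)); rw [h.invol] at this; omega
    have h3 := h.ne (x + 1) (by omega) (by omega)
    have h4 := h.invol x
    have h5 := h.invol (x + 1)
    have h6 : x < M (x + 1) := by
      by_contra h'
      by_cases h7 : M (x + 1) = x
      · rw [h7] at h5; omega
      · exact h.nc (M (x + 1)) x (by omega) (by rw [h5]; omega) (by rw [h5]; omega)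
    have h7 : M (x + 1) < M x := by
      by_contra h'
      by_cases h8 : M (x + 1) = M x
      · rw [h8, h4] at h5; omega
      · exact h.nc x (x + 1) (by omega) (by omega) (by omega)
    obtain ⟨y, a1, a2, a3⟩ := ih (x := x + 1) (by omega) (by omega)
    exact ⟨y, by omega, by omega, a3⟩

/-- A word of height `0` without returns is the word of a straight diagram. -/
theorem IsWord.eq_mirror {n m : ℕ} {M : ℤ → ℤ} (h : IsWord n m M) (ht : ∀ x : ℤ, 1 ≤ x → x ≤ m → M x ≤ 0)
    (hb : ∀ x, 1 - (n : ℤ) ≤ x → x ≤ 0 → 1 ≤ M x) : n = m ∧ M = mirror m := by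
  have up : ∀ j : ℕ, j < n → (j : ℤ) + 1 ≤ M (-j) := by
    intro j hj
    induction j with
    | zero => have := hb 0 (by omega) le_rfl; simpa using this
    | succ j ih =>
      have h1 := ih (by omega)
      have h2 := hb (-(j + 1 : ℕ)) (by push_cast; omega) (by push_cast; omega)
      by_contra h3
      refine h.nc (-(j + 1 : ℕ)) (-j) (by push_cast; omega) (by push_cast at h2 ⊢; omega) ?_
      by_contra h4
      have h5 : M (-(j + 1 : ℕ)) = M (-j) := by push_cast at h3 h4 ⊢; omega
      have h6 := h.invol (-(j + 1 : ℕ))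
      rw [h5, h.invol] at h6
      push_cast at h6; omega
  have dn : ∀ j : ℕ, j < m → M (j + 1) ≤ -j := by
    intro j hj
    induction j with
    | zero => have := ht 1 le_rfl (by omega); simpa using this
    | succ j ih =>
      have h1 := ih (by omega)
      have h2 := ht (((j + 1 : ℕ) : ℤ) + 1) (by push_cast; omega) (by omega)
      by_contra h3
      have i1 := h.invol (j + 1)
      have i2 := h.invol (((j + 1 : ℕ) : ℤ) + 1)
      by_cases h5 : M (((j + 1 : ℕ) : ℤ) + 1) = M (j + 1)
      · rw [h5, i1] at i2
        push_cast at i2; omega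
      refine h.nc (M (j + 1)) (M (((j + 1 : ℕ) : ℤ) + 1)) ?_ ?_ ?_
      · push_cast at h3 h5 ⊢; omega
      · rw [i1]; omega
      · rw [i1, i2]; push_cast; omega
  have key : ∀ x, 1 - (n : ℤ) ≤ x → x ≤ 0 → M x = 1 - x := by
    intro x h1 h2
    have h3 := up (-x).toNat (by omega)
    rw [show -(((-x).toNat : ℕ) : ℤ) = x by omega] at h3
    have h4 := h.mem h1 (by omega)
    have h5 := dn (M x - 1).toNat (by omega)
    rw [show ((M x - 1).toNat : ℤ) + 1 = M x by omega, h.invol] at h5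
    omega
  have key' : ∀ x : ℤ, 1 ≤ x → x ≤ m → M x = 1 - x := by
    intro x h1 h2
    have h3 := h.mem (x := x) (by omega) h2
    have h4 := key (M x) h3.1 (ht x h1 h2)
    rw [h.invol] at h4
    omega
  have hnm : n = m := by
    rcases Nat.lt_trichotomy n m with h1 | h1 | h1
    · have h2 := key' m (by omega) le_rfl
      have h3 := h.mem (x := m) (by omega) le_rfl
      omega
    · exact h1
    · have h2 := key (1 - n) (by omega) (by omega)
      have h3 := h.mem (x := 1 - n) (by omega) (by omega)
      omega
  refine ⟨hnm, funext fun x => ?_⟩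
  unfold mirror
  split_ifs with h1
  · by_cases hx : 1 ≤ x
    · exact key' x hx h1.2
    · exact key x (by omega) (by omega)
  · exact h.off x (by omega)

/-- Every bottom state consists of bottom returns, inserted into a straight diagram. -/
theorem IsWord.exists_insBot {n m : ℕ} {M : ℤ → ℤ} (h : IsWord n m M)
    (ht : ∀ x : ℤ, 1 ≤ x → x ≤ m → M x ≤ 0) :
    ∃ bs, ValidBot n bs ∧ m = n - 2 * bs.length ∧ M = insBot bs (mirror m) := by
  induction n using Nat.strong_induction_on generalizing M with
  | _ n ih =>
  by_cases hb : ∀ x, 1 - (n : ℤ) ≤ x → x ≤ 0 → 1 ≤ M x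
  · obtain ⟨h1, h2⟩ := h.eq_mirror ht hb
    exact ⟨[], trivial, by simpa using h1.symm, h2⟩
  push Not at hb
  obtain ⟨x, h1, h2, h3⟩ := hb
  obtain ⟨y, hy1, hy2, hy⟩ : ∃ y, 1 - (n : ℤ) ≤ y ∧ y + 1 ≤ 0 ∧ M y = y + 1 := by
    have h4 := h.mem h1 (by omega)
    have h5 := h.ne x h1 (by omega)
    by_cases hx : x < M x
    · obtain ⟨y, a1, a2, a3⟩ := h.exists_adj hx
      exact ⟨y, by omega, by omega, a3⟩
    · obtain ⟨y, a1, a2, a3⟩ := h.exists_adj (x := M x) (by rw [h.invol]; omega)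
      rw [h.invol] at a2
      exact ⟨y, by omega, by omega, a3⟩
  obtain ⟨b, rfl⟩ : ∃ b : ℕ, y = -b := ⟨(-y).toNat, by omega⟩
  obtain ⟨M', rfl⟩ := exists_eq_ins h.invol hy
  have e : (n : ℤ) = ((n - 2 : ℕ) : ℤ) + 2 := by omega
  rw [e, isWord_ins_down (by omega) (by omega) (by omega)] at h
  obtain ⟨bs, a1, a2, a3⟩ := ih (n - 2) (by omega) h fun x h1 h2 => by
    have h3 := ht x h1 h2
    have h4 : x = sk (-(b : ℤ)) x := by unfold sk; split_ifs <;> omega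
    rw [h4, ins_sk] at h3
    revert h3; unfold sk; split_ifs <;> omega
  refine ⟨b :: bs, ⟨by omega, by omega, a1⟩, ?_, ?_⟩
  · rw [List.length_cons]; omega
  · rw [insBot, ← a3]

/-- Words of height `0` without top returns are determined by the left ends of their bottom
returns. -/
theorem IsWord.ext_of_left {n m m' : ℕ} {M M' : ℤ → ℤ} (h : IsWord n m M) (h' : IsWord n m' M')
    (ht : ∀ x : ℤ, 1 ≤ x → x ≤ m → M x ≤ 0) (ht' : ∀ x : ℤ, 1 ≤ x → x ≤ m' → M' x ≤ 0)
    (hl : ∀ x ≤ 0, M x < x ↔ M' x < x) : m = m' ∧ M = M' := by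
  induction n using Nat.strong_induction_on generalizing M M' with
  | _ n ih =>
  have hex : ∀ {m : ℕ} {M : ℤ → ℤ}, IsWord n m M → (∀ x ≤ 0, ¬ M x < x) →
      ∀ x, 1 - (n : ℤ) ≤ x → x ≤ 0 → 1 ≤ M x := by
    intro m M h hM x h1 h2
    have h3 := hM x h2
    have h4 := h.ne x h1 (by omega)
    by_contra h5
    have h6 := hM (M x) (by omega)
    rw [h.invol] at h6
    omega
  by_cases hne : ∃ x ≤ 0, M x < x
  swap
  · push Not at hne
    obtain ⟨h1, h2⟩ := h.eq_mirror ht (hex h fun x hx => by have := hne x hx; omega)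
    obtain ⟨h3, h4⟩ := h'.eq_mirror ht' (hex h' fun x hx => by
      have := hne x hx; have := hl x hx; omega)
    have : m = m' := by omega
    exact ⟨this, by rw [h2, h4, this]⟩
  -- the least place `x ≤ 0` that is a left end
  have bdd : ∀ x : ℤ, (x ≤ 0 ∧ M x < x) → 1 - (n : ℤ) ≤ x := fun x hx => by
    by_contra hc
    have := h.off x (by omega)
    omega
  obtain ⟨x, ⟨hx0, hx⟩, hmin⟩ := Int.exists_least_of_bdd ⟨_, bdd⟩ hne
  have adj : ∀ {m : ℕ} {M : ℤ → ℤ}, IsWord n m M → M x < x →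
      (∀ z, z ≤ 0 ∧ M z < z → x ≤ z) → M (x - 1) = x - 1 + 1 ∧ 1 - (n : ℤ) ≤ x - 1 := by
    intro m M h hx hmin
    obtain ⟨y, a1, a2, a3⟩ := h.exists_adj (x := M x) (by rw [h.invol]; exact hx)
    rw [h.invol] at a2
    have a4 : M (y + 1) = y := by rw [← a3, h.invol]
    have a5 := hmin (y + 1) ⟨by omega, by omega⟩
    have a6 : y = x - 1 := by omega
    rw [a6] at a3
    refine ⟨a3, ?_⟩
    by_contra hc
    have := h.off (x - 1) (by omega)
    omega
  have A := adj h hx hmin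
  have A' := adj h' ((hl x hx0).1 hx) fun z hz => hmin z ⟨hz.1, (hl z hz.1).2 hz.2⟩
  obtain ⟨N, rfl⟩ := exists_eq_ins h.invol A.1
  obtain ⟨N', rfl⟩ := exists_eq_ins h'.invol A'.1
  have e : (n : ℤ) = ((n - 2 : ℕ) : ℤ) + 2 := by omega
  rw [e, isWord_ins_down (by omega) (by omega) (by omega)] at h h'
  have top : ∀ {m : ℕ} {N : ℤ → ℤ}, (∀ z : ℤ, 1 ≤ z → z ≤ m → ins (x - 1) N z ≤ 0) →
      ∀ z : ℤ, 1 ≤ z → z ≤ m → N z ≤ 0 := by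
    intro m N ht z h1 h2
    have h3 := ht z h1 h2
    have h4 : z = sk (x - 1) z := by unfold sk; split_ifs <;> omega
    rw [h4, ins_sk] at h3
    revert h3; unfold sk; split_ifs <;> omega
  obtain ⟨h1, h2⟩ := ih (n - 2) (by omega) h h' (top ht) (top ht') fun z hz => by
    have := hl (sk (x - 1) z) (by unfold sk; split_ifs <;> omega)
    rwa [ins_sk, ins_sk, sk_lt_iff, sk_lt_iff] at this
  exact ⟨h1, by rw [h2]⟩

open Classical in
/-- The left ends of bottom returns in terms of words: places run from right to left on the bottom side. -/
theorem mem_phi {F : Conn} {i : ℕ} :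
    i ∈ phi F ↔ 1 ≤ i ∧ F.word (1 - i) < 1 - i := by
  rw [phi, Finset.mem_filter, Finset.mem_Icc]
  constructor
  · rintro ⟨⟨h1, h2⟩, j, h3, h4⟩
    refine ⟨h1, ?_⟩
    have hi : F.Bd (.bot i) := ⟨h1, h2⟩
    have hj : F.Bd (.bot j) := by rw [← h4]; exact F.mate_on _ hi
    have := (F.mate_eq_iff hi hj).1 h4
    simp only [place] at this
    omega
  · rintro ⟨h1, h2⟩
    have h3 : i ≤ F.nb := by
      by_contra h3
      have := F.isWord.off (1 - i) (by omega)
      omega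
    have hi : F.Bd (.bot i) := ⟨h1, h3⟩
    have hm := F.isWord.mem (x := 1 - i) (by omega) (by omega)
    refine ⟨⟨h1, h3⟩, (1 - F.word (1 - i)).toNat, by omega, ?_⟩
    rw [F.mate_eq_iff hi (q := .bot (1 - F.word (1 - i)).toNat) ⟨by omega, by omega⟩]
    simp only [place]
    omega

theorem phi_card (F : Conn) : (phi F).card = {x : ℤ | x ≤ 0 ∧ F.word x < x}.ncard := by
  rw [← Set.ncard_coe_finset]
  refine Set.ncard_congr (fun i _ => 1 - (i : ℤ)) ?_ ?_ ?_
  · intro i hi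
    have := mem_phi.1 hi
    exact ⟨by omega, this.2⟩
  · intro i j _ _ h
    have h : 1 - (i : ℤ) = 1 - j := h
    omega
  · rintro x ⟨h1, h2⟩
    refine ⟨(1 - x).toNat, ?_, by omega⟩
    rw [Finset.mem_coe, mem_phi, show 1 - ((1 - x).toNat : ℤ) = x by omega]
    exact ⟨by omega, h2⟩

/-- A bottom state has as many left ends as returns; finiteness is needed in the induction. -/
theorem ncard_left_insBot {bs : List ℕ} {n : ℕ} (h : ValidBot n bs) (m : ℕ) :
    {x : ℤ | x ≤ 0 ∧ insBot bs (mirror m) x < x}.ncard = bs.length ∧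
      {x : ℤ | x ≤ 0 ∧ insBot bs (mirror m) x < x}.Finite := by
  induction bs generalizing n with
  | nil =>
    have : {x : ℤ | x ≤ 0 ∧ insBot [] (mirror m) x < x} = ∅ := by
      ext x
      simp only [Set.mem_ofPred_eq, Set.mem_empty_iff_false, iff_false, insBot, mirror]
      split_ifs <;> omega
    rw [this]
    simp
  | cons b bs ih =>
    have ih := ih h.2.2
    have hb := h.1
    have : {x : ℤ | x ≤ 0 ∧ insBot (b :: bs) (mirror m) x < x} =
        insert (-(b : ℤ) + 1) (sk (-(b : ℤ)) '' {x : ℤ | x ≤ 0 ∧ insBot bs (mirror m) x < x}) := by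
      ext x
      rw [Set.mem_insert_iff]
      constructor
      · rintro ⟨h1, h2⟩
        rw [insBot] at h2
        rcases sk_cases (-(b : ℤ)) x with rfl | rfl | ⟨y, rfl⟩
        · rw [ins_self] at h2; omega
        · exact Or.inl rfl
        · rw [ins_sk, sk_lt_iff] at h2
          refine Or.inr ⟨y, ⟨?_, h2⟩, rfl⟩
          revert h1; unfold sk; split_ifs <;> omega
      · rintro (rfl | ⟨y, ⟨h1, h2⟩, rfl⟩)
        · refine ⟨by omega, ?_⟩
          rw [insBot, ins_succ]; omega
        · refine ⟨by unfold sk; split_ifs <;> omega, ?_⟩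
          rwa [insBot, ins_sk, sk_lt_iff]
    rw [this, Set.ncard_insert_of_notMem _ (ih.2.image _),
      Set.ncard_image_of_injective _ fun _ _ => sk_inj.1, ih.1, List.length_cons]
    · exact ⟨rfl, (ih.2.image _).insert _⟩
    · rintro ⟨y, -, h⟩
      exact sk_ne' _ _ h

/-- The bottom state with `n` bottom points and the given bottom returns. -/
def botState (n : ℕ) (bs : List ℕ) (h : ValidBot n bs) : Conn :=
  ofWord 0 (n - 2 * bs.length) n (insBot bs (mirror (n - 2 * bs.length))) <| by
    have := (isWord_insBot (U := (n - 2 * bs.length : ℕ)) (by omega) h).2 (isWord_mirror _)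
    simpa using this

theorem botState_word {n : ℕ} {bs : List ℕ} (h : ValidBot n bs) :
    (botState n bs h).word = insBot bs (mirror (n - 2 * bs.length)) := ofWord_word _

theorem isBottomState_botState {n : ℕ} {bs : List ℕ} (h : ValidBot n bs) :
    (botState n bs h).IsBottomState := by
  refine ⟨Conn.isFloor_of_word fun z h1 h2 => Or.inl ?_, rfl⟩
  have e1 : (botState n bs h).ht = 0 := rfl
  have e2 : (botState n bs h).nt = n - 2 * bs.length := rfl
  rw [e1, e2] at h2
  rw [e1] at h1
  rw [botState_word, ← skBot_of_pos h (x := z) (by omega), insBot_skBot, e1]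
  refine skBot_nonpos bs ?_
  unfold mirror
  split_ifs <;> omega

theorem Conn.IsBottomState.word_nonpos {F : Conn} (h : F.IsBottomState) {x : ℤ} (h1 : 1 ≤ x)
    (h2 : x ≤ F.nt) : F.word x ≤ 0 := by
  have h3 := h.2
  have h4 := h.1.word (z := x) (by omega) (by omega)
  have h5 := F.isWord.mem (x := x) (by omega) (by omega)
  omega

theorem Conn.IsBottomState.isWord {F : Conn} (h : F.IsBottomState) : IsWord F.nb F.nt F.word := by
  have := Conn.isWord F
  rw [h.2] at this
  simpa using this

theorem Conn.IsBottomState.exists_botState {F : Conn} (h : F.IsBottomState) :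
    ∃ bs, ∃ hv : ValidBot F.nb bs, F = botState F.nb bs hv := by
  obtain ⟨bs, h1, h2, h3⟩ := h.isWord.exists_insBot fun x => h.word_nonpos
  refine ⟨bs, h1, Conn.eq_of_word h.2 h2 rfl ?_⟩
  rw [botState_word, h3, h2]

/-- `φ` is injective on bottom states with a given number of bottom points. -/
theorem phi_injective {F F' : Conn} (h : F.IsBottomState) (h' : F'.IsBottomState)
    (hn : F.nb = F'.nb) (hp : phi F = phi F') : F = F' := by
  have hw' := h'.isWord
  rw [← hn] at hw'
  obtain ⟨h1, h2⟩ := h.isWord.ext_of_left hw' (fun x => h.word_nonpos) (fun x => h'.word_nonpos)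
    fun x hx => by
      have := Finset.ext_iff.1 hp (1 - x).toNat
      rw [mem_phi, mem_phi, show 1 - ((1 - x).toNat : ℤ) = x by omega] at this
      constructor
      · intro h; exact (this.1 ⟨by omega, h⟩).2
      · intro h; exact (this.2 ⟨by omega, h⟩).2
  exact Conn.eq_of_word (h.2.trans h'.2.symm) h1 hn h2

theorem phiInv_phi {F : Conn} (h : F.IsBottomState) {n : ℕ} (hn : F.nb = n) :
    phiInv n (phi F) = some F := by
  have hx : ∃ G : Conn, G.IsBottomState ∧ G.nb = n ∧ phi G = phi F := ⟨F, h, hn, rfl⟩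
  rw [phiInv, dif_pos hx]
  obtain ⟨h1, h2, h3⟩ := hx.choose_spec
  rw [phi_injective h1 h (h2.trans hn.symm) h3]

open Classical in
theorem mem_LL {n : ℕ} {I : Finset ℕ} : I ∈ LL n ↔ ∃ F : Conn, F.IsBottomState ∧ F.nb = n ∧ phi F = I := by
  rw [LL, Finset.mem_filter, Finset.mem_powerset]
  refine ⟨And.right, fun h => ⟨?_, h⟩⟩
  obtain ⟨F, -, rfl, rfl⟩ := h
  rw [phi]
  exact Finset.filter_subset _ _

/-- The index set of a bottom state with given bottom returns. -/
def botSet (n : ℕ) (bs : List ℕ) (h : ValidBot n bs) : Finset ℕ := phi (botState n bs h)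

theorem phiInv_botSet {n : ℕ} {bs : List ℕ} (h : ValidBot n bs) :
    phiInv n (botSet n bs h) = some (botState n bs h) :=
  phiInv_phi (isBottomState_botState h) rfl

theorem botSet_card {n : ℕ} {bs : List ℕ} (h : ValidBot n bs) : (botSet n bs h).card = bs.length := by
  rw [botSet, phi_card, botState_word]
  exact (ncard_left_insBot h _).1

theorem botSet_mem_LL {n : ℕ} {bs : List ℕ} (h : ValidBot n bs) : botSet n bs h ∈ LL n :=
  mem_LL.2 ⟨_, isBottomState_botState h, rfl, rfl⟩

theorem exists_botSet {n : ℕ} {I : Finset ℕ} (h : I ∈ LL n) :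
    ∃ bs, ∃ hv : ValidBot n bs, I = botSet n bs hv := by
  obtain ⟨F, h1, rfl, rfl⟩ := mem_LL.1 h
  obtain ⟨bs, hv, h2⟩ := h1.exists_botState
  exact ⟨bs, hv, by rw [botSet, ← h2]⟩

theorem phiInv_eq_none {n : ℕ} {I : Finset ℕ} (h : I ∉ LL n) : phiInv n I = none := by
  rw [phiInv, dif_neg fun hx => h (mem_LL.2 hx)]

/-- Stacking a crossingless connection on a bottom state means to insert bottom returns. -/
theorem vprod_botState {G F : Conn} {n : ℕ} {bs : List ℕ} (h : ValidBot n bs) :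
    vprod (some G) (some (botState n bs h)) = some F ↔
      F.ht = G.ht ∧ F.nt = G.nt ∧ F.nb = n ∧ G.nb = n - 2 * bs.length ∧
        F.word = insBot bs G.word := by
  have hG := G.isWord
  constructor
  · intro hv
    have hp := isVProd_of_vprod_eq hv
    have hn : G.nb = n - 2 * bs.length := hp.1
    have hw : IsWord n (2 * G.ht + G.nt) (insBot bs G.word) := by
      rw [isWord_insBot (by omega) h, ← hn]; exact hG
    have := isVProd_insBot (C := G) (D := botState n bs h) (E := ofWord G.ht G.nt n _ hw) (bs := bs)
      h rfl hn.symm (by rw [botState_word, hn]) rfl rfl rfl (ofWord_word _)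
    rw [hp.unique this]
    exact ⟨rfl, rfl, rfl, hn, ofWord_word _⟩
  · rintro ⟨h1, h2, h3, h4, h5⟩
    exact (isVProd_insBot (bs := bs) h rfl h4.symm (by rw [botState_word, h4]) h1 h2 h3 h5).vprod_eq

theorem remove_botSet {F G : Conn} {bs : List ℕ} (h : ValidBot F.nb bs) :
    remove (some F) (botSet F.nb bs h) = some G ↔
      F.ht = G.ht ∧ F.nt = G.nt ∧ G.nb = F.nb - 2 * bs.length ∧ F.word = insBot bs G.word := by
  have key : ∀ G, vprod (some G) (phiInv F.nb (botSet F.nb bs h)) = some F ↔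
      F.ht = G.ht ∧ F.nt = G.nt ∧ G.nb = F.nb - 2 * bs.length ∧ F.word = insBot bs G.word := by
    intro G
    rw [phiInv_botSet, vprod_botState]
    tauto
  rw [remove]
  constructor
  · intro h'
    split_ifs at h' with hx
    rw [← Option.some_injective _ h']
    exact (key _).1 hx.choose_spec
  · intro h'
    have hx : ∃ C', vprod (some C') (phiInv F.nb (botSet F.nb bs h)) = some F := ⟨G, (key G).2 h'⟩
    rw [dif_pos hx]
    obtain ⟨a1, a2, a3, a4⟩ := (key _).1 hx.choose_spec
    obtain ⟨b1, b2, b3, b4⟩ := h'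
    congr 1
    exact Conn.eq_of_word (a1.symm.trans b1) (a2.symm.trans b2) (a3.trans b3.symm)
      (insBot_injective (a4.symm.trans b4))

theorem remove_eq_none {F : Conn} {I : Finset ℕ} (h : I ∉ LL F.nb) : remove (some F) I = none := by
  rw [remove, dif_neg]
  rintro ⟨C', hC⟩
  rw [phiInv_eq_none h] at hC
  simp [vprod] at hC

theorem validBot_nil (n : ℕ) : ValidBot n [] := trivial

theorem empty_eq_botSet (n : ℕ) : (∅ : Finset ℕ) = botSet n [] (validBot_nil n) := by
  have := botSet_card (validBot_nil n)
  exact (Finset.card_eq_zero.1 this).symm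

theorem remove_empty (F : Conn) : remove (some F) ∅ = some F := by
  rw [empty_eq_botSet F.nb, remove_botSet]
  simp [insBot]

/-- Only the left ends of bottom returns can be removed. -/
theorem subset_of_remove_eq_some {F G : Conn} {I : Finset ℕ} (h : remove (some F) I = some G) :
    I ⊆ phi F := by
  have hI : I ∈ LL F.nb := by
    by_contra hI
    rw [remove_eq_none hI] at h
    cases h
  obtain ⟨bs, hv, rfl⟩ := exists_botSet hI
  obtain ⟨-, -, -, hw⟩ := (remove_botSet hv).1 h
  intro i hi
  rw [botSet, mem_phi, botState_word] at hi
  obtain ⟨h1, h2⟩ := hi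
  rw [mem_phi]
  refine ⟨h1, ?_⟩
  rw [hw, insBot_of_notMem (M' := mirror (F.nb - 2 * bs.length)) ?_]
  · exact h2
  · intro y hy
    rw [hy, insBot_skBot, skBot_lt_iff] at h2
    revert h2
    unfold mirror
    have : y ≤ 0 := by
      by_contra hc
      rw [skBot_of_pos hv (by omega)] at hy
      omega
    split_ifs <;> omega

/-! ### Row expansions of words with at most two peaks -/

theorem mem_rowArcs_one {n a : ℕ} (ha : a ≤ n) : a ∈ rowArcs n (Finset.Icc 1 a) := by
  simp only [rowArcs, Set.mem_ofPred_eq, Finset.mem_Icc]; omega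

theorem mem_rowArcs_two {n a b e : ℕ} (hab : a < b) (hbe : b < e) (hen : e ≤ n) :
    a ∈ rowArcs n (Finset.Icc 1 a ∪ Finset.Icc (b + 1) e) ∧
      e ∈ rowArcs n (Finset.Icc 1 a ∪ Finset.Icc (b + 1) e) := by
  simp only [rowArcs, Set.mem_ofPred_eq, Finset.mem_union, Finset.mem_Icc]; omega

/-- Where the upper arcs of a row have to lie if it is the first row of a state that realizes a word
`twoPeak (h + e) c p q G` whose part `G` has no neighbours joined between `h` and `h + t`. -/
theorem peak_of_rowTerm_ne_zero {h t e c p q ρ N : ℕ} (he : e ≤ t)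
    (hN : N + 2 * (ρ + 1) = t + 2 * (c + p + q)) {G : ℤ → ℤ}
    (hG : ∀ x : ℤ, h < x → x < h + t → G x ≠ x + 1) {s₁ : Finset ℕ} {j : ℕ} (hj : j ∈ rowArcs N s₁)
    (hne : rowTerm (h + ρ) N s₁ (twoPeak (h + e) c p q G) ≠ 0) :
    (1 ≤ p ∧ ρ + 1 + j = e + c + p) ∨ (1 ≤ q ∧ ρ + 1 + j = e + c + 2 * p + q) ∨
      (p = 0 ∧ q = 0 ∧ 1 ≤ c ∧ ρ + 1 + j = e + c) := by
  have hadj : twoPeak (h + e) c p q G ((h + ρ : ℕ) + 1 + j) = (h + ρ : ℕ) + 1 + j + 1 := by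
    by_contra h'
    exact hne (rowTerm_eq_zero hj h')
  have hjN := hj.1
  have := twoPeak_adj (h := h) (t := t) (by omega) (by omega) (by omega) hG (by omega) (by omega) hadj
  omega

/-- The term of the first row of a state with at most two peaks vanishes, or it is the coefficient of
the word without one of the peaks, or both peaks and a bottom return are removed. Which of
these happens depends neither on the height `h` nor on the remaining part `G` of the word. -/
theorem rowTerm_twoPeak {t e c p q ρ N : ℕ} (he : e ≤ t)
    (hN : N + 2 * (ρ + 1) = t + 2 * (c + p + q)) {s₁ : Finset ℕ} (hs : s₁ ⊆ Finset.Icc 1 N) :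
    (∀ (h : ℕ) (G : ℤ → ℤ), (∀ x : ℤ, h < x → x < h + t → G x ≠ x + 1) →
      rowTerm (h + ρ) N s₁ (twoPeak (h + e) c p q G) = 0) ∨
    (∃ c' p' q', c' + p' + q' + 1 = c + p + q ∧ p' + q' ≤ p + q - 1 ∧
      ∀ (h : ℕ) (G : ℤ → ℤ), rowTerm (h + ρ) N s₁ (twoPeak (h + e) c p q G) =
        wordCoeff (h + ρ) N (twoPeak (h + e) c' p' q' G)) ∨
    (∃ p' q' b, p = p' + 1 ∧ q = q' + 1 ∧ 1 ≤ b ∧ b + 1 ≤ N ∧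
      ∀ (h : ℕ) (G : ℤ → ℤ),
        (∀ G', G = ins (-(b : ℤ)) G' → rowTerm (h + ρ) N s₁ (twoPeak (h + e) c p q G) =
          wordCoeff (h + ρ) (N - 2) (twoPeak (h + e) c p' q' G')) ∧
        (G (-(b : ℤ)) ≠ -b + 1 → rowTerm (h + ρ) N s₁ (twoPeak (h + e) c p q G) = 0)) := by
  by_cases hz : ∀ (h : ℕ) (G : ℤ → ℤ), (∀ x : ℤ, h < x → x < h + t → G x ≠ x + 1) →
      rowTerm (h + ρ) N s₁ (twoPeak (h + e) c p q G) = 0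
  · exact Or.inl hz
  refine Or.inr ?_
  push Not at hz
  obtain ⟨h, G, hG, hne⟩ := hz
  have peak := fun j (hj : j ∈ rowArcs N s₁) => peak_of_rowTerm_ne_zero he hN hG hj hne
  rcases row_trichotomy hs with ⟨a, ha, rfl⟩ | ⟨a, b, d, hab, hbd, hd, rfl⟩ |
    ⟨a, b, d, hab, hbd, ha, hb, hd⟩
  · refine Or.inl ?_
    rcases peak a (mem_rowArcs_one ha) with ⟨h1, h2⟩ | ⟨h1, h2⟩ | ⟨rfl, rfl, h1, h2⟩
    · obtain ⟨p, rfl⟩ := Nat.exists_eq_add_of_le' h1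
      refine ⟨c, p, q, by omega, by omega, fun h G => ?_⟩
      rw [← rowTerm_one ha, twoPeak_succ_left]
      congr 2; push_cast; omega
    · obtain ⟨q, rfl⟩ := Nat.exists_eq_add_of_le' h1
      refine ⟨c, p, q, by omega, by omega, fun h G => ?_⟩
      rw [← rowTerm_one ha, twoPeak_succ_right (by omega)]
      congr 2; push_cast; omega
    · obtain ⟨c, rfl⟩ := Nat.exists_eq_add_of_le' h1
      refine ⟨c, 0, 0, by omega, by omega, fun h G => ?_⟩
      rw [← rowTerm_one ha, twoPeak_succ_base]
      congr 2; push_cast; omega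
  · refine Or.inr ?_
    have m := mem_rowArcs_two hab hbd hd
    have h1 := peak a m.1
    have h2 := peak d m.2
    obtain ⟨p, rfl⟩ : ∃ p', p = p' + 1 := ⟨p - 1, by omega⟩
    obtain ⟨q, rfl⟩ : ∃ q', q = q' + 1 := ⟨q - 1, by omega⟩
    have e1 : ∀ (h : ℕ) (G : ℤ → ℤ), twoPeak (h + e) c (p + 1) (q + 1) G =
        ins ((h + ρ : ℕ) + 1 + a) (ins ((h + ρ : ℕ) + d - 1) (twoPeak (h + e) c p q G)) := by
      intro h G
      rw [twoPeak_succ_left, twoPeak_succ_right (by omega)]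
      congr 1
      · push_cast; omega
      · congr 1; push_cast; omega
    refine ⟨p, q, b, rfl, rfl, by omega, by omega, fun h G => ⟨?_, fun hb => ?_⟩⟩
    · rintro G' rfl
      rw [e1, twoPeak_ins_down (by omega) (by omega), rowTerm_two hab hbd hd]
    · rw [e1, rowTerm_two_zero hab hbd hd]
      rw [twoPeak_low (by omega) _ _ _ _ (by omega), gap]
      split_ifs <;> omega
  · have h1 := peak a ha
    have h2 := peak b hb
    have h3 := peak d hd
    omega

/-- A single nest of arcs that is deeper than the lattice crossing is high cannot be realized. -/
theorem wordCoeff_nest_eq_zero {t e c ρ N : ℕ} (he : e ≤ t) (hN : N + 2 * ρ = t + 2 * c) (hc : ρ < c)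
    {G : ℤ → ℤ} (hG : ∀ x : ℤ, 0 < x → x < t → G x ≠ x + 1) :
    wordCoeff ρ N (twoPeak e c 0 0 G) = 0 := by
  induction ρ generalizing c with
  | zero =>
    by_contra hne
    have := wordCoeff_zero hne (x := e + c) (by omega) (by omega)
    rw [twoPeak_mid (by omega) _ _ _ _ (by omega) (by push_cast; omega)] at this
    split_ifs at this <;> omega
  | succ ρ ih =>
    rw [wordCoeff_succ]
    refine Finset.sum_eq_zero fun s₁ hs => ?_
    have hG' : ∀ x : ℤ, (0 : ℕ) < x → x < (0 : ℕ) + t → G x ≠ x + 1 := by simpa using hG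
    rcases rowTerm_twoPeak he (p := 0) (q := 0) hN (Finset.mem_powerset.1 hs) with
      h | ⟨c', p', q', h1, h2, h⟩ | ⟨p', q', b, h1, -⟩
    · have := h 0 G hG'
      simp only [Nat.cast_zero, zero_add] at this
      rw [this, mul_zero]
    · obtain ⟨rfl, rfl⟩ : p' = 0 ∧ q' = 0 := by omega
      have := h 0 G
      simp only [Nat.cast_zero, zero_add] at this
      rw [this, ih (by omega) (by omega), mul_zero]
    · omega

/-- The row expansion for a single peak: only the row with the positive markers `1, …, e` contributes. -/
theorem wordCoeff_nest_succ {e c N : ℕ} (he : e ≤ N) :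
    wordCoeff (c + 1) N (twoPeak e (c + 1) 0 0 (mirror N)) =
      LaurentPolynomial.T (2 * (e : ℤ) - N) * wordCoeff c N (twoPeak e c 0 0 (mirror N)) := by
  have hG : ∀ x : ℤ, (0 : ℕ) < x → x < (0 : ℕ) + N → mirror N x ≠ x + 1 := by
    intro x h1 h2; unfold mirror; split_ifs <;> omega
  rw [wordCoeff_succ, Finset.sum_eq_single (Finset.Icc 1 e)]
  · rw [twoPeak_succ_base, show (e : ℤ) + c + 1 = c + 1 + e by ring, rowTerm_one he, Nat.card_Icc]
    congr 2
  · intro s₁ hs hne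
    rw [Finset.mem_powerset] at hs
    by_contra h0
    have h0' : rowTerm (0 + c) N s₁ (twoPeak ((0 : ℕ) + e) (c + 1) 0 0 (mirror N)) ≠ 0 := by
      intro h; simp only [Nat.cast_zero, zero_add] at h
      rw [h, mul_zero] at h0
      exact h0 rfl
    have peak := fun j (hj : j ∈ rowArcs N s₁) =>
      peak_of_rowTerm_ne_zero he (by omega) hG hj h0'
    rcases row_trichotomy hs with ⟨a, ha, rfl⟩ | ⟨a, b, d, hab, hbd, hd, rfl⟩ |
      ⟨a, b, d, hab, hbd, ha, hb, hd⟩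
    · have := peak a (mem_rowArcs_one ha)
      exact hne (by congr 1; omega)
    · have m := mem_rowArcs_two hab hbd hd
      have h1 := peak a m.1
      have h2 := peak d m.2
      omega
    · have h1 := peak a ha
      have h2 := peak b hb
      omega
  · intro h
    exact absurd (Finset.mem_powerset.2 (Finset.Icc_subset_Icc_right he)) h

/-- A single nest on a straight diagram, as deep as the lattice crossing is high: every row is forced. -/
theorem wordCoeff_nest {e N : ℕ} (he : e ≤ N) (c : ℕ) :
    wordCoeff c N (twoPeak e c 0 0 (mirror N)) = LaurentPolynomial.T ((2 * (e : ℤ) - N) * c) := by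
  induction c with
  | zero =>
    rw [wordCoeff_zero_id fun x h1 h2 => ?_]
    · simp
    · simp only [twoPeak, nest, mirror]; rw [if_pos ⟨h1, h2⟩]
  | succ c ih =>
    rw [wordCoeff_nest_succ he, ih, ← LaurentPolynomial.T_add]
    congr 1; push_cast; ring

/-! ### Positivity at `A = 1` -/

/-- Evaluation of a Laurent polynomial at `A = 1`. -/
def evalOne : ℤ[T;T⁻¹] →+* ℤ := LaurentPolynomial.eval₂ (RingHom.id ℤ) 1

theorem evalOne_T (r : ℤ) : evalOne (LaurentPolynomial.T r) = 1 := by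
  simp [evalOne]

/-- Words with at most two peaks and without other top returns: these are the words whose
coefficients occur in the row expansion of the product of `R''` and a bottom state. -/
structure IsPeakWord (ρ N : ℕ) (M : ℤ → ℤ) (t e c p q : ℕ) (G : ℤ → ℤ) : Prop where
  he : e ≤ t
  hN : N + 2 * ρ = t + 2 * (c + p + q)
  isWord : IsWord N t G
  top : ∀ x : ℤ, 1 ≤ x → x ≤ t → G x ≤ 0
  eq : M = twoPeak e c p q G

/-- Coefficients of these words, and the terms of their row expansions, are nonnegative at `A = 1`. -/
theorem evalOne_wordCoeff_nonneg {ρ N t e c p q : ℕ} {M G : ℤ → ℤ} (h : IsPeakWord ρ N M t e c p q G) :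
    0 ≤ evalOne (wordCoeff ρ N M) ∧
      ∀ ρ' s₁, ρ = ρ' + 1 → s₁ ⊆ Finset.Icc 1 N → 0 ≤ evalOne (rowTerm ρ' N s₁ M) := by
  induction ρ generalizing N c p q M G with
  | zero =>
    refine ⟨?_, fun ρ' s₁ h => by omega⟩
    by_cases h0 : wordCoeff 0 N M = 0
    · rw [h0, map_zero]
    · have hw := isWord_twoPeak (g := e) (by omega) (by omega) (by have := h.he; omega) c p q h.isWord
      rw [← h.eq] at hw
      have h1 := fun x => wordCoeff_zero h0 (x := x)
      rw [wordCoeff_zero_id fun x h2 h3 => ?_, map_one]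
      · exact zero_le_one
      · by_cases hx : 1 ≤ x
        · exact h1 x hx h3
        · have h4 := h1 (1 - x) (by omega) (by omega)
          have h5 := hw.invol (1 - x)
          rw [h4, show 1 - (1 - x) = x by ring] at h5
          exact h5
  | succ ρ ih =>
    have hrow : ∀ s₁, s₁ ⊆ Finset.Icc 1 N → 0 ≤ evalOne (rowTerm ρ N s₁ M) := by
      intro s₁ hs
      have hG : ∀ x : ℤ, (0 : ℕ) < x → x < (0 : ℕ) + t → G x ≠ x + 1 := by
        intro x h1 h2
        have := h.top x (by omega) (by omega)
        omega
      have hN := h.hN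
      rcases rowTerm_twoPeak h.he h.hN hs with h' | ⟨c', p', q', h1, h2, h'⟩ |
        ⟨p', q', b, rfl, rfl, h1, h2, h'⟩
      · have := h' 0 G hG
        simp only [Nat.cast_zero, zero_add] at this
        rw [h.eq, this, map_zero]
      · have := h' 0 G
        simp only [Nat.cast_zero, zero_add] at this
        rw [h.eq, this]
        exact (ih ⟨h.he, by omega, h.isWord, h.top, rfl⟩).1
      · by_cases hb : G (-(b : ℤ)) = -b + 1
        · obtain ⟨G', rfl⟩ := exists_eq_ins h.isWord.invol hb
          have := (h' 0 _).1 G' rfl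
          simp only [Nat.cast_zero, zero_add] at this
          rw [h.eq, this]
          have hw := h.isWord
          rw [show (N : ℤ) = ((N - 2 : ℕ) : ℤ) + 2 by omega,
            isWord_ins_down (by omega) (by omega) (by omega)] at hw
          refine (ih ⟨h.he, by omega, hw, fun x h3 h4 => ?_, rfl⟩).1
          have h5 := h.top x h3 h4
          have h6 : x = sk (-(b : ℤ)) x := by unfold sk; split_ifs <;> omega
          rw [h6, ins_sk] at h5
          revert h5; unfold sk; split_ifs <;> omega
        · have := (h' 0 G).2 hb
          simp only [Nat.cast_zero, zero_add] at this
          rw [h.eq, this, map_zero]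
    refine ⟨?_, ?_⟩
    · rw [wordCoeff_succ, map_sum]
      refine Finset.sum_nonneg fun s₁ hs => ?_
      rw [map_mul, evalOne_T, one_mul]
      exact hrow s₁ (Finset.mem_powerset.1 hs)
    · intro ρ' s₁ h' hs
      obtain rfl : ρ = ρ' := by omega
      exact hrow s₁ hs

theorem IsPeakWord.evalOne_rowTerm_le {ρ N t e c p q : ℕ} {M G : ℤ → ℤ}
    (h : IsPeakWord (ρ + 1) N M t e c p q G) {s₁ : Finset ℕ} (hs : s₁ ⊆ Finset.Icc 1 N) :
    evalOne (rowTerm ρ N s₁ M) ≤ evalOne (wordCoeff (ρ + 1) N M) := by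
  rw [wordCoeff_succ, map_sum]
  have := Finset.single_le_sum (s := (Finset.Icc 1 N).powerset)
    (f := fun s₁ => evalOne (LaurentPolynomial.T (2 * (s₁.card : ℤ) - N) * rowTerm ρ N s₁ M))
    (fun s hs => ?_) (Finset.mem_powerset.2 hs)
  · simpa only [map_mul, evalOne_T, one_mul] using this
  · rw [map_mul, evalOne_T, one_mul]
    exact (evalOne_wordCoeff_nonneg h).2 ρ s rfl (Finset.mem_powerset.1 hs)

theorem mirror_top (N : ℕ) (x : ℤ) (h1 : 1 ≤ x) (h2 : x ≤ N) : mirror N x ≤ 0 := by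
  unfold mirror; split_ifs <;> omega

/-- When the left peak is used up, rows with the positive markers `1, …, e` remove the rest. -/
theorem evalOne_pos_right {e N : ℕ} (he : e ≤ N) (c q : ℕ) :
    0 < evalOne (wordCoeff (c + q) N (twoPeak e c 0 q (mirror N))) := by
  induction q with
  | zero => rw [add_zero, wordCoeff_nest he, evalOne_T]; exact zero_lt_one
  | succ q ih =>
    refine ih.trans_le ?_
    have h : IsPeakWord (c + q + 1) N (twoPeak e c 0 (q + 1) (mirror N)) N e c 0 (q + 1) (mirror N) :=
      ⟨he, by omega, isWord_mirror N, mirror_top N, rfl⟩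
    have h2 := h.evalOne_rowTerm_le (Finset.Icc_subset_Icc_right he)
    rw [← add_assoc]
    refine Eq.trans_le ?_ h2
    rw [← rowTerm_one he, twoPeak_succ_right (by omega)]
    congr 3; push_cast; ring

/-- When the bottom returns are used up, rows without positive markers remove the left peak. -/
theorem evalOne_pos_left (c p q : ℕ) :
    0 < evalOne (wordCoeff (c + p + q) (p + q) (twoPeak q c p q (mirror (p + q)))) := by
  -- the number of bottom points does not change in the induction on `p`
  obtain ⟨N, hN⟩ : ∃ N, N = p + q := ⟨_, rfl⟩
  rw [← hN]
  have hq : q ≤ N := by omega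
  clear hN
  induction p with
  | zero => exact evalOne_pos_right hq c q
  | succ p ih =>
    refine ih.trans_le ?_
    have h : IsPeakWord (c + p + q + 1) N (twoPeak q c (p + 1) q (mirror N)) N q c (p + 1) q (mirror N) :=
      ⟨hq, by omega, isWord_mirror N, mirror_top N, rfl⟩
    have h2 := h.evalOne_rowTerm_le (s₁ := Finset.Icc 1 0) (by simp)
    rw [show c + (p + 1) + q = c + p + q + 1 by ring]
    refine Eq.trans_le ?_ h2
    rw [← rowTerm_one (Nat.zero_le N), twoPeak_succ_left]
    congr 3; push_cast; ring

/-- The coefficient of the product of `R''` and a bottom state is positive at `A = 1`. In the top rows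
both peaks are removed together with the bottom returns, then the left peak and the right peak. -/
theorem evalOne_pos (c p q : ℕ) {n : ℕ} {bs : List ℕ} (h : ValidBot n bs)
    (hn : n = p + q + 2 * bs.length) :
    0 < evalOne (wordCoeff (c + p + q + bs.length) n
      (twoPeak q c (p + bs.length) (q + bs.length) (insBot bs (mirror (p + q))))) := by
  induction bs generalizing n with
  | nil =>
    simp only [List.length_nil, mul_zero, add_zero] at hn ⊢
    rw [hn]
    exact evalOne_pos_left c p q
  | cons b bs ih =>
    simp only [List.length_cons] at hn ⊢
    have hb := h.1
    have hb' := h.2.1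
    refine (ih h.2.2 (by omega)).trans_le ?_
    set l := bs.length
    have hw : IsPeakWord (c + p + q + l + 1) n
        (twoPeak q c (p + (l + 1)) (q + (l + 1)) (insBot (b :: bs) (mirror (p + q))))
        (p + q) q c (p + (l + 1)) (q + (l + 1)) (insBot (b :: bs) (mirror (p + q))) := by
      refine ⟨by omega, by omega, ?_, fun x h1 h2 => ?_, rfl⟩
      · rw [isWord_insBot (by omega) h]
        have := isWord_mirror (p + q)
        convert this using 2
        simp only [List.length_cons]; omega
      · rw [← skBot_of_pos h h1, insBot_skBot]
        exact skBot_nonpos _ (mirror_top _ x h1 h2)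
    have h2 := hw.evalOne_rowTerm_le (s₁ := Finset.Icc 1 0 ∪ Finset.Icc (b + 1) n) (by
      intro x hx
      simp only [Finset.mem_union, Finset.mem_Icc] at hx ⊢
      omega)
    refine Eq.trans_le ?_ h2
    rw [← rowTerm_two (a := 0) (b := b) (e := n) hb (by omega) le_rfl]
    congr 2
    rw [← add_assoc, ← add_assoc, twoPeak_succ_left, twoPeak_succ_right (by omega), insBot,
      twoPeak_ins_down (by omega) (by omega)]
    congr 1
    · push_cast; omega
    · congr 1; push_cast; omega

/-! ### The functions `Θ` of the states `R` and `R'` -/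

theorem bracket_vprod_eq_zero {C D : Conn} (h : C.nb ≠ D.nt ∨ C.nt ≠ D.nb) :
    bracket (vprod (some C) (some D)) = 0 := by
  rcases hE : vprod (some C) (some D) with _ | E
  · rfl
  · obtain ⟨h1, -, h2, h3, -⟩ := isVProd_of_vprod_eq hE
    rw [bracket, if_neg]
    rw [h2, h3]
    exact h.resolve_left (not_not.2 h1)

/-- The coefficient of the product of a middle or top state with the arcs of `twoPeak`, and a floor
state. -/
theorem bracket_vprod_twoPeak {C F : Conn} {a b c e f : ℕ}
    (hC : C.word = twoPeak e c a b (mirror (e + f))) (hb : C.nb = e + f) (hF : F.nt = e + f)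
    (hU : 2 * C.ht + C.nt = e + f + 2 * (c + a + b)) (hfl : F.IsFloor) (hn : C.nt = F.nb) :
    bracket (vprod (some C) (some F)) =
      wordCoeff (C.ht + F.ht) C.nt (twoPeak (F.ht + e) c a b F.word) := by
  have hw : IsWord F.nb (2 * (C.ht + F.ht : ℕ) + C.nt) (twoPeak (F.ht + e) c a b F.word) := by
    have := isWord_twoPeak (g := F.ht + e) (by omega) (by omega) (by omega) c a b F.isWord
    convert this using 1
    push_cast; omega
  have hv : IsVProd C F (ofWord (C.ht + F.ht) C.nt F.nb _ hw) :=
    isVProd_twoPeak hC hb hF hU hfl rfl rfl rfl (ofWord_word hw)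
  have hn' : (ofWord (C.ht + F.ht) C.nt F.nb _ hw).nt = (ofWord (C.ht + F.ht) C.nt F.nb _ hw).nb := hn
  rw [hv.vprod_eq, bracket, if_pos hn', coeff_eq hn', ofWord_word]
  rfl

theorem dims_of_remove {F G : Conn} {I : Finset ℕ} (h : remove (some F) I = some G) :
    G.nt = F.nt ∧ G.nb + 2 * I.card = F.nb := by
  have hI : I ∈ LL F.nb := by
    by_contra hI
    rw [remove_eq_none hI] at h
    cases h
  obtain ⟨bs, hv, rfl⟩ := exists_botSet hI
  obtain ⟨-, h1, h2, -⟩ := (remove_botSet hv).1 h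
  have := hv.length_le
  rw [botSet_card]
  omega

theorem Theta_eq_zero_of_remove {R F : Conn} {I : Finset ℕ} (h : remove (some F) I = none) :
    Theta R I (some F) = 0 := by
  rw [Theta, h]; rfl

/-- `Θ` vanishes on floor states with a wrong number of points. -/
theorem Theta_eq_zero {R F : Conn} {I : Finset ℕ} (h : F.nt ≠ R.nb ∨ F.nb ≠ R.nt + 2 * I.card) :
    Theta R I (some F) = 0 := by
  rcases hG : remove (some F) I with _ | G
  · exact Theta_eq_zero_of_remove hG
  · rw [Theta, hG]
    have := dims_of_remove hG
    exact bracket_vprod_eq_zero (by omega)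

/-- The product of `R` and a floor state. -/
theorem Theta_Rmid {n k : ℕ} (hk : k ≤ n) {F : Conn} (hF : F.IsFloor)
    (ht : F.nt = (k - (n - k)) + (n - k - k)) (hb : F.nb = n) :
    Theta (Rmid n k) ∅ (some F) = wordCoeff (F.ht + n) n
      (twoPeak (F.ht + (k - (n - k) : ℕ)) (min k (n - k)) (n - k) k F.word) := by
  have e1 : (Rmid n k).ht = n := by
    change n - k + min k (n - k) + (k - (n - k)) = n; omega
  have e2 : (Rmid n k).nt = n := by change n - k + k = n; omega
  rw [Theta, remove_empty, bracket_vprod_twoPeak (C := Rmid n k) (cornerState_word _ _ _ _ _ _) rfl ht ?_ hF]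
  · change wordCoeff ((Rmid n k).ht + F.ht) (Rmid n k).nt _ = _
    rw [e1, e2, Nat.add_comm n]
  · rw [e2, hb]
  · rw [e1, e2]; omega

/-- The product of `R''` and a bottom state. -/
theorem bracket_Rmid'' {n k : ℕ} (hk : k ≤ n) {bs : List ℕ} (hv : ValidBot n bs)
    (hl : bs.length ≤ min k (n - k)) :
    bracket (vprod (some (Rmid'' n k bs.length)) (phiInv n (botSet n bs hv))) =
      wordCoeff (min k (n - k) + (n - k - bs.length) + (k - bs.length) + bs.length) n
        (twoPeak (k - bs.length : ℕ) (min k (n - k)) (n - k - bs.length + bs.length)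
          (k - bs.length + bs.length)
          (insBot bs (mirror (n - k - bs.length + (k - bs.length))))) := by
  set l := bs.length with hl0
  have e1 : (Rmid'' n k l).ht = min k (n - k) + (n - k - l) + (k - l) + l := by
    change l + (n - k - l) + min k (n - k) + (k - l) = _; omega
  have e2 : (Rmid'' n k l).nt = n := by change l + (n - k - l) + (l + (k - l)) = n; omega
  have e3 : n - 2 * bs.length = n - k - l + (k - l) := by omega
  rw [phiInv_botSet, bracket_vprod_twoPeak (C := Rmid'' n k l) (cornerState_word _ _ _ _ _ _) rfl ?_ ?_
    (isBottomState_botState hv).1]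
  · change wordCoeff ((Rmid'' n k l).ht + 0) (Rmid'' n k l).nt
      (twoPeak (((0 : ℕ) : ℤ) + _) _ _ _ _) = _
    rw [e1, e2, botState_word, Nat.cast_zero, zero_add, add_zero, Nat.add_comm l, Nat.add_comm l, e3]
  · change (Rmid'' n k l).nt = n
    exact e2
  · change n - 2 * bs.length = _; omega
  · rw [e1, e2]; omega

/-- The value of `φ` at what remains of the floor state `F` after removal of the bottom returns `bs`,
or `0` if these returns cannot be removed. -/
def atRest (bs : List ℕ) (F : Conn) (φ : (ℤ → ℤ) → ℤ[T;T⁻¹]) : ℤ[T;T⁻¹] := by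
  classical exact if h : ∃ G, F.word = insBot bs G then φ h.choose else 0

theorem atRest_eq {bs : List ℕ} {F : Conn} {G : ℤ → ℤ} (h : F.word = insBot bs G)
    (φ : (ℤ → ℤ) → ℤ[T;T⁻¹]) : atRest bs F φ = φ G := by
  have hx : ∃ G, F.word = insBot bs G := ⟨G, h⟩
  rw [atRest, dif_pos hx, insBot_injective (hx.choose_spec.symm.trans h)]

theorem atRest_eq_zero {bs : List ℕ} {F : Conn} (h : ¬ ∃ G, F.word = insBot bs G)
    (φ : (ℤ → ℤ) → ℤ[T;T⁻¹]) : atRest bs F φ = 0 := dif_neg h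

/-- Removal of bottom returns leaves a floor state. -/
theorem floor_rest {F : Conn} (hF : F.IsFloor) {bs : List ℕ} (hv : ValidBot F.nb bs) {G : ℤ → ℤ}
    (h : F.word = insBot bs G) {z : ℤ} (h1 : (F.ht : ℤ) < z) (h2 : z ≤ F.ht + F.nt) :
    G z ≤ F.ht ∨ F.ht + F.nt < G z := by
  have h3 := hF.word h1 h2
  by_cases h4 : 1 ≤ G z
  · rwa [← skBot_of_pos hv (x := z) (by omega), h, insBot_skBot, skBot_of_pos hv h4] at h3
  · omega

/-- The product of `R'` and what remains of a floor state after removal of bottom returns. -/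
theorem Theta_Rtop' {n k : ℕ} (hk : k ≤ n) {bs : List ℕ} (hv : ValidBot n bs)
    (hl : bs.length ≤ min k (n - k)) {F : Conn} (hF : F.IsFloor)
    (ht : F.nt = (k - (n - k)) + (n - k - k)) (hb : F.nb = n) :
    Theta (Rtop' n k bs.length) (botSet n bs hv) (some F) =
      atRest bs F fun G => wordCoeff F.ht (n - 2 * bs.length)
        (twoPeak (F.ht + (k - (n - k) : ℕ)) (min k (n - k) - bs.length) 0 0 G) := by
  subst hb
  by_cases hx : ∃ G, F.word = insBot bs G
  · obtain ⟨G, hG⟩ := hx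
    rw [atRest_eq hG]
    have hw : IsWord (F.nb - 2 * bs.length : ℕ) (2 * F.ht + F.nt) G := by
      rw [← isWord_insBot (by omega) hv, ← hG]; exact F.isWord
    set D := ofWord F.ht F.nt (F.nb - 2 * bs.length) G hw with hD
    have hDw : D.word = G := ofWord_word hw
    have hr : remove (some F) (botSet F.nb bs hv) = some D :=
      (remove_botSet hv).2 ⟨rfl, rfl, rfl, by rw [hDw, hG]⟩
    have hDf : D.IsFloor := Conn.isFloor_of_word fun z h1 h2 => by
      rw [hDw]; exact floor_rest hF hv hG h1 h2
    set l := bs.length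
    have m1 : min (k - l) (F.nb - k - l) = min k (F.nb - k) - l := by omega
    have m2 : k - l - min (k - l) (F.nb - k - l) = k - (F.nb - k) := by omega
    have m3 : F.nb - k - l - min (k - l) (F.nb - k - l) = F.nb - k - k := by omega
    have e2 : (Rtop' F.nb k l).nt = F.nb - 2 * l := by
      change k - l + (F.nb - k - l) = _; omega
    have hword := nestState_word (k - l) (F.nb - k - l)
    rw [m1, ← m1, m2, m3, m1] at hword
    rw [Theta, hr, bracket_vprod_twoPeak (C := Rtop' F.nb k l) (F := D) hword ?_ ht ?_ hDf]
    · change wordCoeff (0 + F.ht) (Rtop' F.nb k l).nt (twoPeak (F.ht + _) _ _ _ _) = _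
      rw [hDw, e2, zero_add]
    · exact e2
    · change k - l + (F.nb - k - l) - 2 * min (k - l) (F.nb - k - l) = _; omega
    · change 2 * 0 + (Rtop' F.nb k l).nt = _
      rw [e2]; omega
  · rw [atRest_eq_zero hx, Theta_eq_zero_of_remove]
    rcases hG : remove (some F) (botSet F.nb bs hv) with _ | G
    · rfl
    · exact absurd ⟨_, ((remove_botSet hv).1 hG).2.2.2⟩ hx

/-! ### Existence of the expansion -/

/-- The floor states with `t` top and `n` bottom points. -/
abbrev FloorState (t n : ℕ) : Type := {F : Conn // F.IsFloor ∧ F.nt = t ∧ F.nb = n}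

/-- Combinations of the functions `Θ(R'_{n,k,|I|}, I; ·)` on floor states. -/
def thetaSpan (n k : ℕ) :
    Submodule ℤ[T;T⁻¹] (FloorState ((k - (n - k)) + (n - k - k)) n → ℤ[T;T⁻¹]) :=
  Submodule.span _ ((fun I F => Theta (Rtop' n k I.card) I (some F.1)) '' (indexSets n k : Set (Finset ℕ)))

theorem atRest_sum {ι : Type*} (bs : List ℕ) (F : Conn) (s : Finset ι) (w : ι → ℤ[T;T⁻¹])
    (φ : ι → (ℤ → ℤ) → ℤ[T;T⁻¹]) :
    atRest bs F (fun G => ∑ i ∈ s, w i * φ i G) = ∑ i ∈ s, w i * atRest bs F (φ i) := by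
  by_cases h : ∃ G, F.word = insBot bs G
  · obtain ⟨G, hG⟩ := h
    simp only [atRest_eq hG]
  · simp only [atRest_eq_zero h, mul_zero, Finset.sum_const_zero]

/-- The coefficients of the words that occur in the row expansion of the product of `R` with a floor
state are combinations of the functions `Θ(R'_{n,k,|I|}, I; ·)`. The numbers `ρ` and `bs` are those of
the remaining rows above the floor state and of the bottom returns removed from it. -/
theorem atRest_mem_thetaSpan {n k : ℕ} (hk : k ≤ n) {ρ c p q : ℕ} {bs : List ℕ} (hv : ValidBot n bs)
    (hpq : p + q ≤ ρ)
    (hN : n - 2 * bs.length + 2 * ρ = (k - (n - k)) + (n - k - k) + 2 * (c + p + q)) :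
    (fun F => atRest bs F.1 fun G => wordCoeff (F.1.ht + ρ) (n - 2 * bs.length)
      (twoPeak (F.1.ht + (k - (n - k) : ℕ)) c p q G)) ∈ thetaSpan n k := by
  induction ρ generalizing c p q bs with
  | zero =>
    have hle := hv.length_le
    have hl : bs.length ≤ min k (n - k) := by omega
    obtain ⟨rfl, rfl⟩ : p = 0 ∧ q = 0 := by omega
    refine Submodule.subset_span ⟨botSet n bs hv, ?_, ?_⟩
    · rw [indexSets, Finset.mem_coe, Finset.mem_filter, botSet_card]
      exact ⟨botSet_mem_LL hv, hl⟩
    · funext F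
      have hc : c = min k (n - k) - bs.length := by omega
      simp only [botSet_card]
      rw [Theta_Rtop' hk hv hl F.2.1 F.2.2.1 F.2.2.2, hc, add_zero]
  | succ ρ ih =>
    have hle := hv.length_le
    set t := (k - (n - k)) + (n - k - k) with ht
    set N := n - 2 * bs.length with hN0
    have e1 : (fun F : FloorState t n => atRest bs F.1 fun G => wordCoeff (F.1.ht + (ρ + 1)) N
        (twoPeak (F.1.ht + (k - (n - k) : ℕ)) c p q G)) =
        ∑ s₁ ∈ (Finset.Icc 1 N).powerset, (LaurentPolynomial.T (2 * (s₁.card : ℤ) - N) : ℤ[T;T⁻¹]) •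
          (fun F : FloorState t n => atRest bs F.1 fun G => rowTerm (F.1.ht + ρ) N s₁
            (twoPeak (F.1.ht + (k - (n - k) : ℕ)) c p q G)) := by
      funext F
      simp only [Finset.sum_apply, Pi.smul_apply, smul_eq_mul]
      rw [← atRest_sum]
      congr 1
      funext G
      rw [← add_assoc, wordCoeff_succ]
    rw [e1]
    refine Submodule.sum_mem _ fun s₁ hs => Submodule.smul_mem _ _ ?_
    rcases rowTerm_twoPeak (e := k - (n - k)) (by omega) hN (Finset.mem_powerset.1 hs) with
      h | ⟨c', p', q', h1, h2, h⟩ | ⟨p', q', b, rfl, rfl, h1, h2, h⟩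
    · convert Submodule.zero_mem _ with F
      obtain ⟨F, hF, hFt, rfl⟩ := F
      by_cases hx : ∃ G, F.word = insBot bs G
      · obtain ⟨G, hG⟩ := hx
        rw [atRest_eq hG]
        refine h F.ht G fun x h3 h4 h5 => ?_
        have := floor_rest hF hv hG (z := x) h3 (by omega)
        omega
      · exact atRest_eq_zero hx _
    · have := ih (c := c') (p := p') (q := q') hv (by omega) (by omega)
      simpa only [h] using this
    · have hv' := hv.append h1 (by omega)
      have hlen : (bs ++ [b]).length = bs.length + 1 := by simp
      have := ih (c := c) (p := p') (q := q') hv' (by omega) (by omega)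
      convert this using 2 with F
      obtain ⟨F, hF, hFt, rfl⟩ := F
      by_cases hx : ∃ G, F.word = insBot bs G
      · obtain ⟨G, hG⟩ := hx
        rw [atRest_eq hG]
        by_cases hb : G (-(b : ℤ)) = -b + 1
        · have hGi : ∀ x, G (G x) = x := by
            have := F.isWord
            rw [hG, isWord_insBot (by omega) hv] at this
            exact this.invol
          obtain ⟨G', rfl⟩ := exists_eq_ins hGi hb
          rw [← insBot_append] at hG
          rw [atRest_eq hG, (h _ _).1 G' rfl, hlen]
          congr 1
        · rw [(h _ _).2 hb, atRest_eq_zero]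
          rintro ⟨G', hG'⟩
          rw [insBot_append, hG] at hG'
          rw [insBot_injective hG', ins_self] at hb
          exact hb rfl
      · rw [atRest_eq_zero hx, atRest_eq_zero]
        rintro ⟨G', hG'⟩
        rw [insBot_append] at hG'
        exact hx ⟨_, hG'⟩

theorem card_of_mem_indexSets {n k : ℕ} {I : Finset ℕ} (h : I ∈ indexSets n k) :
    I ∈ LL n ∧ I.card ≤ min k (n - k) := by
  rwa [indexSets, Finset.mem_filter] at h

theorem Rmid_dims {n k : ℕ} (hk : k ≤ n) :
    (Rmid n k).nt = n ∧ (Rmid n k).nb = (k - (n - k)) + (n - k - k) := by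
  refine ⟨?_, rfl⟩
  change n - k + k = n; omega

theorem Rtop'_dims {n k l : ℕ} (hk : k ≤ n) (hl : l ≤ min k (n - k)) :
    (Rtop' n k l).nt + 2 * l = n ∧ (Rtop' n k l).nb = (k - (n - k)) + (n - k - k) := by
  have e1 : (Rtop' n k l).nt = k - l + (n - k - l) := rfl
  have e2 : (Rtop' n k l).nb = k - l + (n - k - l) - 2 * min (k - l) (n - k - l) := rfl
  rw [e1, e2]; omega

/-- The row expansion starts with all `n` rows of `R` and without removed bottom returns. -/
theorem exists_isExpansion {n k : ℕ} (hk : k ≤ n) : ∃ Z, IsExpansion n k Z := by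
  have hm := atRest_mem_thetaSpan hk (validBot_nil n) (ρ := n) (c := min k (n - k)) (p := n - k)
    (q := k) (by omega) (by simp only [List.length_nil]; omega)
  rw [thetaSpan, Submodule.mem_span_image_finset_iff_exists_fun'] at hm
  obtain ⟨Z, hZ⟩ := hm
  refine ⟨Z, fun F hF => ?_⟩
  rcases F with _ | F
  · have h0 : ∀ R I, Theta R I none = 0 := fun R I => rfl
    simp only [h0, mul_zero, Finset.sum_const_zero]
  by_cases hd : F.nt = (k - (n - k)) + (n - k - k) ∧ F.nb = n
  · have hFl := hF F rfl
    have := congrFun hZ ⟨F, hFl, hd.1, hd.2⟩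
    rw [atRest_eq (F := F) (bs := []) rfl] at this
    rw [Theta_Rmid hk hFl hd.1 hd.2]
    simp only [Finset.sum_apply, Pi.smul_apply, smul_eq_mul] at this
    exact this.symm
  · rw [Theta_eq_zero, Finset.sum_eq_zero]
    · intro I hI
      have h1 := (card_of_mem_indexSets hI).2
      have h2 := Rtop'_dims hk h1
      rw [Theta_eq_zero (by omega), mul_zero]
    · have := Rmid_dims hk
      simp only [Finset.card_empty]
      omega

/-! ### Uniqueness of the expansion -/

/-- The floor state whose word is that of the bottom state with the returns `bs`; its left, right and top
points are the top points of the bottom state. -/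
def testState (h t n : ℕ) (bs : List ℕ) (hv : ValidBot n bs) (e : 2 * h + t = n - 2 * bs.length) : Conn :=
  ofWord h t n (botState n bs hv).word <| by
    have := (isBottomState_botState hv).isWord
    have ht : (botState n bs hv).nt = 2 * h + t := e.symm
    rw [ht] at this
    exact_mod_cast this

/-- Triangularity and the values on the diagonal determine the coefficients of an expansion. -/
theorem IsExpansion.eq {n k : ℕ} (hk : k ≤ n) {Z : Finset ℕ → ℤ[T;T⁻¹]} (hZ : IsExpansion n k Z)
    {I : Finset ℕ} (hI : I ∈ indexSets n k) :
    Z I = LaurentPolynomial.T (((n : ℤ) - 2 * k) * ((min k (n - k) : ℕ) - (I.card : ℤ))) *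
      bracket (vprod (some (Rmid'' n k I.card)) (phiInv n I)) := by
  obtain ⟨hLL, hcard⟩ := card_of_mem_indexSets hI
  obtain ⟨bs, hv, rfl⟩ := exists_botSet hLL
  rw [botSet_card] at hcard
  have hlen := hv.length_le
  set l := bs.length with hl
  set t := (k - (n - k)) + (n - k - k) with ht
  have hdim : 2 * (min k (n - k) - l) + t = n - 2 * l := by omega
  set F := testState (min k (n - k) - l) t n bs hv hdim with hFdef
  have hFw : F.word = insBot bs (mirror (n - 2 * l)) := by
    rw [hFdef, testState, ofWord_word, botState_word]
  have hFh : F.ht = min k (n - k) - l := rfl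
  have hFt : F.nt = t := rfl
  have hFb : F.nb = n := rfl
  have hneg : ∀ z : ℤ, 1 ≤ z → z ≤ (n - 2 * l : ℕ) → F.word z ≤ 0 := by
    intro z h1 h2
    rw [hFw, ← skBot_of_pos hv h1, insBot_skBot]
    exact skBot_nonpos _ (mirror_top _ _ h1 h2)
  have hFl : F.IsFloor := Conn.isFloor_of_word fun z h1 h2 => by
    have := hneg z (by omega) (by omega)
    omega
  have hsum := hZ (some F) fun F₀ h => by
    rw [← Option.some_injective _ h]; exact hFl
  have he : ((F.ht : ℕ) : ℤ) + (k - (n - k) : ℕ) = (k - l : ℕ) := by rw [hFh]; omega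
  rw [Finset.sum_eq_single_of_mem _ hI, botSet_card, Theta_Rmid hk hFl hFt hFb,
    Theta_Rtop' hk hv hcard hFl hFt hFb, atRest_eq hFw, he, hFh,
    wordCoeff_nest (by omega)] at hsum
  · rw [botSet_card, bracket_Rmid'' hk hv hcard]
    have hw : wordCoeff (min k (n - k) - l + n) n
        (twoPeak (k - l : ℕ) (min k (n - k)) (n - k) k F.word) =
        wordCoeff (min k (n - k) + (n - k - l) + (k - l) + l) n
        (twoPeak (k - l : ℕ) (min k (n - k)) (n - k - l + l) (k - l + l)
          (insBot bs (mirror (n - k - l + (k - l))))) := by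
      rw [hFw, show n - k - l + l = n - k by omega, show k - l + l = k by omega,
        show n - k - l + (k - l) = n - 2 * l by omega,
        show min k (n - k) + (n - k - l) + (k - l) + l = min k (n - k) - l + n by omega]
    rw [← hw, hsum, mul_left_comm, ← LaurentPolynomial.T_add]
    have : ((n : ℤ) - 2 * k) * ((min k (n - k) : ℕ) - (l : ℤ)) +
        (2 * ((k - l : ℕ) : ℤ) - (n - 2 * l : ℕ)) * (min k (n - k) - l : ℕ) = 0 := by
      have e1 : ((k - l : ℕ) : ℤ) = k - l := by omega
      have e2 : ((n - 2 * l : ℕ) : ℤ) = n - 2 * l := by omega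
      have e3 : ((min k (n - k) - l : ℕ) : ℤ) = (min k (n - k) : ℕ) - l := by omega
      rw [e1, e2, e3]; ring
    rw [this, LaurentPolynomial.T_zero, mul_one]
  · -- the other summands vanish: no returns outside of `I` can be removed from the test state, and fewer
    -- returns leave a nest of arcs that is deeper than the test state is high
    intro J hJ hne
    obtain ⟨hJL, hJc⟩ := card_of_mem_indexSets hJ
    obtain ⟨bs', hv', rfl⟩ := exists_botSet hJL
    rw [botSet_card] at hJc ⊢
    rw [Theta_Rtop' hk hv' hJc hFl hFt hFb]
    by_cases hx : ∃ G, F.word = insBot bs' G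
    swap
    · rw [atRest_eq_zero hx, mul_zero]
    obtain ⟨G, hG⟩ := hx
    have hG0 : ∀ z : ℤ, 1 ≤ z → z ≤ (n - 2 * l : ℕ) → G z ≤ 0 := by
      intro z h1 h2
      have := hneg z h1 h2
      rw [hG, ← skBot_of_pos hv' h1, insBot_skBot] at this
      by_contra hc
      rw [skBot_of_pos hv' (by omega)] at this
      exact hc this
    have hlt : bs'.length < l := by
      have hsub : botSet n bs' hv' ⊆ botSet n bs hv := by
        have hw : IsWord (n - 2 * bs'.length : ℕ) (2 * F.ht + F.nt) G := by
          rw [← isWord_insBot (by omega) hv', ← hG]; exact F.isWord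
        have hr : remove (some F) (botSet n bs' hv') =
            some (ofWord F.ht F.nt (n - 2 * bs'.length) G hw) :=
          (remove_botSet (F := F) hv').2 ⟨rfl, rfl, rfl, by rw [ofWord_word, hG]⟩
        intro i hi
        have := subset_of_remove_eq_some hr hi
        rw [mem_phi, hFw] at this
        rwa [botSet, mem_phi, botState_word]
      have := Finset.card_lt_card (hsub.ssubset_of_ne hne)
      rwa [botSet_card, botSet_card] at this
    rw [atRest_eq hG, he, hFh, wordCoeff_nest_eq_zero (t := n - 2 * l) (by omega) (by omega)
      (by omega), mul_zero]
    intro x h1 h2 h3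
    have := hG0 x (by omega) (by omega)
    omega

theorem bracket_Rmid''_ne_zero {n k : ℕ} (hk : k ≤ n) {I : Finset ℕ} (hI : I ∈ indexSets n k) :
    bracket (vprod (some (Rmid'' n k I.card)) (phiInv n I)) ≠ 0 := by
  obtain ⟨hLL, hcard⟩ := card_of_mem_indexSets hI
  obtain ⟨bs, hv, rfl⟩ := exists_botSet hLL
  rw [botSet_card] at hcard ⊢
  rw [bracket_Rmid'' hk hv hcard]
  intro h
  have := evalOne_pos (min k (n - k)) (n - k - bs.length) (k - bs.length) hv (by omega)
  rw [h, map_zero] at this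
  exact lt_irrefl _ this

/-! ### The relation `⊴` and the types of the states -/

theorem isMiddle_cornerState (a b c e f : ℕ) (h : a + e = b + f) :
    (cornerState a b c e f h).IsMiddle := by
  constructor
  · intro i j hi hij
    have hi' : 1 ≤ i ∧ i ≤ e + f := hi
    have hij' : cornerMate a b c e f (.bot i) = .bot j := hij
    simp only [cornerMate] at hij'
    split_ifs at hij'; omega
  · intro i j hi hij
    have hi' : 1 ≤ i ∧ i ≤ a + b := hi
    have hij' : cornerMate a b c e f (.top i) = .top j := hij
    simp only [cornerMate] at hij'
    split_ifs at hij'; omega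

theorem isRoof_nestState (p q : ℕ) : (nestState p q).IsRoof := by
  intro i j hi hij
  have hi' : 1 ≤ i ∧ i ≤ p + q - 2 * min p q := hi
  have hij' : nestMate p q (.bot i) = .bot j := hij
  simp only [nestMate] at hij'
  split_ifs at hij'; omega

theorem ominus_empty {n : ℕ} {I : Finset ℕ} (hI : I ∈ LL n) : ominus I ∅ = some I := by
  have hmin : I ∈ LL (minLevel I) := Nat.sInf_mem (s := {n | I ∈ LL n}) ⟨n, hI⟩
  obtain ⟨F, h1, h2, h3⟩ := mem_LL.1 hmin
  have h4 := phiInv_phi h1 h2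
  rw [h3] at h4
  rw [ominus, h4, remove_empty, Option.map_some, h3]

theorem below_Rtop' {n k : ℕ} (hk : k ≤ n) {I : Finset ℕ} (hI : I ∈ indexSets n k) :
    Below (Rmid n k) ∅ (Rtop' n k I.card) I := by
  obtain ⟨hLL, hcard⟩ := card_of_mem_indexSets hI
  have h1 := Rmid_dims hk
  have h2 := Rtop'_dims hk hcard
  refine ⟨(isMiddle_cornerState _ _ _ _ _ _).1, isRoof_nestState _ _,
    ⟨I, ominus_empty hLL, by rwa [h1.1]⟩, ?_, by rw [h1.2, h2.2]⟩
  rw [h1.1, h2.1]; simp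

end
end LatticeCrossing

theorem lemma4p3 (n k : ℕ) (hk : k ≤ n) :
    (LatticeCrossing.Rmid n k).IsMiddle ∧
    (∀ I ∈ LatticeCrossing.indexSets n k,
      (LatticeCrossing.Rtop' n k I.card).IsTopState ∧
      (LatticeCrossing.Rmid'' n k I.card).IsMiddle ∧
      LatticeCrossing.Below (LatticeCrossing.Rmid n k) ∅ (LatticeCrossing.Rtop' n k I.card) I) ∧
    (∃ Z : Finset ℕ → LaurentPolynomial ℤ, LatticeCrossing.IsExpansion n k Z) ∧
    (∀ Z : Finset ℕ → LaurentPolynomial ℤ, LatticeCrossing.IsExpansion n k Z →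
      ∀ I ∈ LatticeCrossing.indexSets n k,
        Z I =
          LaurentPolynomial.T
            (((n : ℤ) - 2 * (k : ℤ)) * ((min k (n - k) : ℕ) - (I.card : ℤ))) *
            LatticeCrossing.bracket
              (LatticeCrossing.vprod (some (LatticeCrossing.Rmid'' n k I.card))
                (LatticeCrossing.phiInv n I)) ∧
        Z I ≠ 0) := by
  refine ⟨LatticeCrossing.isMiddle_cornerState _ _ _ _ _ _, fun I hI =>
    ⟨⟨LatticeCrossing.isRoof_nestState _ _, rfl⟩, LatticeCrossing.isMiddle_cornerState _ _ _ _ _ _,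
      LatticeCrossing.below_Rtop' hk hI⟩,
    LatticeCrossing.exists_isExpansion hk, fun Z hZ I hI => ⟨hZ.eq hk hI, ?_⟩⟩
  rw [hZ.eq hk hI]
  exact mul_ne_zero (LaurentPolynomial.isUnit_T _).ne_zero
    (LatticeCrossing.bracket_Rmid''_ne_zero hk hI)
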